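/- Let $d\ge 1$, $\alpha=(\alpha_1,\dots,\alpha_d)\in(-1,\infty)^d$ and $\mathbb{R}^d_+=(0,\infty)^d$, and let $\mu_\alpha$ be the measure $d\mu_\alpha(x)=x_1^{\alpha_1}\cdots x_d^{\alpha_d}\,e^{-(x_1+\cdots+x_d)}\,dx$ on $\mathbb{R}^d_+$. For $a>-1$ let $L_n^a(x)=\sum_{k=0}^n(-1)^k\binom{n+a}{n-k}\frac{x^k}{k!}$, $n=0,1,2,\dots$, be the Laguerre polynomials, and let $\breve L_n^a=L_n^a/\|L_n^a\|$ be normalized in $L^2((0,\infty),x^ae^{-x}\,dx)$. For $t>0$ and $x,y\in\mathbb{R}^d_+$ put $$G_t^\alpha(x,y)=\prod_{i=1}^d\ \sum_{n=0}^\infty e^{-tn}\,\breve L_n^{\alpha_i}(x_i)\,\breve L_n^{\alpha_i}(y_i),\qquad T_t^\alpha f(x)=\int_{\mathbb{R}^d_+}G_t^\alpha(x,y)f(y)\,d\mu_\alpha(y),$$ so that $T_t^\alpha$ is the classical Laguerre semigroup, and let $T_*^\alpha f(x)=\sup_{t>0}|T_t^\alpha f(x)|\in[0,\infty]$. Then the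 series defining $G_t^\alpha$ converge absolutely for all $t>0$ and $x,y\in\mathbb{R}^d_+$; for every complex-valued $f\in L^1(d\mu_\alpha)$ the integral defining $T_t^\alpha f(x)$ converges absolutely for all $t>0$ and $x\in\mathbb{R}^d_+$; and $T_*^\alpha$ is of weak type $(1,1)$ with respect to $\mu_\alpha$: there is a constant $C$, depending only on $d$ and $\alpha$, such that $$\mu_\alpha\{x\in\mathbb{R}^d_+ : T_*^\alpha f(x)>\lambda\}\le\frac{C}{\lambda}\int_{\mathbb{R}^d_+}|f(x)|\,d\mu_\alpha(x),\qquad \lambda>0,\quad f\in L^1(d\mu_\alpha).$$ -/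

import Mathlib

open MeasureTheory

noncomputable section

/-- The Laguerre polynomial
`L_n^a(x) = ∑_{k=0}^n (-1)^k * binom(n + a, n - k) * x^k / k!`, with the generalized binomial
coefficient `binom(n + a, n - k) = (n + a)(n + a - 1) ⋯ (a + k + 1) / (n - k)!`. -/
def laguerrePoly (a : ℝ) (n : ℕ) (x : ℝ) : ℝ :=
  ∑ k ∈ Finset.range (n + 1),
    (-1) ^ k * ((ascPochhammer ℝ (n - k)).eval (a + k + 1) / (n - k).factorial) *
      (x ^ k / k.factorial)

/-- The norm of `L_n^a` in `L²((0,∞), x^a e^{-x} dx)`. -/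
def laguerreNorm (a : ℝ) (n : ℕ) : ℝ :=
  √(∫ x in Set.Ioi (0 : ℝ), laguerrePoly a n x ^ 2 * (x ^ a * Real.exp (-x)))

/-- The Laguerre polynomial normalized in `L²((0,∞), x^a e^{-x} dx)`. -/
def laguerreNormalized (a : ℝ) (n : ℕ) (x : ℝ) : ℝ :=
  laguerrePoly a n x / laguerreNorm a n

/-- The `n`-th term of the spectral series of the one-dimensional Laguerre heat kernel. -/
def laguerreKernelTerm (a t x y : ℝ) (n : ℕ) : ℝ :=
  Real.exp (-(t * n)) * laguerreNormalized a n x * laguerreNormalized a n y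

/-- The one-dimensional Laguerre heat kernel (relative to the measure `x^a e^{-x} dx`). -/
def laguerreKernel₁ (a t x y : ℝ) : ℝ :=
  ∑' n : ℕ, laguerreKernelTerm a t x y n

/-- The `d`-dimensional Laguerre heat kernel, the tensor product of one-dimensional ones. -/
def laguerreKernel {d : ℕ} (α : Fin d → ℝ) (t : ℝ) (x y : Fin d → ℝ) : ℝ :=
  ∏ i, laguerreKernel₁ (α i) t (x i) (y i)

/-- `(0,∞)^d`. -/
def posOrthant (d : ℕ) : Set (Fin d → ℝ) := {x | ∀ i, 0 < x i}

/-- The measure `x^α e^{-(x_1 + … + x_d)} dx` on `(0,∞)^d`, extended by zero to `ℝ^d`. -/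
def laguerreMeasure {d : ℕ} (α : Fin d → ℝ) : Measure (Fin d → ℝ) :=
  (volume.restrict (posOrthant d)).withDensity
    fun x => ENNReal.ofReal ((∏ i, x i ^ α i) * Real.exp (-∑ i, x i))

/-- The classical Laguerre semigroup `T_t^α`, pointwise, through its integral kernel. -/
def laguerreSemigroup {d : ℕ} (α : Fin d → ℝ) (t : ℝ) (f : (Fin d → ℝ) → ℂ)
    (x : Fin d → ℝ) : ℂ :=
  ∫ y, (laguerreKernel α t x y : ℂ) * f y ∂(laguerreMeasure α)

/-- The maximal operator `T_*^α f = sup_{t > 0} |T_t^α f|`, with values in `[0,∞]`. -/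
def laguerreMaximal {d : ℕ} (α : Fin d → ℝ) (f : (Fin d → ℝ) → ℂ)
    (x : Fin d → ℝ) : ENNReal :=
  ⨆ (t : ℝ) (_ : 0 < t), ‖laguerreSemigroup α t f x‖ₑ

end

open MeasureTheory Filter Topology

/-- The Laguerre polynomial as an element of `ℝ[X]`. -/
noncomputable def laguerrePolynomial (a : ℝ) (n : ℕ) : Polynomial ℝ :=
  ∑ k ∈ Finset.range (n + 1), Polynomial.C
    (Real.Gamma (n + a + 1) / n.factorial * ((-1) ^ k * n.choose k / Real.Gamma (k + a + 1))) *
      Polynomial.X ^ k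

theorem ascPochhammer_eval_eq_Gamma_div {z : ℝ} (hz : 0 < z) (n : ℕ) :
    (ascPochhammer ℝ n).eval z = Real.Gamma (z + n) / Real.Gamma z := by
  induction n with
  | zero => simp [(Real.Gamma_pos_of_pos hz).ne']
  | succ n ih =>
    have h : z + n ≠ 0 := by positivity
    rw [ascPochhammer_succ_right, Polynomial.eval_mul, ih]
    simp only [Polynomial.eval_add, Polynomial.eval_X, Polynomial.eval_natCast]
    rw [Nat.cast_succ, ← add_assoc, Real.Gamma_add_one h]
    ring

theorem laguerrePoly_eq_sum {a : ℝ} (ha : -1 < a) (n : ℕ) (x : ℝ) :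
    laguerrePoly a n x = ∑ k ∈ Finset.range (n + 1),
      Real.Gamma (n + a + 1) / n.factorial * ((-1) ^ k * n.choose k / Real.Gamma (k + a + 1)) *
        x ^ k := by
  refine Finset.sum_congr rfl fun k hk => ?_
  have hkn : k ≤ n := Nat.lt_succ_iff.1 (Finset.mem_range.1 hk)
  have hpos : 0 < a + k + 1 := by have := k.cast_nonneg (α := ℝ); linarith
  rw [ascPochhammer_eval_eq_Gamma_div hpos, Nat.cast_choose ℝ hkn, Nat.cast_sub hkn]
  have e1 : a + k + 1 + ((n : ℝ) - k) = n + a + 1 := by ring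
  have e2 : a + k + 1 = (k : ℝ) + a + 1 := by ring
  rw [e1, e2]
  have := n.factorial_ne_zero
  field_simp

theorem laguerrePolynomial_eval {a : ℝ} (ha : -1 < a) (n : ℕ) (x : ℝ) :
    (laguerrePolynomial a n).eval x = laguerrePoly a n x := by
  rw [laguerrePoly_eq_sum ha, laguerrePolynomial, Polynomial.eval_finsetSum]
  simp

theorem laguerrePolynomial_coeff (a : ℝ) (n k : ℕ) :
    (laguerrePolynomial a n).coeff k =
      Real.Gamma (n + a + 1) / n.factorial *
        ((-1) ^ k * n.choose k / Real.Gamma (k + a + 1)) := by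
  rw [laguerrePolynomial, Polynomial.finsetSum_coeff]
  simp only [Polynomial.coeff_C_mul, Polynomial.coeff_X_pow, mul_ite, mul_one, mul_zero]
  rw [Finset.sum_ite_eq]
  split_ifs with h
  · rfl
  · rw [Nat.choose_eq_zero_of_lt (by simpa using h)]; simp

theorem laguerrePolynomial_succ {a : ℝ} (ha : -1 < a) (n : ℕ) :
    ((n : ℝ) + 1) • laguerrePolynomial a (n + 1) =
      (a + 1 + n) • laguerrePolynomial a n - Polynomial.X * laguerrePolynomial a n +
        Polynomial.X * Polynomial.derivative (laguerrePolynomial a n) := by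
  have hn : (0 : ℝ) < n + a + 1 := by have := n.cast_nonneg (α := ℝ); linarith
  have hG : Real.Gamma (((n + 1 : ℕ) : ℝ) + a + 1) = (n + a + 1) * Real.Gamma (n + a + 1) := by
    rw [← Real.Gamma_add_one hn.ne']; congr 1; push_cast; ring
  have hf : (n.factorial : ℝ) ≠ 0 := by exact_mod_cast n.factorial_ne_zero
  ext k
  cases k with
  | zero =>
    have h0 : Real.Gamma (a + 1) ≠ 0 := (Real.Gamma_pos_of_pos (by linarith)).ne'
    simp [laguerrePolynomial_coeff, -Nat.cast_add, hG, Nat.factorial_succ]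
    field_simp
    push_cast
    ring
  | succ k =>
    have hk : (0 : ℝ) < k + a + 1 := by have := k.cast_nonneg (α := ℝ); linarith
    have hGk : Real.Gamma (((k + 1 : ℕ) : ℝ) + a + 1) = (k + a + 1) * Real.Gamma (k + a + 1) := by
      rw [← Real.Gamma_add_one hk.ne']; congr 1; push_cast; ring
    have h0 : Real.Gamma (k + a + 1) ≠ 0 := (Real.Gamma_pos_of_pos hk).ne'
    have hc : ((k : ℝ) + 1) * n.choose (k + 1) = (n - k) * n.choose k := by
      rcases le_or_gt k n with h | h
      · have := Nat.choose_succ_right_eq n k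
        rw [← Nat.cast_sub h]
        have h2 : ((n.choose (k + 1) * (k + 1) : ℕ) : ℝ) = ((n.choose k * (n - k) : ℕ) : ℝ) := by
          rw [this]
        push_cast at h2 ⊢
        linarith
      · rw [Nat.choose_eq_zero_of_lt h, Nat.choose_eq_zero_of_lt (by omega)]; simp
    simp only [Polynomial.coeff_add, Polynomial.coeff_sub, Polynomial.coeff_smul,
      Polynomial.coeff_X_mul, Polynomial.coeff_derivative, laguerrePolynomial_coeff, hG, hGk,
      smul_eq_mul, Nat.factorial_succ, Nat.choose_succ_succ]
    push_cast
    have hc' : (n.choose (k + 1) : ℝ) = (n - k) * n.choose k / (k + 1) := by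
      rw [← hc]; field_simp
    rw [hc']
    field_simp
    ring

/-- The generating function of the Laguerre polynomials with parameter `a`, in a form that is
stable under differentiation. -/
theorem iteratedDeriv_laguerreGenerating {a : ℝ} (ha : -1 < a) (x : ℝ) (n : ℕ) :
    ∀ z ∈ Metric.ball (0 : ℂ) 1,
      iteratedDeriv n (fun z : ℂ => (1 - z) ^ (-((a : ℂ) + 1)) *
        Complex.exp (-(x * z / (1 - z)))) z =
      n.factorial * ((1 - z) ^ (-((a : ℂ) + 1 + n)) * Complex.exp (-(x * z / (1 - z))) *
        Polynomial.aeval ((x : ℂ) / (1 - z)) (laguerrePolynomial a n)) := by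
  induction n with
  | zero =>
    intro z hz
    have h0 : Real.Gamma (a + 1) ≠ 0 := (Real.Gamma_pos_of_pos (by linarith)).ne'
    simp [laguerrePolynomial, h0]
  | succ n ih =>
    intro z hz
    have hslit : 1 - z ∈ Complex.slitPlane := by
      have h1 : z.re ≤ ‖z‖ := Complex.re_le_norm z
      have h2 : ‖z‖ < 1 := by simpa using hz
      left
      simp only [Complex.sub_re, Complex.one_re]
      linarith
    have hne : 1 - z ≠ 0 := Complex.slitPlane_ne_zero hslit
    rw [iteratedDeriv_succ]
    have hev := (Filter.eventuallyEq_of_mem (Metric.isOpen_ball.mem_nhds hz) ih).deriv_eq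
    rw [hev]
    have hlin : HasDerivAt (fun z : ℂ => 1 - z) (-1) z := by
      simpa using (hasDerivAt_id z).const_sub 1
    have hX : HasDerivAt (fun z : ℂ => (x : ℂ) / (1 - z)) (x / (1 - z) ^ 2) z := by
      have := (hasDerivAt_const z (x : ℂ)).div hlin hne
      refine this.congr_deriv ?_
      field_simp
      ring
    have hE : HasDerivAt (fun z : ℂ => -(x * z / (1 - z))) (-(x / (1 - z) ^ 2)) z := by
      have := ((((hasDerivAt_id z).const_mul (x : ℂ)).div hlin hne)).neg
      refine this.congr_deriv ?_
      simp only [id]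
      field_simp
      ring
    have hpow : HasDerivAt (fun z : ℂ => (1 - z) ^ (-((a : ℂ) + 1 + n)))
        (-((a : ℂ) + 1 + n) * (1 - z) ^ (-((a : ℂ) + 1 + n) - 1) * (-1)) z :=
      hlin.cpow_const hslit
    have hP := ((laguerrePolynomial a n).hasDerivAt_aeval ((x : ℂ) / (1 - z))).comp z hX
    have htot := ((hpow.mul hE.cexp).mul hP).const_mul (n.factorial : ℂ)
    refine htot.deriv.trans ?_
    have hrec := congrArg (Polynomial.aeval ((x : ℂ) / (1 - z))) (laguerrePolynomial_succ ha n)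
    simp only [map_smul, map_add, map_sub, map_mul, Polynomial.aeval_X, Complex.real_smul] at hrec
    push_cast at hrec
    have e1 : (1 - z) ^ (-((a : ℂ) + 1 + n) - 1) = (1 - z) ^ (-((a : ℂ) + 1 + (n + 1 : ℕ))) := by
      congr 1; push_cast; ring
    have e2 : (1 - z) ^ (-((a : ℂ) + 1 + n)) =
        (1 - z) ^ (-((a : ℂ) + 1 + (n + 1 : ℕ))) * (1 - z) := by
      rw [← e1, Complex.cpow_sub _ _ hne, Complex.cpow_one]
      field_simp
    simp only [Function.comp_apply, Pi.mul_apply]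
    rw [e1, e2, Nat.factorial_succ, Nat.cast_mul]
    have e3 : ∀ A B : ℂ, ((n + 1 : ℕ) : ℂ) * n.factorial * (A * B *
        Polynomial.aeval ((x : ℂ) / (1 - z)) (laguerrePolynomial a (n + 1))) =
        n.factorial * A * B * (((n : ℂ) + 1) *
          Polynomial.aeval ((x : ℂ) / (1 - z)) (laguerrePolynomial a (n + 1))) := by
      intro A B; push_cast; ring
    rw [e3, hrec]
    generalize (1 - z) ^ (-((a : ℂ) + 1 + (n + 1 : ℕ))) = A
    generalize Complex.exp (-(x * z / (1 - z))) = B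
    generalize (Polynomial.aeval ((x : ℂ) / (1 - z))) (laguerrePolynomial a n) = P
    generalize (Polynomial.aeval ((x : ℂ) / (1 - z)))
      (Polynomial.derivative (laguerrePolynomial a n)) = P'
    field_simp
    ring

theorem hasSum_laguerrePoly {a : ℝ} (ha : -1 < a) (x : ℝ) (k : ℕ) {r : ℝ} (hr : |r| < 1) :
    HasSum (fun m : ℕ => ((m + k).choose k : ℝ) * laguerrePoly a (m + k) x * r ^ m)
      ((1 - r) ^ (-(a + 1 + k)) * Real.exp (-(x * r / (1 - r))) *
        laguerrePoly a k (x / (1 - r))) := by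
  set g : ℂ → ℂ := fun z => (1 - z) ^ (-((a : ℂ) + 1)) * Complex.exp (-(x * z / (1 - z))) with hg
  have hdiff : DifferentiableOn ℂ g (Metric.ball 0 1) := by
    intro z hz
    have hslit : 1 - z ∈ Complex.slitPlane := by
      have h1 : z.re ≤ ‖z‖ := Complex.re_le_norm z
      have h2 : ‖z‖ < 1 := by simpa using hz
      left
      simp only [Complex.sub_re, Complex.one_re]
      linarith
    have hne : 1 - z ≠ 0 := Complex.slitPlane_ne_zero hslit
    apply DifferentiableAt.differentiableWithinAt
    apply DifferentiableAt.mul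
    · exact DifferentiableAt.cpow (by fun_prop) (by fun_prop) hslit
    · fun_prop (disch := assumption)
  have hdiffk : DifferentiableOn ℂ (iteratedDeriv k g) (Metric.ball 0 1) := by
    have := (hdiff.analyticOnNhd Metric.isOpen_ball).iterated_deriv k
    rw [← iteratedDeriv_eq_iterate] at this
    exact this.differentiableOn
  have hz : (r : ℂ) ∈ Metric.ball (0 : ℂ) 1 := by simpa using hr
  have hsum := Complex.hasSum_taylorSeries_on_ball hdiffk hz
  rw [iteratedDeriv_laguerreGenerating ha x k _ hz] at hsum
  have hcoef : ∀ m, iteratedDeriv m (iteratedDeriv k g) 0 =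
      ((m + k).factorial : ℂ) * ((laguerrePoly a (m + k) x : ℝ) : ℂ) := by
    intro m
    rw [iteratedDeriv_eq_iterate, iteratedDeriv_eq_iterate, ← Function.iterate_add_apply,
      ← iteratedDeriv_eq_iterate, iteratedDeriv_laguerreGenerating ha x _ 0 (by simp),
      ← laguerrePolynomial_eval ha]
    have := Polynomial.aeval_algebraMap_apply ℂ x (laguerrePolynomial a (m + k))
    simp only [Complex.coe_algebraMap] at this
    simp [this, Polynomial.coe_aeval_eq_eval]
  have hk : (k.factorial : ℂ) ≠ 0 := by exact_mod_cast k.factorial_ne_zero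
  have h2 := hsum.mul_left ((k.factorial : ℂ)⁻¹)
  rw [inv_mul_cancel_left₀ hk] at h2
  rw [← Complex.hasSum_ofReal]
  have hval : (((1 - r) ^ (-(a + 1 + k)) * Real.exp (-(x * r / (1 - r))) *
      laguerrePoly a k (x / (1 - r)) : ℝ) : ℂ) = (1 - (r : ℂ)) ^ (-((a : ℂ) + 1 + k)) *
        Complex.exp (-(x * r / (1 - r))) *
        Polynomial.aeval ((x : ℂ) / (1 - r)) (laguerrePolynomial a k) := by
    have h1r : 0 ≤ 1 - r := by linarith [(abs_lt.1 hr).2]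
    have := Polynomial.aeval_algebraMap_apply ℂ (x / (1 - r)) (laguerrePolynomial a k)
    simp only [Complex.coe_algebraMap, Polynomial.coe_aeval_eq_eval] at this
    push_cast at this
    rw [this, laguerrePolynomial_eval ha]
    push_cast [Complex.ofReal_cpow h1r]
    rfl
  rw [hval]
  refine h2.congr_fun fun m => ?_
  rw [hcoef, Nat.cast_choose ℝ (Nat.le_add_left k m), Nat.add_sub_cancel]
  have hm : (m.factorial : ℂ) ≠ 0 := by exact_mod_cast m.factorial_ne_zero
  simp only [smul_eq_mul, sub_zero]
  push_cast
  field_simp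

theorem laguerrePoly_moment {a : ℝ} (ha : -1 < a) (k : ℕ) :
    IntegrableOn (fun x : ℝ => x ^ k * (x ^ a * Real.exp (-x))) (Set.Ioi 0) ∧
      ∫ x in Set.Ioi (0 : ℝ), x ^ k * (x ^ a * Real.exp (-x)) = Real.Gamma (k + a + 1) := by
  have hk : (0 : ℝ) < k + a + 1 := by have := k.cast_nonneg (α := ℝ); linarith
  have hcongr : Set.EqOn (fun x : ℝ => Real.exp (-x) * x ^ ((k : ℝ) + a + 1 - 1))
      (fun x : ℝ => x ^ k * (x ^ a * Real.exp (-x))) (Set.Ioi 0) := by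
    intro x hx
    have hx : 0 < x := hx
    have : (k : ℝ) + a + 1 - 1 = k + a := by ring
    simp only [this, Real.rpow_add hx, Real.rpow_natCast]
    ring
  refine ⟨(Real.GammaIntegral_convergent hk).congr_fun hcongr measurableSet_Ioi, ?_⟩
  rw [Real.Gamma_eq_integral hk, setIntegral_congr_fun measurableSet_Ioi hcongr]

theorem alternating_sum_choose_ascPochhammer (b : ℝ) {m n : ℕ} (hmn : m ≤ n) :
    ∑ j ∈ Finset.range (n + 1), (-1 : ℝ) ^ j * n.choose j * (ascPochhammer ℝ m).eval (j + b) =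
      if m = n then (-1 : ℝ) ^ n * n.factorial else 0 := by
  set Q : Polynomial ℝ := (ascPochhammer ℝ m).comp (Polynomial.X + Polynomial.C b) with hQ
  have hmonic : Q.Monic := (monic_ascPochhammer ℝ m).comp_X_add_C b
  have hdeg : Q.natDegree = m := by
    simp [hQ, Polynomial.natDegree_comp, ascPochhammer_natDegree]
  have hdiff := fwdDiff_iter_eq_sum_shift (1 : ℝ) Q.eval n 0
  have hsum : ∑ j ∈ Finset.range (n + 1), (-1 : ℝ) ^ j * n.choose j *
      (ascPochhammer ℝ m).eval (j + b) = (-1) ^ n * (fwdDiff (1 : ℝ))^[n] Q.eval 0 := by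
    rw [hdiff, Finset.mul_sum]
    refine Finset.sum_congr rfl fun j hj => ?_
    have hj : j ≤ n := Nat.lt_succ_iff.1 (Finset.mem_range.1 hj)
    obtain ⟨i, rfl⟩ := Nat.exists_eq_add_of_le hj
    have h1 : ((-1 : ℝ) ^ i) * (-1) ^ i = 1 := by rw [← mul_pow]; simp
    simp only [hQ, Polynomial.eval_comp, Polynomial.eval_add, Polynomial.eval_X,
      Polynomial.eval_C, zsmul_eq_mul, nsmul_eq_mul, Nat.add_sub_cancel_left, pow_add]
    push_cast
    simp only [mul_one, zero_add]
    linear_combination (-(-1 : ℝ) ^ j * ((j + i).choose j : ℝ) *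
      Polynomial.eval ((j : ℝ) + b) (ascPochhammer ℝ m)) * h1
  rw [hsum]
  split_ifs with h
  · subst h
    have := Q.fwdDiff_iter_degree_eq_factorial
    rw [hdeg] at this
    rw [this, hmonic.leadingCoeff]
    simp
  · rw [Polynomial.fwdDiff_iter_eq_zero_of_degree_lt (by rw [hdeg]; omega)]
    simp

theorem integral_laguerrePoly_mul_pow {a : ℝ} (ha : -1 < a) {m n : ℕ} (hmn : m ≤ n) :
    IntegrableOn (fun x : ℝ => laguerrePoly a n x * (x ^ m * (x ^ a * Real.exp (-x))))
        (Set.Ioi 0) ∧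
      ∫ x in Set.Ioi (0 : ℝ), laguerrePoly a n x * (x ^ m * (x ^ a * Real.exp (-x))) =
        if m = n then (-1 : ℝ) ^ n * Real.Gamma (n + a + 1) else 0 := by
  set c : ℕ → ℝ := fun k =>
    Real.Gamma (n + a + 1) / n.factorial * ((-1) ^ k * n.choose k / Real.Gamma (k + a + 1)) with hc
  have hexp : (fun x : ℝ => laguerrePoly a n x * (x ^ m * (x ^ a * Real.exp (-x)))) =
      fun x => ∑ k ∈ Finset.range (n + 1),
        c k * (x ^ (k + m) * (x ^ a * Real.exp (-x))) := by
    ext x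
    rw [laguerrePoly_eq_sum ha, Finset.sum_mul]
    refine Finset.sum_congr rfl fun k _ => ?_
    simp only [hc, pow_add]; ring
  have hint : ∀ k ∈ Finset.range (n + 1), IntegrableOn
      (fun x : ℝ => c k * (x ^ (k + m) * (x ^ a * Real.exp (-x)))) (Set.Ioi 0) :=
    fun k _ => (laguerrePoly_moment ha (k + m)).1.const_mul _
  rw [hexp]
  refine ⟨integrable_finsetSum _ hint, ?_⟩
  rw [integral_finsetSum _ hint]
  simp only [integral_const_mul, (laguerrePoly_moment ha _).2]
  have hterm : ∀ k ∈ Finset.range (n + 1), c k * Real.Gamma ((k + m : ℕ) + a + 1) =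
      Real.Gamma (n + a + 1) / n.factorial *
        ((-1 : ℝ) ^ k * n.choose k * (ascPochhammer ℝ m).eval (k + (a + 1))) := by
    intro k _
    have hk : (0 : ℝ) < k + (a + 1) := by have := k.cast_nonneg (α := ℝ); linarith
    rw [ascPochhammer_eval_eq_Gamma_div hk]
    simp only [hc]
    push_cast
    rw [show (k : ℝ) + m + a + 1 = k + (a + 1) + m by ring,
      show (k : ℝ) + a + 1 = k + (a + 1) by ring]
    ring
  rw [Finset.sum_congr rfl hterm, ← Finset.mul_sum, alternating_sum_choose_ascPochhammer _ hmn]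
  have : (n.factorial : ℝ) ≠ 0 := by exact_mod_cast n.factorial_ne_zero
  split_ifs
  · field_simp
  · simp

theorem laguerreNorm_sq {a : ℝ} (ha : -1 < a) (n : ℕ) :
    laguerreNorm a n ^ 2 = Real.Gamma (n + a + 1) / n.factorial := by
  have hn : (0 : ℝ) < n + a + 1 := by have := n.cast_nonneg (α := ℝ); linarith
  have hG := Real.Gamma_pos_of_pos hn
  have hint : ∫ x in Set.Ioi (0 : ℝ), laguerrePoly a n x ^ 2 * (x ^ a * Real.exp (-x)) =
      Real.Gamma (n + a + 1) / n.factorial := by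
    set c : ℕ → ℝ := fun k =>
      Real.Gamma (n + a + 1) / n.factorial *
        ((-1) ^ k * n.choose k / Real.Gamma (k + a + 1)) with hc
    have hexp : (fun x : ℝ => laguerrePoly a n x ^ 2 * (x ^ a * Real.exp (-x))) =
        fun x => ∑ k ∈ Finset.range (n + 1),
          c k * (laguerrePoly a n x * (x ^ k * (x ^ a * Real.exp (-x)))) := by
      ext x
      rw [sq]
      nth_rewrite 1 [laguerrePoly_eq_sum ha]
      rw [Finset.sum_mul, Finset.sum_mul]
      refine Finset.sum_congr rfl fun k _ => ?_
      simp only [hc]; ring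
    rw [hexp, integral_finsetSum _ fun k hk => (integral_laguerrePoly_mul_pow ha
      (Nat.lt_succ_iff.1 (Finset.mem_range.1 hk))).1.const_mul _]
    rw [Finset.sum_congr rfl fun k hk => by
      rw [integral_const_mul, (integral_laguerrePoly_mul_pow ha
        (Nat.lt_succ_iff.1 (Finset.mem_range.1 hk))).2]]
    simp only [mul_ite, mul_zero]
    rw [Finset.sum_ite_eq' , if_pos (by simp)]
    simp only [hc, Nat.choose_self]
    have h1 : ((-1 : ℝ) ^ n) * (-1) ^ n = 1 := by rw [← mul_pow]; simp
    field_simp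
    linear_combination h1
  rw [laguerreNorm, hint, Real.sq_sqrt (by positivity)]

theorem laguerreKernelTerm_eq {a : ℝ} (ha : -1 < a) (t x y : ℝ) (n : ℕ) :
    laguerreKernelTerm a t x y n = Real.exp (-t) ^ n * (n.factorial / Real.Gamma (n + a + 1)) *
      laguerrePoly a n x * laguerrePoly a n y := by
  have h := laguerreNorm_sq ha n
  have hn : (0 : ℝ) < n + a + 1 := by have := n.cast_nonneg (α := ℝ); linarith
  have hG := Real.Gamma_pos_of_pos hn
  have hf : (0 : ℝ) < n.factorial := by exact_mod_cast n.factorial_pos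
  have hne : laguerreNorm a n ≠ 0 := by
    intro h0
    rw [h0] at h
    have : 0 < Real.Gamma (n + a + 1) / n.factorial := by positivity
    rw [← h] at this
    simp at this
  rw [laguerreKernelTerm, laguerreNormalized, laguerreNormalized, ← Real.exp_nat_mul,
    show (n.factorial : ℝ) / Real.Gamma (n + a + 1) = 1 / laguerreNorm a n ^ 2 by
      rw [h]; field_simp]
  rw [show -(t * n) = n * -t by ring]
  field_simp

/-- The modified Bessel function `∑ w ^ k / (k! Γ(k + a + 1))`. -/
noncomputable def besselSeries (a w : ℝ) : ℝ :=
  ∑' k : ℕ, w ^ k / (k.factorial * Real.Gamma (k + a + 1))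

theorem Gamma_nat_add_ge {a : ℝ} (ha : -1 < a) :
    ∃ c : ℝ, 0 < c ∧ ∀ k : ℕ, c ≤ Real.Gamma (k + a + 1) := by
  have hpos : ∀ k : ℕ, (0 : ℝ) < k + a + 1 := fun k => by
    have := k.cast_nonneg (α := ℝ); linarith
  have h0 := Real.Gamma_pos_of_pos (hpos 0)
  refine ⟨min (Real.Gamma ((0 : ℕ) + a + 1)) (Real.Gamma ((1 : ℕ) + a + 1)),
    lt_min h0 (Real.Gamma_pos_of_pos (hpos 1)), fun k => ?_⟩
  induction k with
  | zero => exact min_le_left _ _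
  | succ k ih =>
    cases k with
    | zero => exact min_le_right _ _
    | succ k =>
      refine ih.trans ?_
      have hge : (1 : ℝ) ≤ (k + 1 : ℕ) + a + 1 := by
        push_cast; have := k.cast_nonneg (α := ℝ); linarith
      rw [show (((k + 1 + 1 : ℕ) : ℝ)) + a + 1 = ((k + 1 : ℕ) + a + 1) + 1 by push_cast; ring,
        Real.Gamma_add_one (hpos _).ne']
      exact le_mul_of_one_le_left (Real.Gamma_pos_of_pos (hpos _)).le hge

theorem summable_pow_div_factorial_mul_Gamma {a : ℝ} (ha : -1 < a) (w : ℝ) :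
    Summable fun k : ℕ => ‖w ^ k / (k.factorial * Real.Gamma (k + a + 1))‖ := by
  obtain ⟨c, hc, hcle⟩ := Gamma_nat_add_ge ha
  refine Summable.of_nonneg_of_le (fun _ => norm_nonneg _) (fun k => ?_)
    ((Real.summable_pow_div_factorial |w|).mul_left c⁻¹)
  have hf : (0 : ℝ) < k.factorial := by exact_mod_cast k.factorial_pos
  have hG : 0 < Real.Gamma (k + a + 1) := hc.trans_le (hcle k)
  rw [Real.norm_eq_abs, abs_div, abs_pow, abs_of_pos (by positivity : 0 < k.factorial *
    Real.Gamma (k + a + 1)), div_le_iff₀ (by positivity)]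
  calc |w| ^ k = c⁻¹ * (|w| ^ k / k.factorial) * (k.factorial * c) := by field_simp
    _ ≤ _ := by gcongr; exact hcle k

theorem laguerrePoly_div_Gamma_eq {a : ℝ} (ha : -1 < a) (n : ℕ) (x w : ℝ) :
    laguerrePoly a n x * w ^ n / Real.Gamma (n + a + 1) = ∑ k ∈ Finset.range (n + 1),
      ((-(x * w)) ^ k / (k.factorial * Real.Gamma (k + a + 1))) *
        (w ^ (n - k) / (n - k).factorial) := by
  have hn : (0 : ℝ) < n + a + 1 := by have := n.cast_nonneg (α := ℝ); linarith
  have hG := (Real.Gamma_pos_of_pos hn).ne'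
  rw [laguerrePoly_eq_sum ha, mul_div_assoc, Finset.sum_mul]
  refine Finset.sum_congr rfl fun k hk => ?_
  have hkn : k ≤ n := Nat.lt_succ_iff.1 (Finset.mem_range.1 hk)
  have hk : (0 : ℝ) < k + a + 1 := by have := k.cast_nonneg (α := ℝ); linarith
  have hGk := (Real.Gamma_pos_of_pos hk).ne'
  rw [Nat.cast_choose ℝ hkn]
  obtain ⟨i, rfl⟩ := Nat.exists_eq_add_of_le hkn
  have hf := (k + i).factorial_ne_zero
  rw [Nat.add_sub_cancel_left, neg_pow (x * w), mul_pow, pow_add]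
  have hf1 := (k).factorial_ne_zero
  have hf2 := (i).factorial_ne_zero
  field_simp

theorem hasSum_laguerrePoly_div_Gamma {a : ℝ} (ha : -1 < a) (x w : ℝ) :
    HasSum (fun n : ℕ => laguerrePoly a n x * w ^ n / Real.Gamma (n + a + 1))
      (Real.exp w * besselSeries a (-(x * w))) := by
  have h1 := summable_pow_div_factorial_mul_Gamma ha (-(x * w))
  have h2 : Summable fun k : ℕ => ‖w ^ k / (k.factorial : ℝ)‖ :=
    (Real.summable_pow_div_factorial w).norm
  have h := hasSum_sum_range_mul_of_summable_norm h1 h2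
  simp only [← laguerrePoly_div_Gamma_eq ha] at h
  rw [Real.exp_eq_exp_ℝ, NormedSpace.exp_eq_tsum_div, mul_comm]
  exact h

theorem rpow_le_of_comparable {p q K : ℝ} (hp : 0 < p) (hq : 0 < q) (hpq : p ≤ K * q)
    (hqp : q ≤ K * p) (b : ℝ) : p ^ b ≤ K ^ |b| * q ^ b := by
  have hK : 0 < K := by
    by_contra h
    have := mul_nonpos_of_nonpos_of_nonneg (not_lt.1 h) hq.le
    linarith
  rcases le_total 0 b with hb | hb
  · rw [abs_of_nonneg hb, ← Real.mul_rpow hK.le hq.le]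
    exact Real.rpow_le_rpow hp.le hpq hb
  · rw [abs_of_nonpos hb]
    have h1 : (K * p) ^ b ≤ q ^ b := Real.rpow_le_rpow_of_nonpos hq hqp hb
    rw [Real.mul_rpow hK.le hp.le] at h1
    calc p ^ b = K ^ (-b) * (K ^ b * p ^ b) := by
          rw [← mul_assoc, ← Real.rpow_add hK]; simp
      _ ≤ _ := by gcongr

theorem Gamma_nat_add_asymptotic {a : ℝ} (ha : -1 < a) :
    Tendsto (fun k : ℕ => (k.factorial * ((k : ℝ) + 1) ^ a) / Real.Gamma (k + a + 1)) atTop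
      (𝓝 1) := by
  have hG : Real.Gamma (a + 1) ≠ 0 := (Real.Gamma_pos_of_pos (by linarith)).ne'
  have h1 : Tendsto (fun k : ℕ => ((k : ℝ) / (k + 1)) ^ a) atTop (𝓝 (1 ^ a)) :=
    (tendsto_natCast_div_add_atTop (1 : ℝ)).rpow_const (Or.inl one_ne_zero)
  have h2 := tendsto_natCast_div_add_atTop (a + 1)
  have h3 := ((Real.GammaSeq_tendsto_Gamma (a + 1)).div_const (Real.Gamma (a + 1))).div
    (h1.mul h2) (by simp)
  rw [Real.one_rpow, div_self hG, one_mul, div_one] at h3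
  refine h3.congr' ?_
  filter_upwards [eventually_gt_atTop 0] with k hk
  have hk0 : (0 : ℝ) < k := by exact_mod_cast hk
  have hka : (0 : ℝ) < k + a + 1 := by linarith
  have hGk := (Real.Gamma_pos_of_pos hka).ne'
  have hprod : ∏ j ∈ Finset.range (k + 1), (a + 1 + (j : ℝ)) =
      Real.Gamma (k + a + 1) * (k + a + 1) / Real.Gamma (a + 1) := by
    have : ∀ m : ℕ, ∏ j ∈ Finset.range m, (a + 1 + (j : ℝ)) =
        Real.Gamma (m + a + 1) / Real.Gamma (a + 1) := by
      intro m
      induction m with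
      | zero => simp [hG]
      | succ m ih =>
        have hm : (m : ℝ) + a + 1 ≠ 0 := by
          have := m.cast_nonneg (α := ℝ); exact ne_of_gt (by linarith)
        rw [Finset.prod_range_succ, ih, Nat.cast_succ,
          show (m : ℝ) + 1 + a + 1 = m + a + 1 + 1 by ring, Real.Gamma_add_one hm]
        ring
    rw [this, Nat.cast_succ, show (k : ℝ) + 1 + a + 1 = k + a + 1 + 1 by ring,
      Real.Gamma_add_one hka.ne']
    ring
  simp only [Pi.div_apply]
  rw [Real.GammaSeq, hprod, Real.rpow_add_one hk0.ne', Real.div_rpow hk0.le (by positivity)]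
  have h5 : (k : ℝ) ^ a ≠ 0 := (Real.rpow_pos_of_pos hk0 a).ne'
  have h6 : ((k : ℝ) + 1) ^ a ≠ 0 := (Real.rpow_pos_of_pos (by positivity) a).ne'
  have h7 : (k : ℝ) + (a + 1) ≠ 0 := by rw [← add_assoc]; exact hka.ne'
  have h8 := hka.ne'
  field_simp
  ring

theorem Gamma_nat_add_bounds {a : ℝ} (ha : -1 < a) :
    ∃ C : ℝ, 0 < C ∧ ∀ k : ℕ, k.factorial * ((k : ℝ) + 1) ^ a ≤ C * Real.Gamma (k + a + 1) ∧
      Real.Gamma (k + a + 1) ≤ C * (k.factorial * ((k : ℝ) + 1) ^ a) := by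
  have h := Gamma_nat_add_asymptotic ha
  obtain ⟨C₁, hC₁⟩ := h.bddAbove_range
  obtain ⟨C₂, hC₂⟩ := (h.inv₀ one_ne_zero).bddAbove_range
  have hG : ∀ k : ℕ, 0 < Real.Gamma (k + a + 1) := fun k => Real.Gamma_pos_of_pos (by
    have := k.cast_nonneg (α := ℝ); linarith)
  refine ⟨max (max C₁ C₂) 1, by positivity, fun k => ⟨?_, ?_⟩⟩
  · have h1 := hC₁ ⟨k, rfl⟩
    dsimp only at h1
    rw [div_le_iff₀ (hG k)] at h1
    exact h1.trans (mul_le_mul_of_nonneg_right ((le_max_left _ _).trans (le_max_left _ _))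
      (hG k).le)
  · have h1 := hC₂ ⟨k, rfl⟩
    dsimp only at h1
    have hf : (0 : ℝ) < k.factorial * ((k : ℝ) + 1) ^ a := by positivity
    rw [inv_div, div_le_iff₀ hf] at h1
    exact h1.trans (mul_le_mul_of_nonneg_right ((le_max_right _ _).trans (le_max_left _ _)) hf.le)

theorem summable_pow_div_Gamma {a : ℝ} (ha : -1 < a) {w : ℝ} (hw : 0 ≤ w) :
    Summable fun k : ℕ => w ^ k / Real.Gamma (k + a + 1) := by
  obtain ⟨C, hC, h⟩ := Gamma_nat_add_bounds ha
  refine Summable.of_nonneg_of_le (fun k => ?_) (fun k => ?_)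
    ((Real.summable_pow_div_factorial (2 * w)).mul_left C)
  · have := Real.Gamma_pos_of_pos (show (0 : ℝ) < k + a + 1 by
      have := k.cast_nonneg (α := ℝ); linarith)
    positivity
  · have hG := Real.Gamma_pos_of_pos (show (0 : ℝ) < k + a + 1 by
      have := k.cast_nonneg (α := ℝ); linarith)
    have hk1 : ((k : ℝ) + 1) ≤ 2 ^ k := by exact_mod_cast Nat.lt_two_pow_self
    have h1 : ((k : ℝ) + 1)⁻¹ ≤ ((k : ℝ) + 1) ^ a := by
      rw [← Real.rpow_neg_one]
      exact Real.rpow_le_rpow_of_exponent_le (by linarith [k.cast_nonneg (α := ℝ)]) ha.le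
    have hf : (0 : ℝ) < k.factorial := by exact_mod_cast k.factorial_pos
    have h2 : (k.factorial : ℝ) ≤ 2 ^ k * (C * Real.Gamma (k + a + 1)) := by
      calc (k.factorial : ℝ) = ((k : ℝ) + 1) * (k.factorial * ((k : ℝ) + 1)⁻¹) := by field_simp
        _ ≤ 2 ^ k * (k.factorial * ((k : ℝ) + 1) ^ a) := by gcongr
        _ ≤ _ := mul_le_mul_of_nonneg_left (h k).1 (by positivity)
    rw [div_le_iff₀ hG, mul_pow]
    calc w ^ k = w ^ k / k.factorial * k.factorial := by field_simp
      _ ≤ w ^ k / k.factorial * (2 ^ k * (C * Real.Gamma (k + a + 1))) := by gcongr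
      _ = _ := by ring

theorem summable_choose_mul_geometric_mul_pow_div_Gamma {a : ℝ} (ha : -1 < a) {p y : ℝ}
    (hp0 : 0 ≤ p) (hp1 : p < 1) (hy : 0 ≤ y) :
    Summable fun m : ℕ × ℕ => (y ^ m.1 / Real.Gamma (m.1 + a + 1)) *
      (((m.2 + m.1).choose m.1 : ℝ) * p ^ m.2) := by
  have hGpos : ∀ k : ℕ, 0 < Real.Gamma (k + a + 1) := fun k => Real.Gamma_pos_of_pos (by
    have := k.cast_nonneg (α := ℝ); linarith)
  have hpn : ‖p‖ < 1 := by rwa [Real.norm_of_nonneg hp0]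
  have h1 : ∀ k : ℕ, Summable fun m : ℕ => (y ^ k / Real.Gamma (k + a + 1)) *
      (((m + k).choose k : ℝ) * p ^ m) :=
    fun k => (summable_choose_mul_geometric_of_norm_lt_one k hpn).mul_left _
  have h2 : ∀ k : ℕ, ∑' m : ℕ, (y ^ k / Real.Gamma (k + a + 1)) *
      (((m + k).choose k : ℝ) * p ^ m) =
      1 / (1 - p) * ((y / (1 - p)) ^ k / Real.Gamma (k + a + 1)) := by
    intro k
    rw [tsum_mul_left, tsum_choose_mul_geometric_of_norm_lt_one k hpn, div_pow, pow_succ]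
    have h3 : 1 - p ≠ 0 := by linarith
    have h4 := (hGpos k).ne'
    field_simp
  have h3 : Summable fun k : ℕ => 1 / (1 - p) * ((y / (1 - p)) ^ k / Real.Gamma (k + a + 1)) :=
    (summable_pow_div_Gamma ha (div_nonneg hy (by linarith))).mul_left _
  refine (summable_prod_of_nonneg fun m => ?_).2 ⟨h1, ?_⟩
  · exact mul_nonneg (div_nonneg (pow_nonneg hy _) (hGpos _).le)
      (mul_nonneg (Nat.cast_nonneg _) (pow_nonneg hp0 _))
  · simpa only [h2] using h3

theorem summable_laguerrePoly_double {a : ℝ} (ha : -1 < a) (x y : ℝ) {r : ℝ} (hr0 : 0 ≤ r)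
    (hr : r < 1) :
    Summable fun p : ℕ × ℕ => (((p.2 + p.1).choose p.1 : ℝ) * laguerrePoly a (p.2 + p.1) x *
      r ^ p.2) * ((-(y * r)) ^ p.1 / Real.Gamma (p.1 + a + 1)) := by
  obtain ⟨q, hrq, hq⟩ := exists_between hr
  have hq0 : 0 < q := hr0.trans_lt hrq
  have hs := (hasSum_laguerrePoly ha x 0 (r := q) (by rw [abs_of_pos hq0]; exact hq)).summable
  obtain ⟨M, hM⟩ := hs.tendsto_atTop_zero.norm.bddAbove_range
  have hM' : ∀ n, ‖laguerrePoly a n x‖ * q ^ n ≤ M := fun n => by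
    have := hM ⟨n, rfl⟩
    simpa [abs_mul, abs_of_pos hq0] using this
  obtain ⟨p, hrpq⟩ : ∃ p, r = p * q := ⟨r / q, by field_simp⟩
  have hp0 : 0 ≤ p := nonneg_of_mul_nonneg_left (hrpq ▸ hr0) hq0
  have hp1 : p < 1 := by
    by_contra h
    have := mul_le_mul_of_nonneg_right (not_lt.1 h) hq0.le
    linarith
  refine Summable.of_norm_bounded ((summable_choose_mul_geometric_mul_pow_div_Gamma ha hp0 hp1
    (mul_nonneg (abs_nonneg y) hp0)).mul_left M) fun m => ?_
  obtain ⟨k, m⟩ := m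
  have hG := Real.Gamma_pos_of_pos (show (0 : ℝ) < k + a + 1 by
    have := k.cast_nonneg (α := ℝ); linarith)
  simp only [norm_mul, norm_div, norm_pow, norm_neg, Real.norm_of_nonneg hr0,
    Real.norm_of_nonneg hG.le, Real.norm_natCast]
  calc ((m + k).choose k : ℝ) * ‖laguerrePoly a (m + k) x‖ * r ^ m *
        ((‖y‖ * r) ^ k / Real.Gamma (k + a + 1))
      = ((m + k).choose k : ℝ) * p ^ m * ((‖y‖ * p) ^ k / Real.Gamma (k + a + 1)) *
        (‖laguerrePoly a (m + k) x‖ * q ^ (m + k)) := by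
        rw [hrpq]; simp only [mul_pow, pow_add]; ring
    _ ≤ ((m + k).choose k : ℝ) * p ^ m * ((‖y‖ * p) ^ k / Real.Gamma (k + a + 1)) * M :=
        mul_le_mul_of_nonneg_left (hM' _) (mul_nonneg (mul_nonneg (Nat.cast_nonneg _)
          (pow_nonneg hp0 _)) (div_nonneg (pow_nonneg (mul_nonneg (norm_nonneg _) hp0) _) hG.le))
    _ = _ := by rw [Real.norm_eq_abs]; ring

/-- The Hille–Hardy formula. -/
theorem hasSum_hilleHardy {a : ℝ} (ha : -1 < a) (x y : ℝ) {r : ℝ} (hr0 : 0 ≤ r) (hr : r < 1) :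
    HasSum (fun n : ℕ => r ^ n * (n.factorial / Real.Gamma (n + a + 1)) *
        laguerrePoly a n x * laguerrePoly a n y)
      ((1 - r) ^ (-(a + 1)) * Real.exp (-(r * (x + y) / (1 - r))) *
        besselSeries a (x * y * r / (1 - r) ^ 2)) := by
  have h1r : 0 < 1 - r := by linarith
  have hGpos : ∀ k : ℕ, 0 < Real.Gamma (k + a + 1) := fun k => Real.Gamma_pos_of_pos (by
    have := k.cast_nonneg (α := ℝ); linarith)
  set F : ℕ × ℕ → ℝ := fun p => (((p.2 + p.1).choose p.1 : ℝ) * laguerrePoly a (p.2 + p.1) x *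
    r ^ p.2) * ((-(y * r)) ^ p.1 / Real.Gamma (p.1 + a + 1)) with hF
  have hsummable : Summable F := summable_laguerrePoly_double ha x y hr0 hr
  -- summation over one index first
  have hrow : ∀ k : ℕ, HasSum (fun m => F (k, m))
      ((1 - r) ^ (-(a + 1)) * Real.exp (-(x * r / (1 - r))) *
        (laguerrePoly a k (x / (1 - r)) * (-(y * r / (1 - r))) ^ k / Real.Gamma (k + a + 1))) := by
    intro k
    have := (hasSum_laguerrePoly ha x k (r := r) (by rwa [abs_of_nonneg hr0])).mul_right
      ((-(y * r)) ^ k / Real.Gamma (k + a + 1))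
    refine HasSum.congr_fun ?_ (fun _ => rfl)
    convert! this using 1
    rw [show -(a + 1 + k) = -(a + 1) - k by ring, Real.rpow_sub_natCast h1r.ne',
      show -(y * r / (1 - r)) = -(y * r) / (1 - r) by ring, div_pow]
    ring
  have hcol := ((hasSum_laguerrePoly_div_Gamma ha (x / (1 - r)) (-(y * r / (1 - r)))).mul_left
    ((1 - r) ^ (-(a + 1)) * Real.exp (-(x * r / (1 - r)))))
  have htot := hsummable.hasSum
  have hval := (htot.prod_fiberwise hrow).unique hcol
  rw [hval] at htot
  -- summation along the antidiagonals
  rw [← Finset.HasAntidiagonal.sigmaAntidiagonalEquivProd.hasSum_iff] at htot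
  have hdiag := htot.sigma (fun n => hasSum_fintype _)
  convert hdiag using 1
  · ext n
    rw [laguerrePoly_eq_sum ha n y, Finset.mul_sum]
    simp only [Function.comp_apply, Finset.HasAntidiagonal.sigmaAntidiagonalEquivProd_apply]
    rw [Finset.sum_coe_sort (Finset.HasAntidiagonal.antidiagonal n) (fun p => F p),
      Finset.Nat.sum_antidiagonal_eq_sum_range_succ_mk]
    refine Finset.sum_congr rfl fun k hk => ?_
    have hkn : k ≤ n := Nat.lt_succ_iff.1 (Finset.mem_range.1 hk)
    simp only [hF, Nat.sub_add_cancel hkn]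
    have hf : (n.factorial : ℝ) ≠ 0 := by exact_mod_cast n.factorial_ne_zero
    have h1 := (hGpos n).ne'
    have h2 := (hGpos k).ne'
    have h3 : r ^ n = r ^ (n - k) * r ^ k := by rw [← pow_add, Nat.sub_add_cancel hkn]
    rw [h3, neg_pow (y * r), mul_pow]
    field_simp
  · rw [show -(x / (1 - r) * -(y * r / (1 - r))) = x * y * r / (1 - r) ^ 2 by field_simp,
      show -(r * (x + y) / (1 - r)) = -(x * r / (1 - r)) + -(y * r / (1 - r)) by ring,
      Real.exp_add]
    ring

theorem factorial_add_le_mul_pow (n m : ℕ) :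
    (n + m).factorial ≤ n.factorial * m.factorial * (n + 1) ^ m := by
  induction m with
  | zero => simp
  | succ m ih =>
    rw [← add_assoc, Nat.factorial_succ, Nat.factorial_succ]
    calc (n + m + 1) * (n + m).factorial
        ≤ ((m + 1) * (n + 1)) * (n.factorial * m.factorial * (n + 1) ^ m) :=
          Nat.mul_le_mul (by nlinarith [Nat.zero_le (m * n)]) ih
      _ = _ := by ring

theorem poisson_rpow_moment_le {b : ℝ} (hb : -1 ≤ b) :
    ∃ C : ℝ, 0 < C ∧ ∀ z : ℝ, 0 ≤ z →
      Summable (fun n : ℕ => z ^ n / n.factorial * ((n : ℝ) + 1) ^ (-b)) ∧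
      ∑' n : ℕ, z ^ n / n.factorial * ((n : ℝ) + 1) ^ (-b) ≤
        C * ((1 + z) ^ (-b) * Real.exp z) := by
  obtain ⟨m, hm⟩ := exists_nat_ge b
  refine ⟨1 + 2 ^ m * (1 + m.factorial), by positivity, fun z hz => ?_⟩
  have hz1 : 0 < 1 + z := by linarith
  have hexp : HasSum (fun n : ℕ => z ^ n / n.factorial) (Real.exp z) := by
    rw [Real.exp_eq_exp_ℝ]; exact NormedSpace.expSeries_div_hasSum_exp z
  have hmean : HasSum (fun n : ℕ => z ^ n / n.factorial * ((n : ℝ) + 1))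
      ((1 + z) * Real.exp z) := by
    have h1 : HasSum (fun n : ℕ => z ^ n / n.factorial * (n : ℝ)) (z * Real.exp z) := by
      rw [← hasSum_nat_add_iff' 1]
      simp only [Finset.range_one, Finset.sum_singleton, Nat.cast_zero, mul_zero, sub_zero]
      refine (hexp.mul_left z).congr_fun fun n => ?_
      rw [Nat.factorial_succ]
      have := n.factorial_ne_zero
      push_cast
      field_simp
      ring
    convert! hexp.add h1 using 1
    · ext n; ring
    · ring
  have hshift : HasSum (fun n : ℕ => z ^ (n + m) / (n + m).factorial)
      (Real.exp z - ∑ i ∈ Finset.range m, z ^ i / i.factorial) := (hasSum_nat_add_iff' m).2 hexp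
  have hshift_le : Real.exp z - ∑ i ∈ Finset.range m, z ^ i / i.factorial ≤ Real.exp z :=
    sub_le_self _ (Finset.sum_nonneg fun i _ => by positivity)
  have hbound := ((((hmean.mul_left (1 + z)⁻¹).add ((hexp.add (hshift.mul_left
    (m.factorial : ℝ))).mul_left ((2 : ℝ) ^ m)))).mul_left ((1 + z) ^ (-b)))
  have hterm : ∀ n : ℕ, z ^ n / n.factorial * ((n : ℝ) + 1) ^ (-b) ≤
      (1 + z) ^ (-b) * ((1 + z)⁻¹ * (z ^ n / n.factorial * ((n : ℝ) + 1)) +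
        2 ^ m * (z ^ n / n.factorial + m.factorial * (z ^ (n + m) / (n + m).factorial))) := by
    intro n
    have hn1 : (0 : ℝ) < (n : ℝ) + 1 := by positivity
    set p : ℝ := ((n : ℝ) + 1) / (1 + z) with hp
    have hp0 : 0 < p := by positivity
    have hpb : p ^ (-b) ≤ p + (p⁻¹) ^ m := by
      rcases le_total 1 p with h | h
      · calc p ^ (-b) ≤ p ^ (1 : ℝ) := Real.rpow_le_rpow_of_exponent_le h (by linarith)
          _ = p := Real.rpow_one p
          _ ≤ _ := le_add_of_nonneg_right (by positivity)
      · calc p ^ (-b) ≤ p ^ (-(m : ℝ)) := Real.rpow_le_rpow_of_exponent_ge hp0 h (by linarith)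
          _ = (p⁻¹) ^ m := by rw [Real.rpow_neg hp0.le, Real.rpow_natCast, inv_pow]
          _ ≤ _ := le_add_of_nonneg_left hp0.le
    have hsplit : ((n : ℝ) + 1) ^ (-b) = (1 + z) ^ (-b) * p ^ (-b) := by
      rw [← Real.mul_rpow hz1.le hp0.le, hp]
      congr 1; field_simp
    have hpow : (1 + z) ^ m ≤ 2 ^ m * (1 + z ^ m) := by
      rcases le_total z 1 with h | h
      · calc (1 + z) ^ m ≤ 2 ^ m := by gcongr; linarith
          _ ≤ _ := le_mul_of_one_le_right (by positivity) (by linarith [pow_nonneg hz m])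
      · calc (1 + z) ^ m ≤ (2 * z) ^ m := by gcongr; linarith
          _ = 2 ^ m * z ^ m := mul_pow _ _ _
          _ ≤ _ := by gcongr; linarith
    have hfac : (((n + m).factorial : ℕ) : ℝ) ≤ n.factorial * m.factorial * ((n : ℝ) + 1) ^ m := by
      exact_mod_cast factorial_add_le_mul_pow n m
    have hf : (0 : ℝ) < n.factorial := by exact_mod_cast n.factorial_pos
    have hfm : (0 : ℝ) < m.factorial := by exact_mod_cast m.factorial_pos
    have hfnm : (0 : ℝ) < (n + m).factorial := by exact_mod_cast (n + m).factorial_pos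
    have h1 : z ^ n / n.factorial * (p⁻¹) ^ m ≤
        2 ^ m * (z ^ n / n.factorial + m.factorial * (z ^ (n + m) / (n + m).factorial)) := by
      have hA : z ^ n / n.factorial / ((n : ℝ) + 1) ^ m ≤ z ^ n / n.factorial :=
        div_le_self (by positivity) (one_le_pow₀ (by linarith [n.cast_nonneg (α := ℝ)]))
      have hB : z ^ n / n.factorial / ((n : ℝ) + 1) ^ m * z ^ m ≤
          m.factorial * (z ^ (n + m) / (n + m).factorial) := by
        calc z ^ n / n.factorial / ((n : ℝ) + 1) ^ m * z ^ m
            = m.factorial * (z ^ (n + m) / (n.factorial * m.factorial * ((n : ℝ) + 1) ^ m)) := by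
              rw [pow_add]; field_simp
          _ ≤ _ := by gcongr
      calc z ^ n / n.factorial * (p⁻¹) ^ m
          = z ^ n / n.factorial / ((n : ℝ) + 1) ^ m * (1 + z) ^ m := by
            rw [hp, inv_div, div_pow]; field_simp
        _ ≤ z ^ n / n.factorial / ((n : ℝ) + 1) ^ m * (2 ^ m * (1 + z ^ m)) := by gcongr
        _ = 2 ^ m * (z ^ n / n.factorial / ((n : ℝ) + 1) ^ m +
            z ^ n / n.factorial / ((n : ℝ) + 1) ^ m * z ^ m) := by ring
        _ ≤ _ := by gcongr
    calc z ^ n / n.factorial * ((n : ℝ) + 1) ^ (-b)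
        = (1 + z) ^ (-b) * (z ^ n / n.factorial * p ^ (-b)) := by rw [hsplit]; ring
      _ ≤ (1 + z) ^ (-b) * (z ^ n / n.factorial * (p + (p⁻¹) ^ m)) := by gcongr
      _ = (1 + z) ^ (-b) * ((1 + z)⁻¹ * (z ^ n / n.factorial * ((n : ℝ) + 1)) +
          z ^ n / n.factorial * (p⁻¹) ^ m) := by rw [hp]; ring
      _ ≤ _ := by gcongr
  have hs : Summable fun n : ℕ => z ^ n / n.factorial * ((n : ℝ) + 1) ^ (-b) :=
    Summable.of_nonneg_of_le (fun n => by positivity) hterm hbound.summable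
  refine ⟨hs, (hasSum_le hterm hs.hasSum hbound).trans ?_⟩
  rw [inv_mul_cancel_left₀ hz1.ne']
  have : (m.factorial : ℝ) * (Real.exp z - ∑ i ∈ Finset.range m, z ^ i / i.factorial) ≤
      m.factorial * Real.exp z := by gcongr
  calc (1 + z) ^ (-b) * (Real.exp z + 2 ^ m * (Real.exp z +
        m.factorial * (Real.exp z - ∑ i ∈ Finset.range m, z ^ i / i.factorial)))
      ≤ (1 + z) ^ (-b) * (Real.exp z + 2 ^ m * (Real.exp z + m.factorial * Real.exp z)) := by
        gcongr
    _ = _ := by ring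

theorem besselSeries_le {a : ℝ} (ha : -1 < a) :
    ∃ C : ℝ, 0 < C ∧ ∀ z : ℝ, 0 ≤ z →
      besselSeries a (z ^ 2 / 4) ≤ C * ((1 + z) ^ (-(a + 1 / 2)) * Real.exp z) := by
  obtain ⟨C₁, hC₁, h₁⟩ := Gamma_nat_add_bounds ha
  obtain ⟨C₂, hC₂, h₂⟩ := Gamma_nat_add_bounds (a := -(1 / 2)) (by norm_num)
  obtain ⟨C₃, hC₃, h₃⟩ := poisson_rpow_moment_le (b := a + 1 / 2) (by linarith)
  set K : ℝ := C₁ * C₂ * 2 ^ |-(a + 1 / 2)| with hK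
  have hK0 : 0 < K := by positivity
  refine ⟨K * C₃, by positivity, fun z hz => ?_⟩
  obtain ⟨hs, hle⟩ := h₃ z hz
  set g : ℕ → ℝ := fun n => z ^ n / n.factorial * ((n : ℝ) + 1) ^ (-(a + 1 / 2)) with hg
  have hterm : ∀ k : ℕ, (z ^ 2 / 4) ^ k / (k.factorial * Real.Gamma (k + a + 1)) ≤
      K * g (2 * k) := by
    intro k
    have hk1 : (0 : ℝ) < (k : ℝ) + 1 := by positivity
    have hG := Real.Gamma_pos_of_pos (show (0 : ℝ) < k + a + 1 by
      have := k.cast_nonneg (α := ℝ); linarith)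
    have hf : (0 : ℝ) < k.factorial := by exact_mod_cast k.factorial_pos
    have hdup := Real.Gamma_mul_Gamma_add_half ((k : ℝ) + 1 / 2)
    rw [show (k : ℝ) + 1 / 2 + 1 / 2 = k + 1 by ring, Real.Gamma_nat_eq_factorial,
      show 2 * ((k : ℝ) + 1 / 2) = (2 * k : ℕ) + 1 by push_cast; ring,
      Real.Gamma_nat_eq_factorial,
      show (1 : ℝ) - ((2 * k : ℕ) + 1) = -(2 * k : ℕ) by ring, Real.rpow_neg two_pos.le,
      Real.rpow_natCast, pow_mul] at hdup
    norm_num at hdup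
    have hpi : 1 ≤ √Real.pi := by
      rw [Real.one_le_sqrt]; linarith [Real.pi_gt_three]
    have hf2 : (0 : ℝ) < (2 * k).factorial := by exact_mod_cast (2 * k).factorial_pos
    -- lower bound of the denominator
    have hA : ((2 * k).factorial : ℝ) * (4 ^ k)⁻¹ ≤
        C₂ * (k.factorial * ((k : ℝ) + 1) ^ (-(1 / 2) : ℝ)) * k.factorial := by
      calc ((2 * k).factorial : ℝ) * (4 ^ k)⁻¹ ≤ (2 * k).factorial * (4 ^ k)⁻¹ * √Real.pi :=
            le_mul_of_one_le_right (by positivity) hpi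
        _ = Real.Gamma (k + -(1 / 2) + 1) * k.factorial := by
            rw [show (k : ℝ) + -(1 / 2) + 1 = k + 1 / 2 by ring]; exact hdup.symm
        _ ≤ _ := by gcongr; exact (h₂ k).2
    have hB : ((2 * k).factorial : ℝ) * (4 ^ k)⁻¹ * ((k : ℝ) + 1) ^ (a + 1 / 2) ≤
        C₁ * C₂ * (k.factorial * Real.Gamma (k + a + 1)) := by
      calc ((2 * k).factorial : ℝ) * (4 ^ k)⁻¹ * ((k : ℝ) + 1) ^ (a + 1 / 2)
          ≤ C₂ * (k.factorial * ((k : ℝ) + 1) ^ (-(1 / 2) : ℝ)) * k.factorial *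
            ((k : ℝ) + 1) ^ (a + 1 / 2) := by gcongr
        _ = C₂ * k.factorial * (k.factorial * ((k : ℝ) + 1) ^ a) := by
            have : ((k : ℝ) + 1) ^ (-(1 / 2) : ℝ) * ((k : ℝ) + 1) ^ (a + 1 / 2) =
                ((k : ℝ) + 1) ^ a := by rw [← Real.rpow_add hk1]; congr 1; ring
            rw [← this]; ring
        _ ≤ C₂ * k.factorial * (C₁ * Real.Gamma (k + a + 1)) :=
            mul_le_mul_of_nonneg_left (h₁ k).1 (by positivity)
        _ = _ := by ring
    have hcomp : ((k : ℝ) + 1) ^ (-(a + 1 / 2)) ≤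
        2 ^ |-(a + 1 / 2)| * ((2 * k : ℕ) + 1 : ℝ) ^ (-(a + 1 / 2)) :=
      rpow_le_of_comparable hk1 (by positivity) (by push_cast; linarith)
        (by push_cast; linarith) _
    rw [div_le_iff₀ (by positivity)]
    have hrp : ((k : ℝ) + 1) ^ (a + 1 / 2) * ((k : ℝ) + 1) ^ (-(a + 1 / 2)) = 1 := by
      rw [← Real.rpow_add hk1]; simp
    calc (z ^ 2 / 4) ^ k
        = z ^ (2 * k) / (2 * k).factorial * (((2 * k).factorial : ℝ) * (4 ^ k)⁻¹ *
            ((k : ℝ) + 1) ^ (a + 1 / 2)) * ((k : ℝ) + 1) ^ (-(a + 1 / 2)) := by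
          rw [div_pow, ← pow_mul, mul_assoc _ _ (((k : ℝ) + 1) ^ (-(a + 1 / 2))),
            mul_assoc _ _ (((k : ℝ) + 1) ^ (-(a + 1 / 2))), hrp]
          field_simp
      _ ≤ z ^ (2 * k) / (2 * k).factorial * (C₁ * C₂ * (k.factorial * Real.Gamma (k + a + 1))) *
          (2 ^ |-(a + 1 / 2)| * ((2 * k : ℕ) + 1 : ℝ) ^ (-(a + 1 / 2))) := by gcongr
      _ = _ := by simp only [hg, hK]; ring
  have hs2 : Summable fun k : ℕ => g (2 * k) :=
    hs.comp_injective (i := fun k : ℕ => 2 * k) (fun i j h => by simpa using h)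
  have hB := summable_pow_div_factorial_mul_Gamma ha (z ^ 2 / 4)
  calc besselSeries a (z ^ 2 / 4) ≤ ∑' k, K * g (2 * k) :=
        Summable.tsum_le_tsum hterm hB.of_norm (hs2.mul_left K)
    _ = K * ∑' k, g (2 * k) := tsum_mul_left
    _ ≤ K * ∑' n, g n := by
        refine mul_le_mul_of_nonneg_left ?_ hK0.le
        exact hs2.tsum_le_tsum_of_inj (fun k : ℕ => 2 * k) (fun i j h => by simpa using h)
          (fun n _ => by simp only [hg]; positivity) (fun k => le_rfl) hs
    _ ≤ K * (C₃ * ((1 + z) ^ (-(a + 1 / 2)) * Real.exp z)) := by gcongr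
    _ = _ := by ring

theorem exists_one_add_rpow_le_exp (β : ℝ) {c : ℝ} (hc : 0 < c) :
    ∃ C : ℝ, 0 < C ∧ ∀ x : ℝ, 0 ≤ x → (1 + x) ^ β ≤ C * Real.exp (c * x) := by
  obtain ⟨m, hm⟩ := exists_nat_ge β
  refine ⟨m.factorial / c ^ m * Real.exp c, by positivity, fun x hx => ?_⟩
  have h := Real.pow_div_factorial_le_exp (c * (1 + x)) (by positivity) m
  have hf : (0 : ℝ) < m.factorial := by exact_mod_cast m.factorial_pos
  calc (1 + x) ^ β ≤ (1 + x) ^ (m : ℝ) := Real.rpow_le_rpow_of_exponent_le (by linarith) hm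
    _ = m.factorial / c ^ m * ((c * (1 + x)) ^ m / m.factorial) := by
        rw [Real.rpow_natCast, mul_pow]; field_simp
    _ ≤ m.factorial / c ^ m * Real.exp (c * (1 + x)) := by gcongr
    _ = _ := by rw [mul_add, mul_one, Real.exp_add]; ring

theorem summable_laguerreKernelTerm {a : ℝ} (ha : -1 < a) {t : ℝ} (ht : 0 < t) (x y : ℝ) :
    Summable (laguerreKernelTerm a t x y) := by
  refine (hasSum_hilleHardy ha x y (Real.exp_pos (-t)).le
    (by rw [Real.exp_lt_one_iff]; linarith)).summable.congr fun n => ?_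
  rw [laguerreKernelTerm_eq ha]

theorem laguerreKernel₁_eq {a : ℝ} (ha : -1 < a) {t : ℝ} (ht : 0 < t) (x y : ℝ) :
    laguerreKernel₁ a t x y = (1 - Real.exp (-t)) ^ (-(a + 1)) *
      Real.exp (-(Real.exp (-t) * (x + y) / (1 - Real.exp (-t)))) *
        besselSeries a (x * y * Real.exp (-t) / (1 - Real.exp (-t)) ^ 2) := by
  rw [← (hasSum_hilleHardy ha x y (Real.exp_pos (-t)).le
    (by rw [Real.exp_lt_one_iff]; linarith)).tsum_eq]
  exact tsum_congr fun n => laguerreKernelTerm_eq ha t x y n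

/-- The measure, up to constants, of an interval of radius `s` about `u ≥ 0` with respect to
`u ^ (2 a + 1) du` on the half-line. -/
noncomputable def cellVol (a u s : ℝ) : ℝ := s * (s ^ 2 + u ^ 2) ^ (a + 1 / 2)

theorem cellVol_pos (a u : ℝ) {s : ℝ} (hs : 0 < s) : 0 < cellVol a u s := by
  unfold cellVol; positivity

theorem laguerreKernel₁_le {a : ℝ} (ha : -1 < a) :
    ∃ C : ℝ, 0 < C ∧ ∀ u v ρ s t : ℝ, 0 < u → 0 < v → 0 < t → 0 < ρ → 0 < s →
      ρ ^ 2 = Real.exp (-t) → s ^ 2 = 1 - Real.exp (-t) →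
      0 ≤ laguerreKernel₁ a t (u ^ 2) (v ^ 2) ∧
      laguerreKernel₁ a t (u ^ 2) (v ^ 2) ≤
        C * (Real.exp (u ^ 2) / cellVol a u s * Real.exp (-((u - ρ * v) ^ 2 / (2 * s ^ 2)))) := by
  obtain ⟨C₁, hC₁, h₁⟩ := besselSeries_le ha
  obtain ⟨C₂, hC₂, h₂⟩ := exists_one_add_rpow_le_exp |-(a + 1 / 2)| (c := 1 / 2) (by norm_num)
  set b := a + 1 / 2 with hb
  refine ⟨C₁ * (3 ^ |-b| * C₂), by positivity, fun u v ρ s t hu hv ht hρ hs hρt hst => ?_⟩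
  have hρs : ρ ^ 2 = 1 - s ^ 2 := by linarith
  set z : ℝ := 2 * (ρ * u * v) / s ^ 2 with hz
  have hz0 : 0 ≤ z := by positivity
  have hBz := h₁ z hz0
  have hzz : u ^ 2 * v ^ 2 * ρ ^ 2 / (s ^ 2) ^ 2 = z ^ 2 / 4 := by rw [hz]; field_simp; ring
  have hBnn : 0 ≤ besselSeries a (z ^ 2 / 4) := tsum_nonneg fun k => by
    have := Real.Gamma_pos_of_pos (show (0 : ℝ) < k + a + 1 by
      have := k.cast_nonneg (α := ℝ); linarith)
    positivity
  rw [laguerreKernel₁_eq ha ht, ← hst, ← hρt, hzz]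
  refine ⟨by positivity, ?_⟩
  set D : ℝ := (u - ρ * v) ^ 2 / s ^ 2 with hD
  have hDs : D * s ^ 2 = (u - ρ * v) ^ 2 := by rw [hD]; field_simp
  have hD0 : 0 ≤ D := by positivity
  have hw : 0 < ρ * v := by positivity
  have hcomp : (s ^ 2 + 2 * (ρ * u * v)) ^ (-b) ≤
      (3 * (1 + D)) ^ |-b| * (s ^ 2 + u ^ 2) ^ (-b) := by
    refine rpow_le_of_comparable (by positivity) (by positivity) ?_ ?_ _
    · nlinarith [sq_nonneg (u - 2 * (u - ρ * v)), sq_nonneg (u - ρ * v),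
        mul_nonneg hD0 (sq_nonneg u), sq_nonneg (2 * u - ρ * v)]
    · nlinarith [sq_nonneg (u - (u - ρ * v)), mul_nonneg hD0 (mul_pos hw hu).le]
  have hscale : (s ^ 2) ^ (-(a + 1)) * (1 + z) ^ (-b) = s⁻¹ * (s ^ 2 + 2 * (ρ * u * v)) ^ (-b) := by
    have e1 : s ^ 2 + 2 * (ρ * u * v) = s ^ 2 * (1 + z) := by rw [hz]; field_simp
    have e2 : (s ^ 2) ^ (-(a + 1)) = s⁻¹ * (s ^ 2) ^ (-b) := by
      rw [← Real.rpow_natCast, ← Real.rpow_mul hs.le, ← Real.rpow_mul hs.le, ← Real.rpow_neg_one,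
        ← Real.rpow_add hs]
      congr 1; rw [hb]; push_cast; ring
    rw [e1, Real.mul_rpow (by positivity) (by positivity), e2]
    ring
  have hexp : Real.exp (-(ρ ^ 2 * (u ^ 2 + v ^ 2) / s ^ 2)) * Real.exp z =
      Real.exp (u ^ 2) * Real.exp (-D) := by
    rw [← Real.exp_add, ← Real.exp_add]
    congr 1
    rw [hz, hD]
    field_simp
    linear_combination (-u ^ 2) * hρs
  have hDhalf : (u - ρ * v) ^ 2 / (2 * s ^ 2) = D / 2 := by rw [hD]; field_simp
  have hexp2 : Real.exp (-D) * Real.exp (1 / 2 * D) = Real.exp (-(D / 2)) := by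
    rw [← Real.exp_add]; congr 1; ring
  have hvol : (cellVol a u s)⁻¹ = s⁻¹ * (s ^ 2 + u ^ 2) ^ (-b) := by
    rw [cellVol, mul_inv, Real.rpow_neg (by positivity)]
  rw [hDhalf, ← hexp2, div_eq_mul_inv (Real.exp (u ^ 2)), hvol]
  calc (s ^ 2) ^ (-(a + 1)) * Real.exp (-(ρ ^ 2 * (u ^ 2 + v ^ 2) / s ^ 2)) *
        besselSeries a (z ^ 2 / 4)
      ≤ (s ^ 2) ^ (-(a + 1)) * Real.exp (-(ρ ^ 2 * (u ^ 2 + v ^ 2) / s ^ 2)) *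
        (C₁ * ((1 + z) ^ (-b) * Real.exp z)) := by gcongr
    _ = C₁ * ((s ^ 2) ^ (-(a + 1)) * (1 + z) ^ (-b)) *
        (Real.exp (-(ρ ^ 2 * (u ^ 2 + v ^ 2) / s ^ 2)) * Real.exp z) := by ring
    _ = C₁ * (s⁻¹ * (s ^ 2 + 2 * (ρ * u * v)) ^ (-b)) * (Real.exp (u ^ 2) * Real.exp (-D)) := by
        rw [hscale, hexp]
    _ ≤ C₁ * (s⁻¹ * ((3 ^ |-b| * (C₂ * Real.exp (1 / 2 * D))) * (s ^ 2 + u ^ 2) ^ (-b))) *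
        (Real.exp (u ^ 2) * Real.exp (-D)) := by
        gcongr
        refine hcomp.trans ?_
        rw [Real.mul_rpow (by norm_num) (by positivity)]
        gcongr
        exact h₂ D hD0
    _ = _ := by ring

theorem cellVol_mono {a : ℝ} (ha : -1 < a) (u : ℝ) {s s' : ℝ} (hs : 0 < s) (hss' : s ≤ s') :
    cellVol a u s ≤ cellVol a u s' := by
  have hs' : 0 < s' := hs.trans_le hss'
  unfold cellVol
  rcases le_total 0 (a + 1 / 2) with hb | hb
  · gcongr
  · set K := s' / s with hK
    have hK1 : 1 ≤ K := (one_le_div hs).2 hss'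
    have hs'K : s' = K * s := by rw [hK]; field_simp
    have h1 : (K ^ 2 * (s ^ 2 + u ^ 2)) ^ (a + 1 / 2) ≤ (s' ^ 2 + u ^ 2) ^ (a + 1 / 2) := by
      refine Real.rpow_le_rpow_of_nonpos (by positivity) ?_ hb
      rw [hs'K]
      nlinarith [mul_nonneg (sub_nonneg.2 hK1) (sq_nonneg u),
        mul_nonneg (mul_nonneg (sub_nonneg.2 hK1) (by positivity : 0 ≤ K)) (sq_nonneg u)]
    rw [Real.mul_rpow (by positivity) (by positivity)] at h1
    have h2 : 1 ≤ K * (K ^ 2) ^ (a + 1 / 2) := by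
      have : K * (K ^ 2) ^ (a + 1 / 2) = K ^ (2 * a + 2) := by
        rw [← Real.rpow_natCast, ← Real.rpow_mul (by positivity)]
        nth_rewrite 1 [← Real.rpow_one K]
        rw [← Real.rpow_add (by positivity)]
        congr 1; push_cast; ring
      rw [this]
      exact Real.one_le_rpow hK1 (by linarith)
    calc s * (s ^ 2 + u ^ 2) ^ (a + 1 / 2)
        ≤ s * (s ^ 2 + u ^ 2) ^ (a + 1 / 2) * (K * (K ^ 2) ^ (a + 1 / 2)) :=
          le_mul_of_one_le_right (by positivity) h2
      _ = K * s * ((K ^ 2) ^ (a + 1 / 2) * (s ^ 2 + u ^ 2) ^ (a + 1 / 2)) := by ring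
      _ ≤ K * s * (s' ^ 2 + u ^ 2) ^ (a + 1 / 2) := by gcongr
      _ = _ := by rw [← hs'K]

theorem exists_cellVol_doubling (a : ℝ) :
    ∃ N : ℕ, ∀ u s K : ℝ, 0 < s → 1 ≤ K → cellVol a u (K * s) ≤ K ^ N * cellVol a u s := by
  obtain ⟨m, hm⟩ := exists_nat_ge |a + 1 / 2|
  refine ⟨1 + 2 * m, fun u s K hs hK => ?_⟩
  have hK0 : 0 < K := by linarith
  have h1 : ((K * s) ^ 2 + u ^ 2) ^ (a + 1 / 2) ≤
      (K ^ 2) ^ |a + 1 / 2| * (s ^ 2 + u ^ 2) ^ (a + 1 / 2) := by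
    have hK2 : 1 ≤ K ^ 2 := one_le_pow₀ hK
    refine rpow_le_of_comparable (by positivity) (by positivity) ?_ ?_ _
    · nlinarith [mul_nonneg (sub_nonneg.2 hK2) (sq_nonneg u)]
    · nlinarith [mul_nonneg (sub_nonneg.2 hK2) (sq_nonneg u),
        mul_nonneg (sub_nonneg.2 hK2) (sq_nonneg s),
        mul_nonneg (mul_nonneg (sub_nonneg.2 hK2) (sq_nonneg K)) (sq_nonneg s)]
  have h2 : (K ^ 2) ^ |a + 1 / 2| ≤ K ^ (2 * m) := by
    rw [pow_mul, ← Real.rpow_natCast (K ^ 2) m]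
    exact Real.rpow_le_rpow_of_exponent_le (one_le_pow₀ hK) hm
  unfold cellVol
  calc K * s * ((K * s) ^ 2 + u ^ 2) ^ (a + 1 / 2)
      ≤ K * s * (K ^ (2 * m) * (s ^ 2 + u ^ 2) ^ (a + 1 / 2)) := by
        gcongr; exact h1.trans (by gcongr)
    _ = _ := by rw [pow_add, pow_one]; ring

theorem cellVol_mul_mul (a u s : ℝ) {k : ℝ} (hk : 0 < k) :
    cellVol a (k * u) (k * s) = (k ^ 2) ^ (a + 1) * cellVol a u s := by
  have : (k ^ 2) ^ (a + 1) = k * (k ^ 2) ^ (a + 1 / 2) := by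
    rw [← Real.rpow_natCast, ← Real.rpow_mul hk.le, ← Real.rpow_mul hk.le]
    nth_rewrite 2 [← Real.rpow_one k]
    rw [← Real.rpow_add hk]
    congr 1; push_cast; ring
  unfold cellVol
  rw [this, show (k * s) ^ 2 + (k * u) ^ 2 = k ^ 2 * (s ^ 2 + u ^ 2) by ring,
    Real.mul_rpow (by positivity) (by positivity)]
  ring

theorem cellVol_le_of_abs_sub_le (a : ℝ) {u v s : ℝ} (hs : 0 < s) (huv : |u - v| ≤ s) :
    cellVol a u s ≤ 3 ^ |a + 1 / 2| * cellVol a v s := by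
  have h := sq_le_sq' (abs_le.1 huv).1 (abs_le.1 huv).2
  have h1 : (s ^ 2 + u ^ 2) ^ (a + 1 / 2) ≤
      3 ^ |a + 1 / 2| * (s ^ 2 + v ^ 2) ^ (a + 1 / 2) := by
    refine rpow_le_of_comparable (by positivity) (by positivity) ?_ ?_ _
    · nlinarith [sq_nonneg (u - 2 * v), sq_nonneg v]
    · nlinarith [sq_nonneg (2 * u - v), sq_nonneg u]
  unfold cellVol
  calc s * (s ^ 2 + u ^ 2) ^ (a + 1 / 2)
      ≤ s * (3 ^ |a + 1 / 2| * (s ^ 2 + v ^ 2) ^ (a + 1 / 2)) := by gcongr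
    _ = _ := by ring

theorem lintegral_rpow_Ioc {a T : ℝ} (ha : -1 < a) (hT : 0 ≤ T) :
    ∫⁻ x in Set.Ioc 0 T, ENNReal.ofReal (x ^ a) = ENNReal.ofReal (T ^ (a + 1) / (a + 1)) := by
  have hint : IntegrableOn (fun x : ℝ => x ^ a) (Set.Ioc 0 T) :=
    (intervalIntegrable_iff_integrableOn_Ioc_of_le hT).1 (intervalIntegral.intervalIntegrable_rpow' ha)
  rw [← ofReal_integral_eq_lintegral_ofReal hint, ← intervalIntegral.integral_of_le hT,
    integral_rpow (Or.inl ha), Real.zero_rpow (by linarith), sub_zero]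
  filter_upwards [ae_restrict_mem measurableSet_Ioc] with x hx
  exact Real.rpow_nonneg hx.1.le _

/-- The interval of radius `s` about `u` in the coordinate `√x` has measure at most
`C * cellVol a u s` with respect to `x ^ a dx`. -/
theorem lintegral_rpow_sqrt_ball_le {a : ℝ} (ha : -1 < a) :
    ∃ C : ℝ, 0 < C ∧ ∀ u s : ℝ, 0 ≤ u → 0 < s →
      ∫⁻ x in {x : ℝ | 0 < x ∧ |√x - u| ≤ s}, ENNReal.ofReal (x ^ a) ≤
        ENNReal.ofReal (C * cellVol a u s) := by
  have ha1 : 0 < a + 1 := by linarith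
  set C₁ : ℝ := 9 ^ (a + 1) / (a + 1) * 5 ^ |a + 1 / 2| with hC₁
  set C₂ : ℝ := 4 ^ |a| * 4 * 2 ^ |a + 1 / 2| with hC₂
  refine ⟨C₁ + C₂, by positivity, fun u s hu hs => ?_⟩
  have hvol := cellVol_pos a u hs
  have hb : ∀ k : ℝ, 0 < k → (k ^ 2) ^ (a + 1 / 2) = k * (k ^ 2) ^ a := by
    intro k hk
    rw [Real.rpow_add (by positivity), ← Real.sqrt_eq_rpow, Real.sqrt_sq hk.le]; ring
  have hb1 : ∀ k : ℝ, 0 < k → (k ^ 2) ^ (a + 1) = k * (k ^ 2) ^ (a + 1 / 2) := by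
    intro k hk
    rw [Real.rpow_add_one (by positivity), hb k hk]; ring
  rcases le_or_gt u (2 * s) with h | h
  · have hsub : {x : ℝ | 0 < x ∧ |√x - u| ≤ s} ⊆ Set.Ioc 0 (9 * s ^ 2) := by
      rintro x ⟨hx0, hx⟩
      refine ⟨hx0, ?_⟩
      have h1 : √x ≤ 3 * s := by linarith [(abs_le.1 hx).2]
      calc x = √x ^ 2 := (Real.sq_sqrt hx0.le).symm
        _ ≤ (3 * s) ^ 2 := by gcongr
        _ = _ := by ring
    refine (lintegral_mono_set hsub).trans ?_
    rw [lintegral_rpow_Ioc ha (by positivity)]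
    apply ENNReal.ofReal_le_ofReal
    have hc : (s ^ 2) ^ (a + 1 / 2) ≤ 5 ^ |a + 1 / 2| * (s ^ 2 + u ^ 2) ^ (a + 1 / 2) :=
      rpow_le_of_comparable (by positivity) (by positivity) (by nlinarith [sq_nonneg u])
        (by nlinarith) _
    calc (9 * s ^ 2) ^ (a + 1) / (a + 1)
        = 9 ^ (a + 1) / (a + 1) * (s * (s ^ 2) ^ (a + 1 / 2)) := by
          rw [Real.mul_rpow (by norm_num) (by positivity), hb1 s hs]; ring
      _ ≤ 9 ^ (a + 1) / (a + 1) * (s * (5 ^ |a + 1 / 2| * (s ^ 2 + u ^ 2) ^ (a + 1 / 2))) := by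
          gcongr
      _ = C₁ * cellVol a u s := by rw [hC₁, cellVol]; ring
      _ ≤ _ := by gcongr; linarith [show 0 < C₂ by positivity]
  · have hu0 : 0 < u := by linarith
    have hsub : {x : ℝ | 0 < x ∧ |√x - u| ≤ s} ⊆ Set.Icc ((u - s) ^ 2) ((u + s) ^ 2) := by
      rintro x ⟨hx0, hx⟩
      obtain ⟨h1, h2⟩ := abs_le.1 hx
      have h3 : x = √x ^ 2 := (Real.sq_sqrt hx0.le).symm
      rw [h3]
      constructor
      · have : 0 ≤ u - s := by linarith
        gcongr; linarith
      · gcongr; linarith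
    refine (lintegral_mono_set hsub).trans ?_
    have hle : ∀ x ∈ Set.Icc ((u - s) ^ 2) ((u + s) ^ 2),
        ENNReal.ofReal (x ^ a) ≤ ENNReal.ofReal (4 ^ |a| * (u ^ 2) ^ a) := by
      rintro x ⟨hx1, hx2⟩
      have hx4 : u ^ 2 ≤ 4 * x := by nlinarith
      have hx0 : 0 < x := by nlinarith [sq_pos_of_pos hu0]
      exact ENNReal.ofReal_le_ofReal (rpow_le_of_comparable hx0 (by positivity) (by nlinarith)
        hx4 _)
    refine (setLIntegral_mono measurable_const hle).trans ?_
    rw [setLIntegral_const, Real.volume_Icc, ← ENNReal.ofReal_mul (by positivity)]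
    apply ENNReal.ofReal_le_ofReal
    have hc : (u ^ 2) ^ (a + 1 / 2) ≤ 2 ^ |a + 1 / 2| * (s ^ 2 + u ^ 2) ^ (a + 1 / 2) :=
      rpow_le_of_comparable (by positivity) (by positivity) (by nlinarith [sq_nonneg s])
        (by nlinarith) _
    calc 4 ^ |a| * (u ^ 2) ^ a * ((u + s) ^ 2 - (u - s) ^ 2)
        = 4 ^ |a| * 4 * (s * (u ^ 2) ^ (a + 1 / 2)) := by rw [hb u hu0]; ring
      _ ≤ 4 ^ |a| * 4 * (s * (2 ^ |a + 1 / 2| * (s ^ 2 + u ^ 2) ^ (a + 1 / 2))) := by gcongr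
      _ = C₂ * cellVol a u s := by rw [hC₂, cellVol]; ring
      _ ≤ _ := by gcongr; linarith [show 0 < C₁ by positivity]

theorem lintegral_fin_prod_eq_prod {n : ℕ} {f : Fin n → ℝ → ENNReal}
    (hf : ∀ i, Measurable (f i)) :
    ∫⁻ x : Fin n → ℝ, ∏ i, f i (x i) = ∏ i, ∫⁻ x, f i x := by
  induction n with
  | zero => simp [volume_pi]
  | succ n ih =>
    rw [← (volume_preserving_piFinSuccAbove (fun _ : Fin (n + 1) => ℝ) 0).symm.lintegral_comp
      (by fun_prop)]
    simp only [MeasurableEquiv.piFinSuccAbove_symm_apply, Fin.insertNthEquiv_apply,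
      Fin.prod_univ_succ, Fin.insertNth_zero', Fin.cons_zero, Fin.cons_succ]
    rw [← ih fun i => hf i.succ, Measure.volume_eq_prod]
    have hm : Measurable fun x : Fin n → ℝ => ∏ i, f i.succ (x i) :=
      Finset.measurable_prod _ fun i _ => (hf i.succ).comp (measurable_pi_apply i)
    exact lintegral_prod_mul (μ := volume) (ν := volume) (hf 0).aemeasurable hm.aemeasurable

/-- The product of the one-dimensional `cellVol`. -/
noncomputable def boxVol {d : ℕ} (α u : Fin d → ℝ) (s : ℝ) : ℝ := ∏ i, cellVol (α i) (u i) s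

theorem boxVol_pos {d : ℕ} (α u : Fin d → ℝ) {s : ℝ} (hs : 0 < s) : 0 < boxVol α u s :=
  Finset.prod_pos fun _ _ => cellVol_pos _ _ hs

theorem boxVol_mono {d : ℕ} {α : Fin d → ℝ} (hα : ∀ i, -1 < α i) (u : Fin d → ℝ) {s s' : ℝ}
    (hs : 0 < s) (hss' : s ≤ s') : boxVol α u s ≤ boxVol α u s' :=
  Finset.prod_le_prod (fun _ _ => (cellVol_pos _ _ hs).le) fun i _ => cellVol_mono (hα i) _ hs hss'

theorem exists_boxVol_doubling {d : ℕ} (α : Fin d → ℝ) :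
    ∃ N : ℕ, ∀ (u : Fin d → ℝ) (s K : ℝ), 0 < s → 1 ≤ K →
      boxVol α u (K * s) ≤ K ^ N * boxVol α u s := by
  choose N hN using fun i => exists_cellVol_doubling (α i)
  refine ⟨∑ i, N i, fun u s K hs hK => ?_⟩
  rw [boxVol, boxVol, ← Finset.prod_pow_eq_pow_sum, ← Finset.prod_mul_distrib]
  exact Finset.prod_le_prod (fun _ _ => (cellVol_pos _ _ (by positivity)).le)
    fun i _ => hN i _ _ _ hs hK

/-- The coordinatewise square root. -/
noncomputable def sqrtVec {d : ℕ} (x : Fin d → ℝ) : Fin d → ℝ := fun i => √(x i)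

/-- The admissible radius at `u`: Gaussian weights are essentially constant on balls of this
radius. -/
noncomputable def admissibleRadius {d : ℕ} (u : Fin d → ℝ) : ℝ := 1 / (2 * (1 + ‖u‖))

theorem admissibleRadius_pos {d : ℕ} (u : Fin d → ℝ) : 0 < admissibleRadius u := by
  unfold admissibleRadius; positivity

@[fun_prop]
theorem measurable_sqrtVec {d : ℕ} : Measurable (sqrtVec (d := d)) := by
  unfold sqrtVec; fun_prop

theorem measurableSet_posOrthant (d : ℕ) : MeasurableSet (posOrthant d) := by
  have : posOrthant d = ⋂ i, (fun x : Fin d → ℝ => x i) ⁻¹' Set.Ioi 0 := by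
    ext x; simp [posOrthant]
  rw [this]
  exact MeasurableSet.iInter fun i => measurable_pi_apply i measurableSet_Ioi

theorem laguerreMeasure_apply {d : ℕ} (α : Fin d → ℝ) {E : Set (Fin d → ℝ)}
    (hE : MeasurableSet E) :
    laguerreMeasure α E = ∫⁻ x in E ∩ posOrthant d,
      ENNReal.ofReal ((∏ i, x i ^ α i) * Real.exp (-∑ i, x i)) := by
  rw [laguerreMeasure, withDensity_apply _ hE, Measure.restrict_restrict hE]

theorem laguerreMeasure_ball_le {d : ℕ} {α : Fin d → ℝ} (hα : ∀ i, -1 < α i) :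
    ∃ C : ℝ, 0 < C ∧ ∀ (u : Fin d → ℝ) (s : ℝ), (∀ i, 0 ≤ u i) → 0 < s →
      s ≤ 5 * admissibleRadius u →
      laguerreMeasure α (sqrtVec ⁻¹' Metric.closedBall u s) ≤
        ENNReal.ofReal (C * (Real.exp (-∑ i, u i ^ 2) * boxVol α u s)) := by
  choose c hc hle using fun i => lintegral_rpow_sqrt_ball_le (hα i)
  refine ⟨Real.exp (5 * d) * ∏ i, c i, mul_pos (Real.exp_pos _)
    (Finset.prod_pos fun i _ => hc i), fun u s hu hs hsu => ?_⟩
  have hmeas : MeasurableSet (sqrtVec ⁻¹' Metric.closedBall u s) :=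
    measurable_sqrtVec Metric.isClosed_closedBall.measurableSet
  have hus : ∀ i, 2 * u i * s ≤ 5 := by
    intro i
    have h1 : u i ≤ ‖u‖ := (le_abs_self _).trans (norm_le_pi_norm u i)
    have h2 : s * (2 * (1 + ‖u‖)) ≤ 5 := by
      rw [admissibleRadius, mul_one_div, le_div_iff₀ (by positivity)] at hsu; exact hsu
    nlinarith [norm_nonneg u]
  set f : Fin d → ℝ → ENNReal := fun i =>
    ({x : ℝ | 0 < x ∧ |√x - u i| ≤ s}).indicator fun x => ENNReal.ofReal (x ^ α i) with hf
  have hS : ∀ i, MeasurableSet {x : ℝ | 0 < x ∧ |√x - u i| ≤ s} := fun i =>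
    (measurableSet_lt measurable_const measurable_id).inter
      (measurableSet_le (f := fun x => |√x - u i|) (by fun_prop) measurable_const)
  have hfm : ∀ i, Measurable (f i) := fun i => Measurable.indicator (by fun_prop) (hS i)
  rw [laguerreMeasure_apply α hmeas,
    ← lintegral_indicator (hmeas.inter (measurableSet_posOrthant d))]
  have hpt : ∀ x : Fin d → ℝ, (sqrtVec ⁻¹' Metric.closedBall u s ∩ posOrthant d).indicator
      (fun x => ENNReal.ofReal ((∏ i, x i ^ α i) * Real.exp (-∑ i, x i))) x ≤
      ENNReal.ofReal (Real.exp (5 * d) * Real.exp (-∑ i, u i ^ 2)) * ∏ i, f i (x i) := by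
    intro x
    by_cases hx : x ∈ sqrtVec ⁻¹' Metric.closedBall u s ∩ posOrthant d
    · rw [Set.indicator_of_mem hx]
      obtain ⟨hxb, hxp⟩ := hx
      have hxi : ∀ i, |√(x i) - u i| ≤ s := by
        intro i
        have := (dist_pi_le_iff hs.le).1 (Metric.mem_closedBall.1 hxb) i
        rwa [Real.dist_eq] at this
      have hfi : ∀ i, f i (x i) = ENNReal.ofReal (x i ^ α i) := fun i =>
        Set.indicator_of_mem (s := {x : ℝ | 0 < x ∧ |√x - u i| ≤ s}) ⟨hxp i, hxi i⟩ _
      simp only [hfi]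
      rw [← ENNReal.ofReal_prod_of_nonneg (fun i _ => Real.rpow_nonneg (hxp i).le _),
        ← ENNReal.ofReal_mul (by positivity), mul_comm (∏ i, x i ^ α i)]
      apply ENNReal.ofReal_le_ofReal
      have hprod : 0 ≤ ∏ i, x i ^ α i := Finset.prod_nonneg fun i _ => Real.rpow_nonneg (hxp i).le _
      refine mul_le_mul_of_nonneg_right ?_ hprod
      rw [← Real.exp_add]
      apply Real.exp_le_exp.2
      have hi : ∀ i ∈ Finset.univ, u i ^ 2 - 5 ≤ x i := by
        intro i _
        have h1 := hxp i
        have h2 := (abs_le.1 (hxi i)).1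
        have h3 := hus i
        have h4 : √(x i) ^ 2 = x i := Real.sq_sqrt h1.le
        have h5 := Real.sqrt_nonneg (x i)
        rcases le_total s (u i) with h6 | h6
        · nlinarith
        · nlinarith [hu i]
      have := Finset.sum_le_sum hi
      simp only [Finset.sum_sub_distrib, Finset.sum_const, Finset.card_univ, Fintype.card_fin,
        nsmul_eq_mul] at this
      linarith
    · rw [Set.indicator_of_notMem hx]; exact zero_le
  refine (lintegral_mono hpt).trans ?_
  rw [lintegral_const_mul _ (by fun_prop), lintegral_fin_prod_eq_prod hfm]
  have hprod : ∏ i, ∫⁻ x, f i x ≤ ENNReal.ofReal (∏ i, (c i * cellVol (α i) (u i) s)) := by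
    rw [ENNReal.ofReal_prod_of_nonneg fun i _ =>
      (mul_pos (hc i) (cellVol_pos _ _ hs)).le]
    refine Finset.prod_le_prod' fun i _ => ?_
    rw [lintegral_indicator (hS i)]
    exact hle i _ _ (hu i) hs
  refine (mul_le_mul_right hprod _).trans ?_
  rw [← ENNReal.ofReal_mul (by positivity), Finset.prod_mul_distrib]
  apply le_of_eq
  congr 1
  rw [boxVol]; ring

theorem laguerreKernel_le {d : ℕ} {α : Fin d → ℝ} (hα : ∀ i, -1 < α i) :
    ∃ C : ℝ, 0 < C ∧ ∀ (x y : Fin d → ℝ) (ρ s t : ℝ), x ∈ posOrthant d → y ∈ posOrthant d →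
      0 < t → 0 < ρ → 0 < s → ρ ^ 2 = Real.exp (-t) → s ^ 2 = 1 - Real.exp (-t) →
      0 ≤ laguerreKernel α t x y ∧
      laguerreKernel α t x y ≤ C * (Real.exp (∑ i, x i) *
        (Real.exp (-(‖sqrtVec x - ρ • sqrtVec y‖ ^ 2 / (2 * s ^ 2))) /
          boxVol α (sqrtVec x) s)) := by
  choose c hc hle using fun i => laguerreKernel₁_le (hα i)
  refine ⟨∏ i, c i, Finset.prod_pos fun i _ => hc i,
    fun x y ρ s t hx hy ht hρ hs hρt hst => ?_⟩
  have h := fun i => hle i (√(x i)) (√(y i)) ρ s t (Real.sqrt_pos.2 (hx i))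
    (Real.sqrt_pos.2 (hy i)) ht hρ hs hρt hst
  simp only [Real.sq_sqrt (hx _).le, Real.sq_sqrt (hy _).le] at h
  refine ⟨Finset.prod_nonneg fun i _ => (h i).1, ?_⟩
  refine (Finset.prod_le_prod (fun i _ => (h i).1) fun i _ => (h i).2).trans ?_
  rw [Finset.prod_mul_distrib, Finset.prod_mul_distrib, Finset.prod_div_distrib, ← Real.exp_sum,
    ← Real.exp_sum, div_mul_eq_mul_div, ← mul_div_assoc, ← mul_div_assoc, ← mul_div_assoc]
  have hbox : boxVol α (sqrtVec x) s = ∏ i, cellVol (α i) (√(x i)) s := rfl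
  rw [hbox]
  have hpos : 0 < ∏ i, cellVol (α i) (√(x i)) s := Finset.prod_pos fun i _ => cellVol_pos _ _ hs
  have hcpos : 0 < ∏ i, c i := Finset.prod_pos fun i _ => hc i
  gcongr
  rw [Finset.sum_neg_distrib, neg_le_neg_iff]
  have hsum0 : 0 ≤ ∑ i, (√(x i) - ρ * √(y i)) ^ 2 / (2 * s ^ 2) :=
    Finset.sum_nonneg fun i _ => by positivity
  have hnorm : ‖sqrtVec x - ρ • sqrtVec y‖ ≤
      √(2 * s ^ 2 * ∑ i, (√(x i) - ρ * √(y i)) ^ 2 / (2 * s ^ 2)) := by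
    refine (pi_norm_le_iff_of_nonneg (Real.sqrt_nonneg _)).2 fun i => ?_
    apply Real.le_sqrt_of_sq_le
    have := Finset.single_le_sum (f := fun i => (√(x i) - ρ * √(y i)) ^ 2 / (2 * s ^ 2))
      (fun i _ => by positivity) (Finset.mem_univ i)
    rw [Real.norm_eq_abs, sq_abs]
    simp only [sqrtVec, Pi.sub_apply, Pi.smul_apply, smul_eq_mul]
    calc (√(x i) - ρ * √(y i)) ^ 2
        = 2 * s ^ 2 * ((√(x i) - ρ * √(y i)) ^ 2 / (2 * s ^ 2)) := by field_simp
      _ ≤ _ := by gcongr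
  have h2 := pow_le_pow_left₀ (norm_nonneg _) hnorm 2
  rw [Real.sq_sqrt (by positivity)] at h2
  rw [div_le_iff₀ (by positivity)]
  linarith

/-- A lower bound for the distance from `u` to the ray through `v`, normalized with respect to
the `j`-th coordinate. -/
noncomputable def rayGap {d : ℕ} (j : Fin d) (u v : Fin d → ℝ) : ℝ :=
  ‖fun i => (u i * v j - u j * v i) / (v i + v j)‖

theorem rayGap_nonneg {d : ℕ} (j : Fin d) (u v : Fin d → ℝ) : 0 ≤ rayGap j u v := norm_nonneg _

theorem rayGap_le {d : ℕ} (j : Fin d) (u : Fin d → ℝ) {v : Fin d → ℝ} (hv : ∀ i, 0 < v i)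
    (ρ : ℝ) : rayGap j u v ≤ ‖u - ρ • v‖ := by
  refine (pi_norm_le_iff_of_nonneg (norm_nonneg _)).2 fun i => ?_
  have hi := norm_le_pi_norm (u - ρ • v) i
  have hj := norm_le_pi_norm (u - ρ • v) j
  simp only [Pi.sub_apply, Pi.smul_apply, smul_eq_mul, Real.norm_eq_abs] at hi hj
  have hij : 0 < v i + v j := add_pos (hv i) (hv j)
  rw [Real.norm_eq_abs, abs_div, abs_of_pos hij, div_le_iff₀ hij]
  calc |u i * v j - u j * v i| = |(u i - ρ * v i) * v j - (u j - ρ * v j) * v i| := by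
        congr 1; ring
    _ ≤ |(u i - ρ * v i) * v j| + |(u j - ρ * v j) * v i| := abs_sub _ _
    _ = |u i - ρ * v i| * v j + |u j - ρ * v j| * v i := by
        rw [abs_mul, abs_mul, abs_of_pos (hv i), abs_of_pos (hv j)]
    _ ≤ ‖u - ρ • v‖ * v j + ‖u - ρ • v‖ * v i := by
        gcongr <;> exact (hv _).le
    _ = _ := by ring

/-- Gaussian profiles are dominated by a global profile, which does not depend on time, or by
averages over balls of admissible radius. -/
theorem gaussian_div_boxVol_le {d : ℕ} {α : Fin d → ℝ} (hα : ∀ i, -1 < α i) :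
    ∃ C : ℝ, 0 < C ∧ ∀ (j : Fin d) (u v : Fin d → ℝ) (ρ s : ℝ), (∀ i, 0 < v i) → 0 < ρ → 0 < s →
      ρ ^ 2 + s ^ 2 = 1 →
      Real.exp (-(‖u - ρ • v‖ ^ 2 / (2 * s ^ 2))) / boxVol α u s ≤
          C / boxVol α u (admissibleRadius u + rayGap j u v) ∨
        ∃ k : ℕ, ‖u - v‖ ≤ min (2 ^ k * s) (admissibleRadius u) ∧
          Real.exp (-(‖u - ρ • v‖ ^ 2 / (2 * s ^ 2))) / boxVol α u s ≤
            C * (1 / 2) ^ k / boxVol α u (min (2 ^ k * s) (admissibleRadius u)) := by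
  obtain ⟨N, hN⟩ := exists_boxVol_doubling α
  obtain ⟨C₀, hC₀, hexp⟩ := exists_one_add_rpow_le_exp (N + 1 : ℕ) (c := 1) one_pos
  set C₁ : ℝ := C₀ * Real.exp (1 / 2) with hC₁
  have hC₁0 : 0 < C₁ := by positivity
  refine ⟨C₁ * 4 ^ (N + 1), by positivity, fun j u v ρ s hv hρ hs hρs => ?_⟩
  set r := admissibleRadius u with hr
  have hr0 : 0 < r := admissibleRadius_pos u
  set h := rayGap j u v with hh
  have hh0 : 0 ≤ h := rayGap_nonneg j u v
  set δ := ‖u - ρ • v‖ / s with hδ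
  have hδ0 : 0 ≤ δ := by positivity
  have hδs : ‖u - ρ • v‖ = δ * s := by rw [hδ]; field_simp
  have hhδ : h ≤ δ * s := hδs ▸ rayGap_le j u hv ρ
  have hbox : 0 < boxVol α u s := boxVol_pos α u hs
  -- polynomial decay
  have hdecay : Real.exp (-(‖u - ρ • v‖ ^ 2 / (2 * s ^ 2))) * (1 + δ) ^ (N + 1) ≤ C₁ := by
    have h1 := hexp δ hδ0
    rw [Real.rpow_natCast] at h1
    have h2 : ‖u - ρ • v‖ ^ 2 / (2 * s ^ 2) = δ ^ 2 / 2 := by rw [hδs]; field_simp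
    rw [h2]
    calc Real.exp (-(δ ^ 2 / 2)) * (1 + δ) ^ (N + 1)
        ≤ Real.exp (-(δ ^ 2 / 2)) * (C₀ * Real.exp (1 * δ)) := by gcongr
      _ = C₀ * Real.exp (-(δ ^ 2 / 2) + δ) := by rw [Real.exp_add, one_mul]; ring
      _ ≤ C₁ := by
        rw [hC₁]; gcongr; nlinarith [sq_nonneg (δ - 1)]
  set G := Real.exp (-(‖u - ρ • v‖ ^ 2 / (2 * s ^ 2))) with hG
  have hG0 : 0 < G := Real.exp_pos _
  have hglobal : r + h ≤ 4 * (1 + δ) * s →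
      G / boxVol α u s ≤ C₁ * 4 ^ (N + 1) / boxVol α u (r + h) := by
    intro hle
    have hrh : 0 < r + h := by positivity
    have h1 : boxVol α u (r + h) ≤ (4 * (1 + δ)) ^ N * boxVol α u s :=
      (boxVol_mono hα u hrh hle).trans (hN u s _ hs (by linarith))
    rw [div_le_div_iff₀ hbox (boxVol_pos α u hrh)]
    calc G * boxVol α u (r + h) ≤ G * ((4 * (1 + δ)) ^ N * boxVol α u s) := by gcongr
      _ = (G * (1 + δ) ^ N * 1) * 4 ^ N * boxVol α u s := by rw [mul_pow]; ring
      _ ≤ (G * (1 + δ) ^ N * (1 + δ)) * 4 ^ (N + 1) * boxVol α u s := by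
        gcongr
        · linarith
        · norm_num
        · omega
      _ = (G * (1 + δ) ^ (N + 1)) * 4 ^ (N + 1) * boxVol α u s := by rw [pow_succ (1 + δ)]; ring
      _ ≤ C₁ * 4 ^ (N + 1) * boxVol α u s := by gcongr
  rcases le_or_gt r s with hrs | hrs
  · left
    apply hglobal
    nlinarith
  have hr1 : r * (1 + ‖u‖) = 1 / 2 := by
    rw [hr, admissibleRadius]; field_simp
  have hrhalf : r ≤ 1 / 2 := by nlinarith [norm_nonneg u]
  have hρhalf : 1 / 2 ≤ ρ := by
    by_contra hcon
    nlinarith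
  have hρ1 : ρ ≤ 1 := by nlinarith [sq_nonneg s]
  have huv : ‖u - v‖ ≤ 2 * (1 + δ) * s := by
    have h1 : ρ • (u - v) = (u - ρ • v) - (1 - ρ) • u := by
      ext i; simp only [Pi.smul_apply, Pi.sub_apply, smul_eq_mul]; ring
    have h2 : ρ * ‖u - v‖ ≤ δ * s + (1 - ρ) * ‖u‖ := by
      calc ρ * ‖u - v‖ = ‖ρ • (u - v)‖ := by rw [norm_smul, Real.norm_of_nonneg hρ.le]
        _ ≤ ‖u - ρ • v‖ + ‖(1 - ρ) • u‖ := by rw [h1]; exact norm_sub_le _ _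
        _ = _ := by rw [hδs, norm_smul, Real.norm_of_nonneg (by linarith)]
    have h3 : 1 - ρ ≤ s ^ 2 := by nlinarith
    have h4 : s ^ 2 * ‖u‖ ≤ s := by
      have : s * ‖u‖ ≤ 1 := by nlinarith [norm_nonneg u, mul_le_mul_of_nonneg_right hrs.le (norm_nonneg u)]
      nlinarith
    have h5 : (1 - ρ) * ‖u‖ ≤ s := (mul_le_mul_of_nonneg_right h3 (norm_nonneg u)).trans h4
    nlinarith [norm_nonneg (u - v), mul_le_mul_of_nonneg_right hρhalf (norm_nonneg (u - v))]
  rcases lt_or_ge r ‖u - v‖ with hlt | hge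
  · left
    apply hglobal
    nlinarith
  · right
    obtain ⟨n, hn1, hn2⟩ := exists_nat_pow_near (x := 2 * (1 + δ)) (y := 2) (by linarith)
      (by norm_num)
    set k := n + 1 with hk
    have hmin : 0 < min (2 ^ k * s) r := lt_min (by positivity) hr0
    refine ⟨k, le_min (huv.trans (by gcongr)) hge, ?_⟩
    have hδk : (2 : ℝ) ^ k ≤ 4 * (1 + δ) := by rw [hk, pow_succ]; linarith
    have h1 : boxVol α u (min (2 ^ k * s) r) ≤ (2 ^ k) ^ N * boxVol α u s :=
      (boxVol_mono hα u hmin (min_le_left _ _)).trans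
        (hN u s _ hs (one_le_pow₀ (by norm_num)))
    rw [div_le_div_iff₀ hbox (boxVol_pos α u hmin)]
    have h2k : ((1 : ℝ) / 2) ^ k * 2 ^ k = 1 := by rw [← mul_pow]; norm_num
    calc G * boxVol α u (min (2 ^ k * s) r) ≤ G * ((2 ^ k) ^ N * boxVol α u s) := by gcongr
      _ = G * (2 ^ k) ^ (N + 1) * (1 / 2) ^ k * boxVol α u s := by
        rw [pow_succ]; linear_combination (-(G * (2 ^ k) ^ N * boxVol α u s)) * h2k
      _ ≤ G * (4 * (1 + δ)) ^ (N + 1) * (1 / 2) ^ k * boxVol α u s := by gcongr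
      _ = G * (1 + δ) ^ (N + 1) * 4 ^ (N + 1) * (1 / 2) ^ k * boxVol α u s := by
        rw [mul_pow]; ring
      _ ≤ C₁ * 4 ^ (N + 1) * (1 / 2) ^ k * boxVol α u s := by gcongr

/-- Weak type estimate for the maximal function over balls of admissible radius. -/
theorem laguerreMeasure_local_le {d : ℕ} {α : Fin d → ℝ} (hα : ∀ i, -1 < α i) :
    ∃ C : ℝ, 0 < C ∧ ∀ (g : (Fin d → ℝ) → ENNReal) (l : ℝ), 0 < l →
      laguerreMeasure α {x ∈ posOrthant d | ∃ ρ : ℝ, 0 < ρ ∧ ρ ≤ admissibleRadius (sqrtVec x) ∧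
        ENNReal.ofReal (l * (Real.exp (-∑ i, x i) * boxVol α (sqrtVec x) ρ)) <
          ∫⁻ y in sqrtVec ⁻¹' Metric.closedBall (sqrtVec x) ρ, g y ∂(laguerreMeasure α)} ≤
      ENNReal.ofReal (C / l) * ∫⁻ y, g y ∂(laguerreMeasure α) := by
  obtain ⟨C, hC, hball⟩ := laguerreMeasure_ball_le hα
  obtain ⟨N, hN⟩ := exists_boxVol_doubling α
  refine ⟨C * 5 ^ N, by positivity, fun g l hl => ?_⟩
  set μ := laguerreMeasure α with hμ
  set E := {x ∈ posOrthant d | ∃ ρ : ℝ, 0 < ρ ∧ ρ ≤ admissibleRadius (sqrtVec x) ∧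
        ENNReal.ofReal (l * (Real.exp (-∑ i, x i) * boxVol α (sqrtVec x) ρ)) <
          ∫⁻ y in sqrtVec ⁻¹' Metric.closedBall (sqrtVec x) ρ, g y ∂μ} with hE
  have hex : ∀ x, ∃ ρ : ℝ, x ∈ E → 0 < ρ ∧ ρ ≤ admissibleRadius (sqrtVec x) ∧
        ENNReal.ofReal (l * (Real.exp (-∑ i, x i) * boxVol α (sqrtVec x) ρ)) <
          ∫⁻ y in sqrtVec ⁻¹' Metric.closedBall (sqrtVec x) ρ, g y ∂μ := by
    intro x
    by_cases hx : x ∈ E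
    · obtain ⟨ρ, h⟩ := hx.2
      exact ⟨ρ, fun _ => h⟩
    · exact ⟨0, fun h => absurd h hx⟩
  choose ρ hρ using hex
  have hadm : ∀ u : Fin d → ℝ, admissibleRadius u ≤ 1 := fun u => by
    rw [admissibleRadius, div_le_one (by positivity)]
    linarith [norm_nonneg u]
  obtain ⟨U, hUE, hdisj, hcover⟩ := Vitali.exists_disjoint_subfamily_covering_enlargement_closedBall
    E sqrtVec ρ 1 (fun x hx => (hρ x hx).2.1.trans (hadm _)) 5 (by norm_num)
  have hcount : U.Countable := hdisj.countable_of_nonempty_interior fun x hx =>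
    ⟨sqrtVec x, Metric.ball_subset_interior_closedBall
      (Metric.mem_ball_self (hρ x (hUE hx)).1)⟩
  have hmeas : ∀ x s, MeasurableSet (sqrtVec ⁻¹' Metric.closedBall (sqrtVec x : Fin d → ℝ) s) :=
    fun x s => measurable_sqrtVec Metric.isClosed_closedBall.measurableSet
  have hEsub : E ⊆ ⋃ x ∈ U, sqrtVec ⁻¹' Metric.closedBall (sqrtVec x) (5 * ρ x) := by
    intro x hx
    obtain ⟨b, hb, hsub⟩ := hcover x hx
    exact Set.mem_biUnion hb (hsub (Metric.mem_closedBall_self (hρ x hx).1.le))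
  have hone : ∀ x ∈ U, μ (sqrtVec ⁻¹' Metric.closedBall (sqrtVec x) (5 * ρ x)) ≤
      ENNReal.ofReal (C * 5 ^ N / l) *
        ∫⁻ y in sqrtVec ⁻¹' Metric.closedBall (sqrtVec x) (ρ x), g y ∂μ := by
    intro x hx
    obtain ⟨h1, h2, h3⟩ := hρ x (hUE hx)
    have hxp : x ∈ posOrthant d := (hUE hx).1
    have hsum : ∑ i, sqrtVec x i ^ 2 = ∑ i, x i :=
      Finset.sum_congr rfl fun i _ => Real.sq_sqrt (hxp i).le
    have hb := hball (sqrtVec x) (5 * ρ x) (fun i => Real.sqrt_nonneg _) (by positivity)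
      (by linarith)
    rw [hsum] at hb
    refine hb.trans ?_
    calc ENNReal.ofReal (C * (Real.exp (-∑ i, x i) * boxVol α (sqrtVec x) (5 * ρ x)))
        ≤ ENNReal.ofReal (C * 5 ^ N / l *
            (l * (Real.exp (-∑ i, x i) * boxVol α (sqrtVec x) (ρ x)))) := by
          apply ENNReal.ofReal_le_ofReal
          have := hN (sqrtVec x) (ρ x) 5 h1 (by norm_num)
          calc C * (Real.exp (-∑ i, x i) * boxVol α (sqrtVec x) (5 * ρ x))
              ≤ C * (Real.exp (-∑ i, x i) * (5 ^ N * boxVol α (sqrtVec x) (ρ x))) := by gcongr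
            _ = _ := by field_simp
      _ = ENNReal.ofReal (C * 5 ^ N / l) *
            ENNReal.ofReal (l * (Real.exp (-∑ i, x i) * boxVol α (sqrtVec x) (ρ x))) :=
          ENNReal.ofReal_mul (by positivity)
      _ ≤ _ := by gcongr
  calc μ E ≤ μ (⋃ x ∈ U, sqrtVec ⁻¹' Metric.closedBall (sqrtVec x) (5 * ρ x)) :=
        measure_mono hEsub
    _ ≤ ∑' x : U, μ (sqrtVec ⁻¹' Metric.closedBall (sqrtVec (x : Fin d → ℝ)) (5 * ρ x)) :=
        measure_biUnion_le _ hcount _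
    _ ≤ ∑' x : U, ENNReal.ofReal (C * 5 ^ N / l) *
        ∫⁻ y in sqrtVec ⁻¹' Metric.closedBall (sqrtVec (x : Fin d → ℝ)) (ρ x), g y ∂μ :=
        ENNReal.tsum_le_tsum fun x => hone x x.2
    _ = ENNReal.ofReal (C * 5 ^ N / l) *
        ∫⁻ y in ⋃ x ∈ U, sqrtVec ⁻¹' Metric.closedBall (sqrtVec x) (ρ x), g y ∂μ := by
        rw [ENNReal.tsum_mul_left, lintegral_biUnion hcount (fun x _ => hmeas x _)]
        exact fun x hx y hy hxy => (hdisj hx hy hxy).preimage _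
    _ ≤ _ := by gcongr; exact Measure.restrict_le_self

/-- A one-dimensional factor of the angular part of the global kernel. -/
noncomputable def angularProfile (a κ η σ θ : ℝ) : ℝ :=
  (η / (η + |√θ - σ|)) ^ κ / cellVol a √θ (η + |√θ - σ|)

theorem angularProfile_nonneg (a κ σ θ : ℝ) {η : ℝ} (hη : 0 < η) :
    0 ≤ angularProfile a κ η σ θ := by
  have h : 0 < η + |√θ - σ| := by positivity
  exact div_nonneg (by positivity) (cellVol_pos a _ h).le

theorem lintegral_angularProfile_le {a κ : ℝ} (ha : -1 < a) (hκ : 0 < κ) :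
    ∃ C : ℝ, 0 < C ∧ ∀ η σ : ℝ, 0 < η → 0 ≤ σ →
      ∫⁻ θ in Set.Ioi (0 : ℝ), ENNReal.ofReal (θ ^ a) *
        ENNReal.ofReal (angularProfile a κ η σ θ) ≤ ENNReal.ofReal C := by
  obtain ⟨N, hN⟩ := exists_cellVol_doubling a
  obtain ⟨C₁, hC₁, hball⟩ := lintegral_rpow_sqrt_ball_le ha
  set q : ℝ := (1 / 2) ^ κ with hq
  have hq0 : 0 < q := by positivity
  have hq1 : q < 1 := Real.rpow_lt_one (by norm_num) (by norm_num) hκ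
  set K : ℝ := q⁻¹ * (2 ^ N * 3 ^ |a + 1 / 2|) with hK
  have hK0 : 0 < K := by positivity
  have h1q : 0 < 1 - q := by linarith
  refine ⟨K * C₁ * (1 - q)⁻¹, by positivity, fun η σ hη hσ => ?_⟩
  set S : ℕ → Set ℝ := fun k => {θ : ℝ | 0 < θ ∧ |√θ - σ| ≤ 2 ^ k * η} with hS
  have hSm : ∀ k, MeasurableSet (S k) := fun k =>
    (measurableSet_lt measurable_const measurable_id).inter
      (measurableSet_le (f := fun x => |√x - σ|) (by fun_prop) measurable_const)
  have hpt : ∀ θ ∈ Set.Ioi (0 : ℝ), ENNReal.ofReal (θ ^ a) *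
      ENNReal.ofReal (angularProfile a κ η σ θ) ≤
      ∑' k : ℕ, ENNReal.ofReal (K * q ^ k / cellVol a σ (2 ^ k * η)) *
        (S k).indicator (fun θ => ENNReal.ofReal (θ ^ a)) θ := by
    intro θ hθ
    set δ := |√θ - σ| / η with hδ
    have hδη : |√θ - σ| = δ * η := by rw [hδ]; field_simp
    have hδ0 : 0 ≤ δ := by positivity
    obtain ⟨n, hn1, hn2⟩ := exists_nat_pow_near (x := 1 + δ) (y := 2) (by linarith)
      (by norm_num)
    have hk : |√θ - σ| ≤ 2 ^ (n + 1) * η := by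
      rw [hδη]; gcongr; linarith
    have hpos : 0 < 2 ^ (n + 1) * η := by positivity
    have hε : η + |√θ - σ| = (1 + δ) * η := by rw [hδη]; ring
    refine le_trans ?_ (ENNReal.le_tsum (n + 1))
    rw [Set.indicator_of_mem (show θ ∈ S (n + 1) from ⟨hθ, hk⟩), mul_comm]
    refine mul_le_mul_left (ENNReal.ofReal_le_ofReal ?_) _
    have h1 : cellVol a σ (2 ^ (n + 1) * η) ≤
        3 ^ |a + 1 / 2| * (2 ^ N * cellVol a √θ ((1 + δ) * η)) := by
      calc cellVol a σ (2 ^ (n + 1) * η)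
          ≤ 3 ^ |a + 1 / 2| * cellVol a √θ (2 ^ (n + 1) * η) :=
            cellVol_le_of_abs_sub_le a hpos (by rw [abs_sub_comm]; exact hk)
        _ = 3 ^ |a + 1 / 2| * cellVol a √θ (2 * (2 ^ n * η)) := by
            rw [pow_succ']; ring_nf
        _ ≤ 3 ^ |a + 1 / 2| * (2 ^ N * cellVol a √θ (2 ^ n * η)) := by
            gcongr
            exact hN _ _ _ (by positivity) (by norm_num)
        _ ≤ _ := by
            gcongr
            exact cellVol_mono ha _ (by positivity) (by gcongr)
    have h2 : (η / ((1 + δ) * η)) ^ κ ≤ q⁻¹ * q ^ (n + 1) := by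
      have e : η / ((1 + δ) * η) = (1 + δ)⁻¹ := by field_simp
      have e2 : q⁻¹ * q ^ (n + 1) = ((1 / 2 : ℝ) ^ n) ^ κ := by
        rw [pow_succ', inv_mul_cancel_left₀ hq0.ne', hq, ← Real.rpow_natCast, ← Real.rpow_natCast,
          ← Real.rpow_mul (by norm_num), ← Real.rpow_mul (by norm_num), mul_comm]
      rw [e, e2]
      refine Real.rpow_le_rpow (by positivity) ?_ hκ.le
      rw [one_div, inv_pow]
      exact inv_anti₀ (by positivity) hn1
    rw [angularProfile, hε, div_le_div_iff₀ (cellVol_pos _ _ (by positivity))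
      (cellVol_pos _ _ hpos)]
    have hc := cellVol_pos a √θ (s := (1 + δ) * η) (by positivity)
    have hc' := cellVol_pos a σ hpos
    calc (η / ((1 + δ) * η)) ^ κ * cellVol a σ (2 ^ (n + 1) * η)
        ≤ (q⁻¹ * q ^ (n + 1)) *
          (3 ^ |a + 1 / 2| * (2 ^ N * cellVol a √θ ((1 + δ) * η))) := by gcongr
      _ = _ := by rw [hK]; ring
  refine (setLIntegral_mono' measurableSet_Ioi hpt).trans ((setLIntegral_le_lintegral _ _).trans ?_)
  rw [lintegral_tsum fun k => ((Measurable.indicator (by fun_prop) (hSm k)).const_mul _).aemeasurable]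
  have hterm : ∀ k : ℕ, ∫⁻ θ, ENNReal.ofReal (K * q ^ k / cellVol a σ (2 ^ k * η)) *
        (S k).indicator (fun θ => ENNReal.ofReal (θ ^ a)) θ ≤
      ENNReal.ofReal (K * C₁) * ENNReal.ofReal q ^ k := by
    intro k
    have hc := cellVol_pos a σ (s := 2 ^ k * η) (by positivity)
    rw [lintegral_const_mul _ (Measurable.indicator (by fun_prop) (hSm k)),
      lintegral_indicator (hSm k)]
    refine (mul_le_mul_right (hball σ (2 ^ k * η) hσ (by positivity)) _).trans ?_
    rw [← ENNReal.ofReal_mul (by positivity), ← ENNReal.ofReal_pow hq0.le,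
      ← ENNReal.ofReal_mul (by positivity)]
    apply le_of_eq
    congr 1
    field_simp
  refine (ENNReal.tsum_le_tsum hterm).trans ?_
  rw [ENNReal.tsum_mul_left, ENNReal.tsum_geometric, ← ENNReal.ofReal_one,
    ← ENNReal.ofReal_sub _ hq0.le, ← ENNReal.ofReal_inv_of_pos h1q,
    ← ENNReal.ofReal_mul (by positivity)]

theorem lintegral_exp_neg_superlevel_le (κ : ENNReal) {S : ℝ} (hS : 1 ≤ S) :
    ∫⁻ q in {q : ℝ | 1 < ENNReal.ofReal (Real.exp (q * S)) * κ},
      ENNReal.ofReal (Real.exp (-(q * S))) ≤ κ := by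
  induction κ with
  | top => exact le_top
  | coe k =>
    rcases eq_or_ne k 0 with rfl | hk
    · simp
    have hk0 : 0 < (k : ℝ) := by positivity
    have hset : {q : ℝ | 1 < ENNReal.ofReal (Real.exp (q * S)) * (k : ENNReal)} =
        Set.Ioi (-Real.log k / S) := by
      ext q
      simp only [Set.mem_ofPred_eq, Set.mem_Ioi]
      rw [← ENNReal.ofReal_coe_nnreal, ← ENNReal.ofReal_mul (Real.exp_pos _).le,
        ← ENNReal.ofReal_one, ENNReal.ofReal_lt_ofReal_iff (by positivity),
        div_lt_iff₀ (by linarith)]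
      constructor
      · intro h
        have := Real.log_lt_log one_pos h
        rw [Real.log_one, Real.log_mul (Real.exp_pos _).ne' hk0.ne', Real.log_exp] at this
        linarith
      · intro h
        calc (1 : ℝ) = Real.exp (-Real.log k) * k := by
              rw [Real.exp_neg, Real.exp_log hk0]; field_simp
          _ < _ := by gcongr
    have e : ∀ q : ℝ, Real.exp (-(q * S)) = Real.exp (-S * q) := fun q => by congr 1; ring
    rw [hset]
    simp only [e]
    rw [← ofReal_integral_eq_lintegral_ofReal (integrableOn_exp_mul_Ioi (by linarith) _)
      (Eventually.of_forall fun q => (Real.exp_pos _).le),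
      integral_exp_mul_Ioi (by linarith), ← ENNReal.ofReal_coe_nnreal]
    apply ENNReal.ofReal_le_ofReal
    have : -S * (-Real.log k / S) = Real.log k := by field_simp
    rw [this, Real.exp_log hk0, neg_div_neg_eq]
    exact div_le_self hk0.le hS

/-- Integration in the projective coordinates `(x_j, (x_i / x_j)_{i ≠ j})`. -/
theorem lintegral_eq_lintegral_projective {n : ℕ} (j : Fin (n + 1))
    {F : (Fin (n + 1) → ℝ) → ENNReal} (hF : Measurable F) (hF0 : ∀ x, x j ≤ 0 → F x = 0) :
    ∫⁻ x, F x = ∫⁻ θ : Fin n → ℝ, ∫⁻ q in Set.Ioi (0 : ℝ),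
      ENNReal.ofReal (q ^ n) * F (j.insertNth q (q • θ)) := by
  have hins : Measurable fun p : ℝ × (Fin n → ℝ) =>
      (j.insertNth p.1 p.2 : Fin (n + 1) → ℝ) :=
    (MeasurableEquiv.piFinSuccAbove (fun _ : Fin (n + 1) => ℝ) j).symm.measurable
  rw [← (volume_preserving_piFinSuccAbove (fun _ : Fin (n + 1) => ℝ) j).symm.lintegral_comp hF,
    Measure.volume_eq_prod, lintegral_prod _ (by fun_prop)]
  have hscale : ∀ q : ℝ, 0 < q → ∫⁻ x : Fin n → ℝ, F (j.insertNth q x) =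
      ∫⁻ θ : Fin n → ℝ, ENNReal.ofReal (q ^ n) * F (j.insertNth q (q • θ)) := by
    intro q hq
    have hmap := Measure.map_addHaar_smul (volume : Measure (Fin n → ℝ)) hq.ne'
    have hm : Measurable fun x : Fin n → ℝ => F (j.insertNth q x) :=
      hF.comp (hins.comp (measurable_const.prodMk measurable_id))
    have h1 : ∫⁻ θ : Fin n → ℝ, F (j.insertNth q (q • θ)) =
        ENNReal.ofReal |(q ^ n)⁻¹| * ∫⁻ x : Fin n → ℝ, F (j.insertNth q x) := by
      rw [← lintegral_map hm (measurable_const_smul q), hmap, lintegral_smul_measure]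
      simp
    have hm' : Measurable fun θ : Fin n → ℝ => F (j.insertNth q (q • θ)) :=
      hm.comp (measurable_const_smul q)
    rw [lintegral_const_mul _ hm', h1, ← mul_assoc,
      ← ENNReal.ofReal_mul (by positivity), abs_of_pos (by positivity),
      mul_inv_cancel₀ (by positivity), ENNReal.ofReal_one, one_mul]
  have hjoint : Measurable fun p : (Fin n → ℝ) × ℝ =>
      (j.insertNth p.2 (p.2 • p.1) : Fin (n + 1) → ℝ) :=
    hins.comp (measurable_snd.prodMk (measurable_snd.smul measurable_fst))
  have hmeas : AEMeasurable (Function.uncurry fun (θ : Fin n → ℝ) (q : ℝ) =>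
      ENNReal.ofReal (q ^ n) * F (j.insertNth q (q • θ)))
      (volume.prod (volume.restrict (Set.Ioi 0))) :=
    ((by fun_prop : Measurable fun p : (Fin n → ℝ) × ℝ => ENNReal.ofReal (p.2 ^ n)).mul
      (hF.comp hjoint)).aemeasurable
  rw [lintegral_lintegral_swap hmeas, ← lintegral_indicator measurableSet_Ioi]
  refine lintegral_congr fun q => ?_
  by_cases hq : 0 < q
  · rw [Set.indicator_of_mem (show q ∈ Set.Ioi (0 : ℝ) from hq)]
    exact hscale q hq
  · rw [Set.indicator_of_notMem (show q ∉ Set.Ioi (0 : ℝ) from hq)]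
    refine (lintegral_congr fun x => ?_).trans lintegral_zero
    refine hF0 _ ?_
    change (j.insertNth q x : Fin (n + 1) → ℝ) j ≤ 0
    simpa using hq

theorem cellVol_mul_mul_ge (a : ℝ) {m p K τ ε : ℝ} (hm : 0 < m) (hε : 0 < ε) (hp : 0 < p)
    (hmp : m ≤ K * p) (hpm : p ≤ K * m) (hK : 1 ≤ K) :
    (m ^ 2) ^ (a + 1) * cellVol a τ ε ≤ (K ^ 2) ^ |a + 1 / 2| * cellVol a (p * τ) (m * ε) := by
  rw [← cellVol_mul_mul a τ ε hm]
  have hK2 : 1 ≤ K ^ 2 := one_le_pow₀ hK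
  have h1 : ((m * ε) ^ 2 + (m * τ) ^ 2) ^ (a + 1 / 2) ≤
      (K ^ 2) ^ |a + 1 / 2| * ((m * ε) ^ 2 + (p * τ) ^ 2) ^ (a + 1 / 2) := by
    have e1 : m ^ 2 ≤ K ^ 2 * p ^ 2 := by rw [← mul_pow]; gcongr
    have e2 : p ^ 2 ≤ K ^ 2 * m ^ 2 := by rw [← mul_pow]; gcongr
    have e3 : (m * ε) ^ 2 ≤ K ^ 2 * (m * ε) ^ 2 := le_mul_of_one_le_left (by positivity) hK2
    refine rpow_le_of_comparable (by positivity) (by positivity) ?_ ?_ _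
    · have := mul_le_mul_of_nonneg_right e1 (sq_nonneg τ)
      nlinarith
    · have := mul_le_mul_of_nonneg_right e2 (sq_nonneg τ)
      nlinarith
  unfold cellVol
  calc m * ε * ((m * ε) ^ 2 + (m * τ) ^ 2) ^ (a + 1 / 2)
      ≤ m * ε * ((K ^ 2) ^ |a + 1 / 2| * ((m * ε) ^ 2 + (p * τ) ^ 2) ^ (a + 1 / 2)) := by gcongr
    _ = _ := by ring

theorem le_prod_rpow_inv_card {n : ℕ} {w : Fin n → ℝ} {z : ℝ} (hz0 : 0 < z) (hz1 : z ≤ 1)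
    (hw : ∀ i, z ≤ w i) : z ≤ ∏ i, w i ^ (1 / ((n : ℝ) + 1)) := by
  have hn : (0 : ℝ) < (n : ℝ) + 1 := by positivity
  calc z = z ^ (1 : ℝ) := (Real.rpow_one z).symm
    _ ≤ z ^ ((n : ℝ) * (1 / ((n : ℝ) + 1))) := by
        refine Real.rpow_le_rpow_of_exponent_ge hz0 hz1 ?_
        rw [mul_one_div, div_le_one hn]; linarith
    _ = ∏ _i : Fin n, z ^ (1 / ((n : ℝ) + 1)) := by
        rw [Finset.prod_const, Finset.card_univ, Fintype.card_fin, mul_comm, Real.rpow_mul hz0.le,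
          Real.rpow_natCast]
    _ ≤ _ := Finset.prod_le_prod (fun i _ => by positivity) fun i _ =>
        Real.rpow_le_rpow hz0.le (hw i) (by positivity)

/-- The direction of `y`, in the projective chart at the coordinate `j`, truncated at `1`. -/
noncomputable def chartDirection {n : ℕ} (j : Fin (n + 1)) (y : Fin (n + 1) → ℝ) (i : Fin n) : ℝ :=
  min (√(y (j.succAbove i)) / √(y j)) 1

theorem rayGap_ge {n : ℕ} (j : Fin (n + 1)) {x y : Fin (n + 1) → ℝ} (hx : x ∈ posOrthant (n + 1))
    (hy : y ∈ posOrthant (n + 1)) (i : Fin n) (hij : x (j.succAbove i) ≤ x j) :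
    √(x j) / 2 * |√(x (j.succAbove i) / x j) - chartDirection j y i| ≤
      rayGap j (sqrtVec x) (sqrtVec y) := by
  set k := j.succAbove i
  have hp : 0 < √(x j) := Real.sqrt_pos.2 (hx j)
  have hv : 0 < √(y j) := Real.sqrt_pos.2 (hy j)
  set τ := √(x k / x j) with hτ
  set σ := √(y k) / √(y j) with hσ
  have hσ0 : 0 < σ := div_pos (Real.sqrt_pos.2 (hy k)) hv
  have hτ1 : τ ≤ 1 := by
    exact (Real.sqrt_le_sqrt ((div_le_one (hx j)).2 hij)).trans_eq Real.sqrt_one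
  have hτ0 : 0 ≤ τ := Real.sqrt_nonneg _
  have huk : √(x k) = √(x j) * τ := by
    rw [hτ, ← Real.sqrt_mul (hx j).le]; congr 1; field_simp [(hx j).ne']
  have hvk : √(y k) = √(y j) * σ := by rw [hσ]; field_simp
  have h := norm_le_pi_norm (fun i => (sqrtVec x i * sqrtVec y j - sqrtVec x j * sqrtVec y i) /
    (sqrtVec y i + sqrtVec y j)) k
  refine le_trans ?_ h
  simp only [sqrtVec]
  rw [huk, hvk, show (√(x j) * τ * √(y j) - √(x j) * (√(y j) * σ)) / (√(y j) * σ + √(y j)) =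
    √(x j) * ((τ - σ) / (1 + σ)) by field_simp; ring, Real.norm_eq_abs, abs_mul, abs_of_pos hp,
    div_mul_eq_mul_div, mul_div_assoc]
  gcongr
  rw [abs_div, abs_of_pos (by linarith : 0 < 1 + σ), chartDirection, ← hσ,
    div_le_div_iff₀ (by norm_num) (by linarith)]
  rcases le_total σ 1 with h1 | h1
  · rw [min_eq_left h1]
    exact mul_le_mul_of_nonneg_left (by linarith) (abs_nonneg _)
  · rw [min_eq_right h1, abs_of_nonpos (by linarith), abs_of_nonpos (by linarith)]
    nlinarith

theorem le_mul_cellVol_one (a : ℝ) {e : ℝ} (he0 : 0 < e) (he2 : e ≤ 2) :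
    e ≤ 5 ^ |a + 1 / 2| * cellVol a 1 e := by
  have h : (1 : ℝ) ^ (a + 1 / 2) ≤ 5 ^ |a + 1 / 2| * (e ^ 2 + 1 ^ 2) ^ (a + 1 / 2) :=
    rpow_le_of_comparable one_pos (by positivity) (by nlinarith [sq_nonneg e]) (by nlinarith) _
  rw [Real.one_rpow] at h
  calc e = e * 1 := (mul_one e).symm
    _ ≤ e * (5 ^ |a + 1 / 2| * (e ^ 2 + 1 ^ 2) ^ (a + 1 / 2)) := by gcongr
    _ = _ := by rw [cellVol]; ring

theorem rpow_mul_cellVol_le {a : ℝ} (ha : -1 < a) {c L p K S ω ε : ℝ} (hc : 0 < c) (hL : 0 < L)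
    (hε : 0 < ε) (hp : 0 < p) (hmp : c * √L ≤ K * p) (hpm : p ≤ K * (c * √L)) (hK : 1 ≤ K)
    (hS : c * √L * ε ≤ S) :
    L ^ (a + 1) * cellVol a ω ε ≤
      (c ^ 2) ^ (-(a + 1)) * (K ^ 2) ^ |a + 1 / 2| * cellVol a (p * ω) S := by
  have hl : 0 < √L := Real.sqrt_pos.2 hL
  have h1 := cellVol_mul_mul_ge a (τ := ω) (mul_pos hc hl) hε hp hmp hpm hK
  have h2 := cellVol_mono ha (p * ω) (by positivity) hS
  have hcancel : (c ^ 2) ^ (-(a + 1)) * (c ^ 2) ^ (a + 1) = 1 := by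
    rw [← Real.rpow_add (by positivity)]; simp
  have hm : ((c * √L) ^ 2) ^ (a + 1) = (c ^ 2) ^ (a + 1) * L ^ (a + 1) := by
    rw [mul_pow, Real.sq_sqrt hL.le, Real.mul_rpow (by positivity) hL.le]
  have h3 : (c ^ 2) ^ (a + 1) * L ^ (a + 1) * cellVol a ω ε ≤
      (K ^ 2) ^ |a + 1 / 2| * cellVol a (p * ω) S := by
    rw [← hm]
    exact h1.trans (mul_le_mul_of_nonneg_left h2 (by positivity))
  calc L ^ (a + 1) * cellVol a ω ε
      = (c ^ 2) ^ (-(a + 1)) * ((c ^ 2) ^ (a + 1) * L ^ (a + 1) * cellVol a ω ε) := by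
        linear_combination (-(L ^ (a + 1) * cellVol a ω ε)) * hcancel
    _ ≤ (c ^ 2) ^ (-(a + 1)) * ((K ^ 2) ^ |a + 1 / 2| * cellVol a (p * ω) S) :=
        mul_le_mul_of_nonneg_left h3 (by positivity)
    _ = _ := by ring

/-- Assembles the one-dimensional lower bounds for `cellVol` into a bound for `boxVol`. -/
theorem inv_boxVol_le_of_forall {n : ℕ} {α : Fin (n + 1) → ℝ} {j : Fin (n + 1)}
    {M : Fin (n + 1) → ℝ} {u : Fin (n + 1) → ℝ} {L S e Q A : ℝ} {V : Fin n → ℝ}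
    (hM : ∀ i, 0 < M i) (hL : 0 < L) (hS : 0 < S) (he : 0 < e) (hV : ∀ i, 0 < V i)
    (hA : 0 < A) (hQ : 0 < Q) (hQe : Q * (L * e) = 1)
    (hj : L ^ (α j + 1) * e ≤ M j * A * cellVol (α j) (u j) S)
    (hi : ∀ i : Fin n, L ^ (α (j.succAbove i) + 1) * V i ≤
      M (j.succAbove i) * cellVol (α (j.succAbove i)) (u (j.succAbove i)) S) :
    (boxVol α u S)⁻¹ ≤ (∏ i, M i) * A * (L ^ (1 - ∑ i, (α i + 1)) * (Q / ∏ i, V i)) := by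
  have hP0 : 0 < ∏ i, V i := Finset.prod_pos fun i _ => hV i
  have hbox0 := boxVol_pos α u hS
  have hprod : L ^ (∑ i, (α i + 1)) * e * (∏ i, V i) ≤ (∏ i, M i) * A * boxVol α u S := by
    have h1 := mul_le_mul hj (Finset.prod_le_prod (s := Finset.univ)
      (fun i _ => mul_nonneg (Real.rpow_nonneg hL.le _) (hV i).le) fun i _ => hi i)
      (Finset.prod_nonneg fun i _ => mul_nonneg (Real.rpow_nonneg hL.le _) (hV i).le)
      (mul_nonneg (mul_nonneg (hM j).le hA.le) (cellVol_pos (α j) (u j) hS).le)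
    rw [Finset.prod_mul_distrib, Finset.prod_mul_distrib] at h1
    rw [boxVol, Fin.prod_univ_succAbove (fun i => cellVol (α i) (u i) S) j,
      Fin.prod_univ_succAbove M j,
      Real.rpow_sum_of_pos hL (fun i => α i + 1),
      Fin.prod_univ_succAbove (fun i => L ^ (α i + 1)) j]
    calc _ = _ := by ring
      _ ≤ _ := h1
      _ = _ := by ring
  have hLD : L ^ (1 - ∑ i, (α i + 1)) * L ^ (∑ i, (α i + 1)) = L := by
    rw [← Real.rpow_add hL]; simp
  rw [inv_le_iff_one_le_mul₀ hbox0]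
  calc (1 : ℝ) = Q * ((L ^ (1 - ∑ i, (α i + 1)) * L ^ (∑ i, (α i + 1))) * e) := by
        rw [hLD, hQe]
    _ = L ^ (1 - ∑ i, (α i + 1)) * (Q / ∏ i, V i) *
        (L ^ (∑ i, (α i + 1)) * e * ∏ i, V i) := by field_simp
    _ ≤ L ^ (1 - ∑ i, (α i + 1)) * (Q / ∏ i, V i) * ((∏ i, M i) * A * boxVol α u S) :=
        mul_le_mul_of_nonneg_left hprod (mul_nonneg (Real.rpow_nonneg hL.le _)
          (div_nonneg hQ.le hP0.le))
    _ = _ := by ring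

/-- The key bound of the global kernel in the projective chart at a maximal coordinate. -/
theorem inv_boxVol_le_prod_angularProfile {n : ℕ} (α : Fin (n + 1) → ℝ) (hα : ∀ i, -1 < α i)
    (j : Fin (n + 1)) :
    ∃ C : ℝ, 0 < C ∧ ∀ (L : ℝ) (x y : Fin (n + 1) → ℝ), 1 ≤ L → x ∈ posOrthant (n + 1) →
      y ∈ posOrthant (n + 1) → (∀ i, x i ≤ x j) → L / (2 * ((n : ℝ) + 1)) ≤ x j → x j ≤ 2 * L →
      (boxVol α (sqrtVec x) (admissibleRadius (sqrtVec x) +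
          rayGap j (sqrtVec x) (sqrtVec y)))⁻¹ ≤
        C * (L ^ (1 - ∑ i, (α i + 1)) * ∏ i : Fin n, angularProfile (α (j.succAbove i))
          (1 / ((n : ℝ) + 1)) (1 / L) (chartDirection j y i) (x (j.succAbove i) / x j)) := by
  set c : ℝ := 1 / (6 * ((n : ℝ) + 1)) with hc
  have hn1 : (0 : ℝ) < (n : ℝ) + 1 := by positivity
  have hc0 : 0 < c := by positivity
  have hcn : c * ((n : ℝ) + 1) = 1 / 6 := by rw [hc]; field_simp
  have hc6 : c ≤ 1 / 6 := by nlinarith [n.cast_nonneg (α := ℝ)]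
  set K : ℝ := 2 / c with hK
  have hKc : K * c = 2 := by rw [hK]; field_simp
  have hK1 : 1 ≤ K := by nlinarith [show 0 < K by positivity]
  set M : Fin (n + 1) → ℝ := fun i => (c ^ 2) ^ (-(α i + 1)) * (K ^ 2) ^ |α i + 1 / 2| with hM
  have hM0 : ∀ i, 0 < M i := fun i => by simp only [hM]; positivity
  refine ⟨(∏ i, M i) * 5 ^ |α j + 1 / 2|, mul_pos (Finset.prod_pos fun i _ => hM0 i)
    (by positivity), fun L x y hL hx hy hmax hxL1 hxL2 => ?_⟩
  have hL0 : 0 < L := by linarith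
  set p := √(x j) with hp
  have hp0 : 0 < p := Real.sqrt_pos.2 (hx j)
  have hp2 : p ^ 2 = x j := Real.sq_sqrt (hx j).le
  set l := √L with hl
  have hl0 : 0 < l := Real.sqrt_pos.2 hL0
  have hl2 : l ^ 2 = L := Real.sq_sqrt hL0.le
  have hl1 : 1 ≤ l := by rw [hl, Real.one_le_sqrt]; exact hL
  set m := c * l with hm
  have hm0 : 0 < m := by positivity
  have hp_le : p ≤ 2 * l := by nlinarith
  have hp_ge : l ≤ p * (2 * ((n : ℝ) + 1)) := by
    rw [div_le_iff₀ (by positivity), ← hp2, ← hl2] at hxL1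
    have h2 : (1 : ℝ) ≤ 2 * ((n : ℝ) + 1) := by linarith [n.cast_nonneg (α := ℝ)]
    have h3 : l ^ 2 ≤ (p * (2 * ((n : ℝ) + 1))) ^ 2 := by
      rw [mul_pow]
      refine hxL1.trans (mul_le_mul_of_nonneg_left ?_ (sq_nonneg p))
      nlinarith
    exact (pow_le_pow_iff_left₀ hl0.le (by positivity) two_ne_zero).1 h3
  have hmp : m ≤ K * p := by
    have h1 : m ≤ p := by
      rw [hm]
      nlinarith
    exact h1.trans (le_mul_of_one_le_left hp0.le hK1)
  have hpm : p ≤ K * m := by rw [hm, ← mul_assoc, hKc]; exact hp_le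
  set η := 1 / L with hη
  have hη0 : 0 < η := by positivity
  have hη1 : η ≤ 1 := by rw [hη, div_le_one hL0]; exact hL
  have hlη : l * η * l = 1 := by rw [hη, ← hl2]; field_simp
  set σ := chartDirection j y with hσ
  set τ : Fin n → ℝ := fun i => √(x (j.succAbove i) / x j) with hτ
  set ε : Fin n → ℝ := fun i => η + |τ i - σ i| with hε
  have hε0 : ∀ i, 0 < ε i := fun i => by simp only [hε]; positivity
  set S := admissibleRadius (sqrtVec x) + rayGap j (sqrtVec x) (sqrtVec y) with hS
  have hnorm : ‖sqrtVec x‖ ≤ p := (pi_norm_le_iff_of_nonneg hp0.le).2 fun i => by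
    rw [sqrtVec, Real.norm_of_nonneg (Real.sqrt_nonneg _)]
    exact Real.sqrt_le_sqrt (hmax i)
  have hadm : l * η / 6 ≤ admissibleRadius (sqrtVec x) := by
    rw [admissibleRadius, div_le_div_iff₀ (by norm_num) (by positivity)]
    have : 2 * (1 + ‖sqrtVec x‖) ≤ 6 * l := by linarith
    calc l * η * (2 * (1 + ‖sqrtVec x‖)) ≤ l * η * (6 * l) := by gcongr
      _ = 1 * 6 := by linear_combination 6 * hlη
  have hSη : m * η ≤ S := by
    have h1 : m * η ≤ l * η / 6 := by
      rw [hm]; nlinarith [mul_pos hl0 hη0]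
    linarith [rayGap_nonneg j (sqrtVec x) (sqrtVec y)]
  have hSε : ∀ i, m * ε i ≤ S := fun i => by
    have h1 := rayGap_ge j hx hy i (hmax _)
    have h2 : m * |τ i - σ i| ≤ p / 2 * |τ i - σ i| := by
      refine mul_le_mul_of_nonneg_right ?_ (abs_nonneg _)
      rw [hm]
      nlinarith
    have h3 : m * η ≤ l * η / 6 := by
      rw [hm]; nlinarith [mul_pos hl0 hη0]
    simp only [hε, mul_add]
    linarith
  have hS0 : 0 < S := (mul_pos hm0 hη0).trans_le hSη
  have hτ01 : ∀ i, 0 ≤ τ i ∧ τ i ≤ 1 := fun i => ⟨Real.sqrt_nonneg _, by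
    exact (Real.sqrt_le_sqrt ((div_le_one (hx j)).2 (hmax _))).trans_eq Real.sqrt_one⟩
  have hσ01 : ∀ i, 0 ≤ σ i ∧ σ i ≤ 1 := fun i =>
    ⟨le_min (by positivity) zero_le_one, min_le_right _ _⟩
  have hε2 : ∀ i, ε i ≤ 2 := fun i => by
    have : |τ i - σ i| ≤ 1 := abs_le.2 ⟨by linarith [(hτ01 i).1, (hσ01 i).2],
      by linarith [(hτ01 i).2, (hσ01 i).1]⟩
    simp only [hε]; linarith
  set Q := ∏ i, (η / ε i) ^ (1 / ((n : ℝ) + 1)) with hQ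
  have hQ0 : 0 < Q := Finset.prod_pos fun i _ => by have := hε0 i; positivity
  set e := η / Q with he
  have he0 : 0 < e := by positivity
  have heS : m * e ≤ S := by
    have h1 : η * m / S ≤ Q := by
      refine le_prod_rpow_inv_card (by positivity) ?_ fun i => ?_
      · rw [div_le_one hS0]; linarith
      · rw [div_le_div_iff₀ hS0 (hε0 i)]
        have := mul_le_mul_of_nonneg_left (hSε i) hη0.le
        linarith
    rw [div_le_iff₀ hS0] at h1
    rw [he, ← mul_div_assoc, div_le_iff₀ hQ0]
    linarith
  have he2 : e ≤ 2 := by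
    have h1 : η / 2 ≤ Q := by
      refine le_prod_rpow_inv_card (by positivity) (by linarith) fun i => ?_
      exact div_le_div_of_nonneg_left hη0.le (hε0 i) (hε2 i)
    rw [he, div_le_iff₀ hQ0]; linarith
  have hj : L ^ (α j + 1) * e ≤ M j * 5 ^ |α j + 1 / 2| * cellVol (α j) p S := by
    have h1 := rpow_mul_cellVol_le (hα j) (ω := 1) hc0 hL0 he0 hp0 hmp hpm hK1 heS
    rw [mul_one] at h1
    have h2 := le_mul_cellVol_one (α j) he0 he2
    have h3 : 0 < L ^ (α j + 1) := Real.rpow_pos_of_pos hL0 _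
    have h4 : 0 < (5 : ℝ) ^ |α j + 1 / 2| := Real.rpow_pos_of_pos (by norm_num) _
    calc L ^ (α j + 1) * e ≤ L ^ (α j + 1) * (5 ^ |α j + 1 / 2| * cellVol (α j) 1 e) :=
          mul_le_mul_of_nonneg_left h2 h3.le
      _ = 5 ^ |α j + 1 / 2| * (L ^ (α j + 1) * cellVol (α j) 1 e) := by ring
      _ ≤ 5 ^ |α j + 1 / 2| * (M j * cellVol (α j) p S) := mul_le_mul_of_nonneg_left h1 h4.le
      _ = _ := by ring
  have hi : ∀ i : Fin n, L ^ (α (j.succAbove i) + 1) * cellVol (α (j.succAbove i)) (τ i) (ε i) ≤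
      M (j.succAbove i) * cellVol (α (j.succAbove i)) (√(x (j.succAbove i))) S := by
    intro i
    have h1 := rpow_mul_cellVol_le (hα (j.succAbove i)) (ω := τ i) hc0 hL0 (hε0 i) hp0 hmp hpm
      hK1 (hSε i)
    have h2 : p * τ i = √(x (j.succAbove i)) := by
      have h3 : x j ≠ 0 := (hx j).ne'
      simp only [hτ]
      rw [hp, ← Real.sqrt_mul (hx j).le, mul_div_cancel₀ _ h3]
    rwa [h2] at h1
  have hprof : ∏ i : Fin n, angularProfile (α (j.succAbove i)) (1 / ((n : ℝ) + 1)) η (σ i)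
      (x (j.succAbove i) / x j) = Q / ∏ i, cellVol (α (j.succAbove i)) (τ i) (ε i) := by
    rw [hQ, ← Finset.prod_div_distrib]; rfl
  rw [hprof]
  refine inv_boxVol_le_of_forall hM0 hL0 hS0 he0 (fun i => cellVol_pos _ _ (hε0 i))
    (by positivity) hQ0 ?_ hj hi
  rw [he, hη]; field_simp

/-- Uniform control of the inverse volume of balls of at least the admissible radius. -/
theorem exists_inv_boxVol_le_exp {d : ℕ} {α : Fin d → ℝ} (hα : ∀ i, -1 < α i) :
    ∃ C : ℝ, 0 < C ∧ ∀ x ∈ posOrthant d, ∀ s : ℝ, admissibleRadius (sqrtVec x) ≤ s →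
      (boxVol α (sqrtVec x) s)⁻¹ ≤ C * Real.exp (1 / 2 * ∑ i, x i) := by
  set β : ℝ := ∑ i : Fin d, (1 + 2 * |α i + 1 / 2|) with hβ
  have hβ0 : 0 ≤ β := Finset.sum_nonneg fun i _ => by positivity
  obtain ⟨C, hC, hexp⟩ := exists_one_add_rpow_le_exp β (c := 1 / 2) (by norm_num)
  refine ⟨4 ^ β * C, by positivity, fun x hx s hs => ?_⟩
  set u := sqrtVec x with hu
  set r := admissibleRadius u with hr
  have hr0 : 0 < r := admissibleRadius_pos u
  set B : ℝ := 2 * (1 + ‖u‖) with hB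
  have hB0 : 0 < B := by positivity
  have hrB : r = B⁻¹ := by rw [hr, admissibleRadius, one_div]
  have hcell : ∀ i, 1 ≤ B ^ (1 + 2 * |α i + 1 / 2|) * cellVol (α i) (u i) r := by
    intro i
    have hui : |u i| ≤ ‖u‖ := norm_le_pi_norm u i
    have hui2 : u i ^ 2 ≤ ‖u‖ ^ 2 := sq_le_sq' (abs_le.1 hui).1 (abs_le.1 hui).2
    have hBr : B ^ 2 * r ^ 2 = 1 := by rw [hrB]; field_simp
    have hr1 : r ≤ 1 := by
      rw [hrB]; exact inv_le_one_of_one_le₀ (by rw [hB]; linarith [norm_nonneg u])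
    have h1 : (1 : ℝ) ^ (α i + 1 / 2) ≤
        (B ^ 2) ^ |α i + 1 / 2| * (r ^ 2 + u i ^ 2) ^ (α i + 1 / 2) := by
      refine rpow_le_of_comparable one_pos (by positivity) ?_ ?_ _
      · nlinarith [mul_nonneg (sq_nonneg B) (sq_nonneg (u i))]
      · rw [hB]; nlinarith [norm_nonneg u]
    rw [Real.one_rpow] at h1
    have h2 : B ^ (1 + 2 * |α i + 1 / 2|) = B * (B ^ 2) ^ |α i + 1 / 2| := by
      rw [Real.rpow_add hB0, Real.rpow_one, Real.rpow_mul hB0.le]; norm_cast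
    have h3 : B * r = 1 := by rw [hrB]; field_simp
    calc (1 : ℝ) = (B * r) * 1 := by rw [h3, one_mul]
      _ ≤ (B * r) * ((B ^ 2) ^ |α i + 1 / 2| * (r ^ 2 + u i ^ 2) ^ (α i + 1 / 2)) :=
        mul_le_mul_of_nonneg_left h1 (by rw [h3]; norm_num)
      _ = _ := by rw [h2, cellVol]; ring
  have hbox : 1 ≤ B ^ β * boxVol α u r := by
    calc (1 : ℝ) = ∏ _i : Fin d, (1 : ℝ) := by simp
      _ ≤ ∏ i, (B ^ (1 + 2 * |α i + 1 / 2|) * cellVol (α i) (u i) r) :=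
        Finset.prod_le_prod (fun _ _ => zero_le_one) fun i _ => hcell i
      _ = _ := by rw [Finset.prod_mul_distrib, ← Real.rpow_sum_of_pos hB0, boxVol]
  have hT0 : 0 ≤ ∑ i, x i := Finset.sum_nonneg fun i _ => (hx i).le
  have hu1 : ‖u‖ ≤ 1 + ∑ i, x i := by
    refine (pi_norm_le_iff_of_nonneg (by linarith)).2 fun i => ?_
    have h1 : x i ≤ ∑ i, x i := Finset.single_le_sum (fun i _ => (hx i).le) (Finset.mem_univ i)
    have h2 : √(x i) ^ 2 = x i := Real.sq_sqrt (hx i).le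
    rw [hu, sqrtVec, Real.norm_of_nonneg (Real.sqrt_nonneg _)]
    nlinarith [sq_nonneg (√(x i) - 1)]
  calc (boxVol α u s)⁻¹ ≤ (boxVol α u r)⁻¹ :=
        inv_anti₀ (boxVol_pos α u hr0) (boxVol_mono hα u hr0 hs)
    _ ≤ B ^ β := by rw [inv_le_iff_one_le_mul₀ (boxVol_pos α u hr0)]; exact hbox
    _ ≤ (4 * (1 + ∑ i, x i)) ^ β := by
        refine Real.rpow_le_rpow hB0.le ?_ hβ0
        rw [hB]; linarith
    _ = 4 ^ β * (1 + ∑ i, x i) ^ β := Real.mul_rpow (by norm_num) (by linarith)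
    _ ≤ 4 ^ β * (C * Real.exp (1 / 2 * ∑ i, x i)) := by gcongr; exact hexp _ hT0
    _ = _ := by ring

theorem lintegral_exp_half_lt_top {d : ℕ} {α : Fin d → ℝ} (hα : ∀ i, -1 < α i) :
    ∃ C : ℝ, 0 < C ∧ ∫⁻ x, ENNReal.ofReal (Real.exp (1 / 2 * ∑ i, x i)) ∂(laguerreMeasure α) ≤
      ENNReal.ofReal C := by
  have hone : ∀ i, ∫⁻ z in Set.Ioi (0 : ℝ), ENNReal.ofReal (z ^ α i * Real.exp (-(1 / 2 * z))) =
      ENNReal.ofReal ((1 / (1 / 2 : ℝ)) ^ (α i + 1) * Real.Gamma (α i + 1)) := by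
    intro i
    have h := Real.integral_rpow_mul_exp_neg_mul_Ioi (a := α i + 1) (r := 1 / 2)
      (by linarith [hα i]) (by norm_num)
    rw [add_sub_cancel_right] at h
    have hint : IntegrableOn (fun z : ℝ => z ^ α i * Real.exp (-(1 / 2 * z))) (Set.Ioi 0) := by
      have := integrableOn_rpow_mul_exp_neg_mul_rpow (p := 1) (b := 1 / 2) (hα i) one_pos
        (by norm_num)
      simpa using this
    rw [← h, ofReal_integral_eq_lintegral_ofReal hint]
    filter_upwards [ae_restrict_mem measurableSet_Ioi] with z hz
    have hz : (0 : ℝ) < z := hz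
    positivity
  have hG : ∀ i, 0 < (1 / (1 / 2 : ℝ)) ^ (α i + 1) * Real.Gamma (α i + 1) := fun i =>
    mul_pos (by positivity) (Real.Gamma_pos_of_pos (by linarith [hα i]))
  refine ⟨∏ i, ((1 / (1 / 2 : ℝ)) ^ (α i + 1) * Real.Gamma (α i + 1)),
    Finset.prod_pos fun i _ => hG i, ?_⟩
  rw [ENNReal.ofReal_prod_of_nonneg fun i _ => (hG i).le]
  simp only [← hone, ← lintegral_indicator (measurableSet_Ioi (a := (0 : ℝ)))]
  rw [← lintegral_fin_prod_eq_prod fun i => Measurable.indicator (by fun_prop) measurableSet_Ioi,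
    laguerreMeasure, lintegral_withDensity_eq_lintegral_mul _ (by fun_prop) (by fun_prop),
    ← lintegral_indicator (measurableSet_posOrthant d)]
  refine lintegral_mono fun x => ?_
  by_cases hx : x ∈ posOrthant d
  · rw [Set.indicator_of_mem hx]
    have : ∀ i, (Set.Ioi (0 : ℝ)).indicator
        (fun z => ENNReal.ofReal (z ^ α i * Real.exp (-(1 / 2 * z)))) (x i) =
        ENNReal.ofReal (x i ^ α i * Real.exp (-(1 / 2 * x i))) := fun i =>
      Set.indicator_of_mem (s := Set.Ioi (0 : ℝ)) (hx i) _
    simp only [this, Pi.mul_apply]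
    have hp : ∀ i, 0 ≤ x i ^ α i := fun i => Real.rpow_nonneg (hx i).le _
    rw [← ENNReal.ofReal_prod_of_nonneg fun i _ => mul_nonneg (hp i) (Real.exp_pos _).le,
      ← ENNReal.ofReal_mul (mul_nonneg (Finset.prod_nonneg fun i _ => hp i) (Real.exp_pos _).le),
      Finset.prod_mul_distrib, mul_assoc, ← Real.exp_add, ← Real.exp_sum]
    apply le_of_eq
    congr 3
    rw [Finset.sum_neg_distrib, ← Finset.mul_sum]; ring
  · rw [Set.indicator_of_notMem hx]; exact zero_le

theorem laguerreMeasure_exp_ge_le {d : ℕ} {α : Fin d → ℝ} (hα : ∀ i, -1 < α i) :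
    ∃ C : ℝ, 0 < C ∧ ∀ L : ℝ, laguerreMeasure α {x | 2 * L ≤ ∑ i, x i} ≤
      ENNReal.ofReal (C * Real.exp (-L)) := by
  obtain ⟨C, hC, h⟩ := lintegral_exp_half_lt_top hα
  refine ⟨C, hC, fun L => ?_⟩
  have hm := mul_meas_ge_le_lintegral (μ := laguerreMeasure α)
    (f := fun x : Fin d → ℝ => ENNReal.ofReal (Real.exp (1 / 2 * ∑ i, x i))) (by fun_prop)
    (ENNReal.ofReal (Real.exp L))
  have hsub : {x : Fin d → ℝ | 2 * L ≤ ∑ i, x i} ⊆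
      {x | ENNReal.ofReal (Real.exp L) ≤ ENNReal.ofReal (Real.exp (1 / 2 * ∑ i, x i))} := by
    intro x hx
    have hx : 2 * L ≤ ∑ i, x i := hx
    exact ENNReal.ofReal_le_ofReal (Real.exp_le_exp.2 (by linarith))
  have h1 : ENNReal.ofReal (Real.exp L) * laguerreMeasure α {x | 2 * L ≤ ∑ i, x i} ≤
      ENNReal.ofReal C := (mul_le_mul_right (measure_mono hsub) _).trans (hm.trans h)
  calc laguerreMeasure α {x | 2 * L ≤ ∑ i, x i}
      = ENNReal.ofReal (Real.exp (-L)) * (ENNReal.ofReal (Real.exp L) *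
          laguerreMeasure α {x | 2 * L ≤ ∑ i, x i}) := by
        rw [← mul_assoc, ← ENNReal.ofReal_mul (Real.exp_pos _).le, ← Real.exp_add]; simp
    _ ≤ ENNReal.ofReal (Real.exp (-L)) * ENNReal.ofReal C := by gcongr
    _ = _ := by rw [← ENNReal.ofReal_mul (Real.exp_pos _).le, mul_comm]

theorem ae_mem_posOrthant {d : ℕ} (α : Fin d → ℝ) :
    ∀ᵐ x ∂(laguerreMeasure α), x ∈ posOrthant d :=
  (withDensity_absolutelyContinuous _ _).ae_le (ae_restrict_mem (measurableSet_posOrthant d))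

theorem laguerreMeasure_univ_le {d : ℕ} {α : Fin d → ℝ} (hα : ∀ i, -1 < α i) :
    ∃ C : ℝ, 0 < C ∧ laguerreMeasure α Set.univ ≤ ENNReal.ofReal C := by
  obtain ⟨C, hC, h⟩ := lintegral_exp_half_lt_top hα
  refine ⟨C, hC, le_trans ?_ h⟩
  rw [← lintegral_one]
  refine lintegral_mono_ae ?_
  filter_upwards [ae_mem_posOrthant α] with x hx
  rw [ENNReal.one_le_ofReal]
  have : 0 ≤ ∑ i, x i := Finset.sum_nonneg fun i _ => (hx i).le
  exact Real.one_le_exp (by linarith)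

instance instSFiniteLaguerreMeasure {d : ℕ} (α : Fin d → ℝ) : SFinite (laguerreMeasure α) := by
  unfold laguerreMeasure; infer_instance

theorem measurable_prod_angularProfile {n : ℕ} (α : Fin (n + 1) → ℝ) (j : Fin (n + 1)) (κ η : ℝ) :
    Measurable fun p : (Fin n → ℝ) × (Fin (n + 1) → ℝ) =>
      ∏ i : Fin n, angularProfile (α (j.succAbove i)) κ η (chartDirection j p.2 i) (p.1 i) := by
  unfold angularProfile chartDirection cellVol
  fun_prop

theorem lintegral_mul_lintegral_kernel {X Y : Type*} [MeasurableSpace X] [MeasurableSpace Y]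
    {ν : Measure X} {μ : Measure Y} [SFinite ν] [SFinite μ] {w : X → ENNReal} {P : X → Y → ENNReal}
    {g : Y → ENNReal} (hw : Measurable w) (hP : Measurable fun p : X × Y => P p.1 p.2)
    (hg : Measurable g) :
    ∫⁻ θ, w θ * ∫⁻ y, P θ y * g y ∂μ ∂ν = ∫⁻ y, (∫⁻ θ, w θ * P θ y ∂ν) * g y ∂μ := by
  have hPy : ∀ θ, Measurable fun y => P θ y := fun θ =>
    hP.comp (measurable_const.prodMk measurable_id)
  have hPx : ∀ y, Measurable fun θ => P θ y := fun y =>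
    hP.comp (measurable_id.prodMk measurable_const)
  calc ∫⁻ θ, w θ * ∫⁻ y, P θ y * g y ∂μ ∂ν
      = ∫⁻ θ, ∫⁻ y, w θ * (P θ y * g y) ∂μ ∂ν := by
        refine lintegral_congr fun θ => ?_
        exact (lintegral_const_mul (w θ) (f := fun y => P θ y * g y) ((hPy θ).mul hg)).symm
    _ = ∫⁻ y, ∫⁻ θ, w θ * (P θ y * g y) ∂ν ∂μ := by
        refine lintegral_lintegral_swap (Measurable.aemeasurable ?_)
        exact (hw.comp measurable_fst).mul (hP.mul (hg.comp measurable_snd))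
    _ = _ := by
        refine lintegral_congr fun y => ?_
        rw [← lintegral_mul_const (g y) (f := fun θ => w θ * P θ y) (hw.mul (hPx y))]
        exact lintegral_congr fun θ => (mul_assoc _ _ _).symm

theorem lintegral_posOrthant_prod_angularProfile_le {n : ℕ} {a : Fin n → ℝ} (ha : ∀ i, -1 < a i)
    {κ : ℝ} (hκ : 0 < κ) :
    ∃ C : ℝ, 0 < C ∧ ∀ (η : ℝ) (σ : Fin n → ℝ), 0 < η → (∀ i, 0 ≤ σ i) →
      ∫⁻ θ in posOrthant n, ENNReal.ofReal (∏ i, θ i ^ a i) *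
        ENNReal.ofReal (∏ i, angularProfile (a i) κ η (σ i) (θ i)) ≤ ENNReal.ofReal C := by
  choose c hc hle using fun i : Fin n => lintegral_angularProfile_le (ha i) hκ
  refine ⟨∏ i, c i, Finset.prod_pos fun i _ => hc i, fun η σ hη hσ => ?_⟩
  obtain ⟨f, hf⟩ : ∃ f : Fin n → ℝ → ENNReal, f = fun i => (Set.Ioi (0 : ℝ)).indicator fun θ =>
    ENNReal.ofReal (θ ^ a i) * ENNReal.ofReal (angularProfile (a i) κ η (σ i) θ) := ⟨_, rfl⟩
  have hfm : ∀ i, Measurable (f i) := fun i => by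
    rw [hf]
    refine Measurable.indicator ?_ measurableSet_Ioi
    unfold angularProfile cellVol
    fun_prop
  have hpt : ∀ θ ∈ posOrthant n, ENNReal.ofReal (∏ i, θ i ^ a i) *
      ENNReal.ofReal (∏ i, angularProfile (a i) κ η (σ i) (θ i)) ≤ ∏ i, f i (θ i) := by
    intro θ hθ
    have : ∀ i, f i (θ i) = ENNReal.ofReal (θ i ^ a i) * ENNReal.ofReal
      (angularProfile (a i) κ η (σ i) (θ i)) := fun i => by
        rw [hf]; exact Set.indicator_of_mem (s := Set.Ioi (0 : ℝ)) (hθ i) _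
    simp only [this]
    rw [Finset.prod_mul_distrib, ENNReal.ofReal_prod_of_nonneg fun i _ =>
      Real.rpow_nonneg (hθ i).le _, ENNReal.ofReal_prod_of_nonneg fun i _ =>
      angularProfile_nonneg _ _ _ _ hη]
  refine (setLIntegral_mono' (measurableSet_posOrthant n) hpt).trans ?_
  refine (setLIntegral_le_lintegral _ _).trans ?_
  rw [lintegral_fin_prod_eq_prod hfm, ENNReal.ofReal_prod_of_nonneg fun i _ => (hc i).le]
  gcongr with i
  rw [hf, lintegral_indicator measurableSet_Ioi]
  exact hle i η _ hη (hσ i)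

/-- Integration against the angular kernel in the projective chart at the coordinate `j`. -/
noncomputable def angularTransform {n : ℕ} (α : Fin (n + 1) → ℝ) (j : Fin (n + 1)) (κ η : ℝ)
    (g : (Fin (n + 1) → ℝ) → ENNReal) (θ : Fin n → ℝ) : ENNReal :=
  ∫⁻ y, ENNReal.ofReal (∏ i : Fin n, angularProfile (α (j.succAbove i)) κ η
    (chartDirection j y i) (θ i)) * g y ∂(laguerreMeasure α)

theorem measurable_angularTransform {n : ℕ} (α : Fin (n + 1) → ℝ) (j : Fin (n + 1)) (κ η : ℝ)
    {g : (Fin (n + 1) → ℝ) → ENNReal} (hg : Measurable g) :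
    Measurable (angularTransform α j κ η g) := by
  have h := (measurable_prod_angularProfile α j κ η).ennreal_ofReal.mul (hg.comp measurable_snd)
  exact Measurable.lintegral_prod_right' (ν := laguerreMeasure α) h

/-- Uniform integrability of the angular kernel. -/
theorem lintegral_angularTransform_le {n : ℕ} {α : Fin (n + 1) → ℝ} (hα : ∀ i, -1 < α i)
    (j : Fin (n + 1)) {κ : ℝ} (hκ : 0 < κ) :
    ∃ C : ℝ, 0 < C ∧ ∀ (η : ℝ) (g : (Fin (n + 1) → ℝ) → ENNReal), 0 < η → Measurable g →
      ∫⁻ θ in posOrthant n, ENNReal.ofReal (∏ i, θ i ^ α (j.succAbove i)) *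
        angularTransform α j κ η g θ ≤
      ENNReal.ofReal C * ∫⁻ y, g y ∂(laguerreMeasure α) := by
  obtain ⟨C, hC, hle⟩ := lintegral_posOrthant_prod_angularProfile_le
    (fun i => hα (j.succAbove i)) hκ
  refine ⟨C, hC, fun η g hη hg => ?_⟩
  have hw : Measurable fun θ : Fin n → ℝ => ENNReal.ofReal (∏ i, θ i ^ α (j.succAbove i)) := by
    fun_prop
  have hP := (measurable_prod_angularProfile α j κ η).ennreal_ofReal
  have hswap := lintegral_mul_lintegral_kernel (ν := volume.restrict (posOrthant n))
    (μ := laguerreMeasure α) hw (P := fun θ y => ENNReal.ofReal (∏ i : Fin n,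
      angularProfile (α (j.succAbove i)) κ η (chartDirection j y i) (θ i))) hP hg
  unfold angularTransform
  rw [hswap, ← lintegral_const_mul _ hg]
  refine lintegral_mono fun y => ?_
  gcongr
  exact hle η _ hη fun i => le_min (by positivity) zero_le_one

theorem lintegral_inv_boxVol_le_angularTransform {n : ℕ} {α : Fin (n + 1) → ℝ}
    (hα : ∀ i, -1 < α i) (j : Fin (n + 1)) :
    ∃ C : ℝ, 0 < C ∧ ∀ (g : (Fin (n + 1) → ℝ) → ENNReal) (L : ℝ) (x : Fin (n + 1) → ℝ), 1 ≤ L →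
      x ∈ posOrthant (n + 1) → (∀ i, x i ≤ x j) → L / (2 * ((n : ℝ) + 1)) ≤ x j → x j ≤ 2 * L →
      ∫⁻ y, ENNReal.ofReal ((boxVol α (sqrtVec x) (admissibleRadius (sqrtVec x) +
            rayGap j (sqrtVec x) (sqrtVec y)))⁻¹) * g y ∂(laguerreMeasure α) ≤
        ENNReal.ofReal (C * L ^ (1 - ∑ i, (α i + 1))) *
          angularTransform α j (1 / ((n : ℝ) + 1)) (1 / L) g
            (fun i => x (j.succAbove i) / x j) := by
  obtain ⟨C, hC, hker⟩ := inv_boxVol_le_prod_angularProfile α hα j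
  refine ⟨C, hC, fun g L x hL hx hmax h1 h2 => ?_⟩
  have hL0 : 0 < L := by linarith
  rw [angularTransform, ← lintegral_const_mul' _ _ ENNReal.ofReal_ne_top]
  refine lintegral_mono_ae ?_
  filter_upwards [ae_mem_posOrthant α] with y hy
  rw [← mul_assoc, ← ENNReal.ofReal_mul (by positivity), mul_assoc C]
  exact mul_le_mul_left (ENNReal.ofReal_le_ofReal (hker L x y hL hx hy hmax h1 h2)) _

theorem density_insertNth {n : ℕ} (α : Fin (n + 1) → ℝ) (j : Fin (n + 1)) {q : ℝ} (hq : 0 < q)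
    {θ : Fin n → ℝ} (hθ : θ ∈ posOrthant n) :
    q ^ n * ((∏ i, (j.insertNth q (q • θ) : Fin (n + 1) → ℝ) i ^ α i) *
        Real.exp (-∑ i, (j.insertNth q (q • θ) : Fin (n + 1) → ℝ) i)) =
      (∏ i, θ i ^ α (j.succAbove i)) * q ^ (∑ i, (α i + 1) - 1) *
        Real.exp (-(q * (1 + ∑ i, θ i))) := by
  rw [Fin.prod_univ_succAbove _ j, Fin.sum_univ_succAbove _ j]
  simp only [Fin.insertNth_apply_same, Fin.insertNth_apply_succAbove, Pi.smul_apply, smul_eq_mul]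
  have h1 : ∀ i, (q * θ i) ^ α (j.succAbove i) =
      q ^ α (j.succAbove i) * θ i ^ α (j.succAbove i) := fun i =>
    Real.mul_rpow hq.le (hθ i).le
  simp only [h1]
  rw [Finset.prod_mul_distrib, ← Real.rpow_sum_of_pos hq, ← Finset.mul_sum, ← Real.rpow_natCast]
  have h2 : q ^ (∑ i, (α i + 1) - 1) =
      q ^ (n : ℝ) * q ^ α j * q ^ (∑ i, α (j.succAbove i)) := by
    rw [← Real.rpow_add hq, ← Real.rpow_add hq]
    congr 1
    rw [Fin.sum_univ_succAbove _ j, Finset.sum_add_distrib]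
    simp
    ring
  rw [h2, mul_add, mul_one]
  ring

/-- Weak type estimate for the global part of the maximal operator, in an annulus. -/
theorem laguerreMeasure_annulus_le {n : ℕ} {α : Fin (n + 1) → ℝ} (hα : ∀ i, -1 < α i)
    (j : Fin (n + 1)) :
    ∃ C : ℝ, 0 < C ∧ ∀ (g : (Fin (n + 1) → ℝ) → ENNReal) (L l : ℝ), Measurable g → 1 ≤ L → 0 < l →
      laguerreMeasure α {x ∈ posOrthant (n + 1) | (∀ i, x i ≤ x j) ∧
        L / (2 * ((n : ℝ) + 1)) ≤ x j ∧ x j ≤ 2 * L ∧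
        ENNReal.ofReal l < ENNReal.ofReal (Real.exp (∑ i, x i)) *
          ∫⁻ y, ENNReal.ofReal ((boxVol α (sqrtVec x) (admissibleRadius (sqrtVec x) +
            rayGap j (sqrtVec x) (sqrtVec y)))⁻¹) * g y ∂(laguerreMeasure α)} ≤
      ENNReal.ofReal (C / l) * ∫⁻ y, g y ∂(laguerreMeasure α) := by
  have hn1 : (0 : ℝ) < (n : ℝ) + 1 := by positivity
  obtain ⟨C₀, hC₀, hker⟩ := lintegral_inv_boxVol_le_angularTransform hα j
  obtain ⟨C₁, hC₁, hang⟩ := lintegral_angularTransform_le hα j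
    (κ := 1 / ((n : ℝ) + 1)) (by positivity)
  set D : ℝ := ∑ i, (α i + 1) with hD
  set K : ℝ := (2 * ((n : ℝ) + 1)) ^ |D - 1| with hK
  have hK0 : 0 < K := by positivity
  refine ⟨K * C₀ * C₁, by positivity, fun g L l hg hL hl => ?_⟩
  have hL0 : 0 < L := by linarith
  set μ := laguerreMeasure α with hμ
  obtain ⟨W, hW⟩ : ∃ W, W = angularTransform α j (1 / ((n : ℝ) + 1)) (1 / L) g := ⟨_, rfl⟩
  have hWm : Measurable W := hW ▸ measurable_angularTransform α j _ _ hg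
  set κ : (Fin n → ℝ) → ENNReal := fun θ => ENNReal.ofReal (C₀ * L ^ (1 - D) / l) * W θ with hκ
  have hκm : Measurable κ := hWm.const_mul _
  set E : Set (Fin (n + 1) → ℝ) := {x | x ∈ posOrthant (n + 1) ∧
    (L / (2 * ((n : ℝ) + 1)) ≤ x j ∧ x j ≤ 2 * L) ∧
    1 < ENNReal.ofReal (Real.exp (∑ i, x i)) * κ (fun i => x (j.succAbove i) / x j)} with hE
  have hEm : MeasurableSet E := by
    refine (measurableSet_posOrthant _).inter (MeasurableSet.inter ?_ ?_)
    · exact (measurableSet_le measurable_const (measurable_pi_apply j)).inter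
        (measurableSet_le (measurable_pi_apply j) measurable_const)
    · refine measurableSet_lt measurable_const (Measurable.mul (by fun_prop) (hκm.comp ?_))
      fun_prop
  -- passage to the angular kernel
  have hsub : {x ∈ posOrthant (n + 1) | (∀ i, x i ≤ x j) ∧
        L / (2 * ((n : ℝ) + 1)) ≤ x j ∧ x j ≤ 2 * L ∧
        ENNReal.ofReal l < ENNReal.ofReal (Real.exp (∑ i, x i)) *
          ∫⁻ y, ENNReal.ofReal ((boxVol α (sqrtVec x) (admissibleRadius (sqrtVec x) +
            rayGap j (sqrtVec x) (sqrtVec y)))⁻¹) * g y ∂μ} ⊆ E := by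
    rintro x ⟨hx, hmax, h1, h2, h3⟩
    refine ⟨hx, ⟨h1, h2⟩, ?_⟩
    have hint : ∫⁻ y, ENNReal.ofReal ((boxVol α (sqrtVec x) (admissibleRadius (sqrtVec x) +
            rayGap j (sqrtVec x) (sqrtVec y)))⁻¹) * g y ∂μ ≤
        ENNReal.ofReal (C₀ * L ^ (1 - D)) * W (fun i => x (j.succAbove i) / x j) := by
      rw [hW]
      exact hker g L x hL hx hmax h1 h2
    calc (1 : ENNReal) = ENNReal.ofReal l⁻¹ * ENNReal.ofReal l := by
          rw [← ENNReal.ofReal_mul (by positivity), inv_mul_cancel₀ hl.ne', ENNReal.ofReal_one]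
      _ < ENNReal.ofReal l⁻¹ * (ENNReal.ofReal (Real.exp (∑ i, x i)) *
          ∫⁻ y, ENNReal.ofReal ((boxVol α (sqrtVec x) (admissibleRadius (sqrtVec x) +
            rayGap j (sqrtVec x) (sqrtVec y)))⁻¹) * g y ∂μ) := by
          refine ENNReal.mul_lt_mul_right ?_ ENNReal.ofReal_ne_top h3
          simpa using hl
      _ ≤ ENNReal.ofReal l⁻¹ * (ENNReal.ofReal (Real.exp (∑ i, x i)) *
          (ENNReal.ofReal (C₀ * L ^ (1 - D)) * W (fun i => x (j.succAbove i) / x j))) := by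
          gcongr
      _ = _ := by
          simp only [hκ]
          rw [div_eq_inv_mul, ENNReal.ofReal_mul (inv_nonneg.2 hl.le)]
          ring
  refine (measure_mono hsub).trans ?_
  -- integration in projective coordinates
  set F : (Fin (n + 1) → ℝ) → ENNReal := E.indicator fun x =>
    ENNReal.ofReal ((∏ i, x i ^ α i) * Real.exp (-∑ i, x i)) with hF
  have hFm : Measurable F := Measurable.indicator (by fun_prop) hEm
  have hμE : μ E = ∫⁻ x, F x := by
    rw [hμ, laguerreMeasure_apply α hEm, Set.inter_eq_left.2 (fun x hx => hx.1),
      ← lintegral_indicator hEm]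
  have hF0 : ∀ x, x j ≤ 0 → F x = 0 := fun x hx =>
    Set.indicator_of_notMem (fun h => absurd (h.1 j) (not_lt.2 hx)) _
  rw [hμE, lintegral_eq_lintegral_projective j hFm hF0]
  have hpt : ∀ (θ : Fin n → ℝ) (q : ℝ), 0 < q →
      ENNReal.ofReal (q ^ n) * F (j.insertNth q (q • θ)) ≤
      (posOrthant n).indicator (fun θ => ENNReal.ofReal (∏ i, θ i ^ α (j.succAbove i)) *
        ENNReal.ofReal (K * L ^ (D - 1)) *
        {q : ℝ | 1 < ENNReal.ofReal (Real.exp (q * (1 + ∑ i, θ i))) * κ θ}.indicator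
          (fun q => ENNReal.ofReal (Real.exp (-(q * (1 + ∑ i, θ i))))) q) θ := by
    intro θ q hq
    by_cases hxE : (j.insertNth q (q • θ) : Fin (n + 1) → ℝ) ∈ E
    · obtain ⟨hx, ⟨hx1, hx2⟩, hx3⟩ := id hxE
      rw [Fin.insertNth_apply_same] at hx1 hx2
      have hθ : θ ∈ posOrthant n := fun i => by
        have := hx (j.succAbove i)
        rw [Fin.insertNth_apply_succAbove, Pi.smul_apply, smul_eq_mul] at this
        exact pos_of_mul_pos_right this hq.le
      have hdir : (fun i => (j.insertNth q (q • θ) : Fin (n + 1) → ℝ) (j.succAbove i) /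
          (j.insertNth q (q • θ) : Fin (n + 1) → ℝ) j) = θ := by
        ext i
        rw [Fin.insertNth_apply_same, Fin.insertNth_apply_succAbove, Pi.smul_apply, smul_eq_mul,
          mul_div_cancel_left₀ _ hq.ne']
      have hsum : ∑ i, (j.insertNth q (q • θ) : Fin (n + 1) → ℝ) i = q * (1 + ∑ i, θ i) := by
        rw [Fin.sum_univ_succAbove _ j]
        simp only [Fin.insertNth_apply_same, Fin.insertNth_apply_succAbove, Pi.smul_apply,
          smul_eq_mul]
        rw [← Finset.mul_sum]; ring
      have hFx : F (j.insertNth q (q • θ)) = ENNReal.ofReal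
          ((∏ i, (j.insertNth q (q • θ) : Fin (n + 1) → ℝ) i ^ α i) *
            Real.exp (-∑ i, (j.insertNth q (q • θ) : Fin (n + 1) → ℝ) i)) :=
        Set.indicator_of_mem hxE _
      rw [hdir, hsum] at hx3
      rw [Set.indicator_of_mem hθ, Set.indicator_of_mem (Set.mem_ofPred_eq ▸ hx3), hFx,
        ← ENNReal.ofReal_mul (by positivity), density_insertNth α j hq hθ]
      have hprod : 0 ≤ ∏ i, θ i ^ α (j.succAbove i) :=
        Finset.prod_nonneg fun i _ => Real.rpow_nonneg (hθ i).le _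
      rw [← ENNReal.ofReal_mul hprod, ← ENNReal.ofReal_mul (by positivity)]
      apply ENNReal.ofReal_le_ofReal
      refine mul_le_mul_of_nonneg_right (mul_le_mul_of_nonneg_left ?_ hprod) (Real.exp_pos _).le
      refine rpow_le_of_comparable hq hL0 ?_ ?_ _
      · nlinarith [n.cast_nonneg (α := ℝ)]
      · rw [div_le_iff₀ (by positivity)] at hx1
        linarith
    · rw [hF, Set.indicator_of_notMem hxE, mul_zero]
      exact zero_le
  have hinner : ∀ θ : Fin n → ℝ, ∫⁻ q in Set.Ioi (0 : ℝ),
      ENNReal.ofReal (q ^ n) * F (j.insertNth q (q • θ)) ≤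
      (posOrthant n).indicator (fun θ => ENNReal.ofReal (K * C₀ / l) *
        (ENNReal.ofReal (∏ i, θ i ^ α (j.succAbove i)) * W θ)) θ := by
    intro θ
    refine (setLIntegral_mono' measurableSet_Ioi fun q hq => hpt θ q hq).trans ?_
    by_cases hθ : θ ∈ posOrthant n
    · simp only [Set.indicator_of_mem hθ]
      have hS : 1 ≤ 1 + ∑ i, θ i :=
        le_add_of_nonneg_right (Finset.sum_nonneg fun i _ => (hθ i).le)
      have hAm : MeasurableSet
          {q : ℝ | 1 < ENNReal.ofReal (Real.exp (q * (1 + ∑ i, θ i))) * κ θ} :=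
        measurableSet_lt measurable_const (Measurable.mul (by fun_prop) measurable_const)
      refine (setLIntegral_le_lintegral _ _).trans ?_
      rw [lintegral_const_mul _ (Measurable.indicator (by fun_prop) hAm), lintegral_indicator hAm]
      refine (mul_le_mul_right (lintegral_exp_neg_superlevel_le (κ θ) hS) _).trans ?_
      apply le_of_eq
      have hLL : K * L ^ (D - 1) * (C₀ * L ^ (1 - D) / l) = K * C₀ / l := by
        have : L ^ (D - 1) * L ^ (1 - D) = 1 := by rw [← Real.rpow_add hL0]; simp
        linear_combination (K * C₀ / l) * this
      rw [← hLL, ENNReal.ofReal_mul (p := K * L ^ (D - 1)) (by positivity)]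
      simp only [hκ]
      ring
    · simp only [Set.indicator_of_notMem hθ]
      simp
  refine (lintegral_mono hinner).trans ?_
  rw [lintegral_indicator (measurableSet_posOrthant n), lintegral_const_mul' _ _ ENNReal.ofReal_ne_top]
  refine (mul_le_mul_right (hW ▸ hang (1 / L) g (by positivity) hg) _).trans ?_
  rw [← mul_assoc, ← ENNReal.ofReal_mul (by positivity)]
  apply le_of_eq
  congr 2
  ring

/-- Weak type estimate for the global part of the maximal operator, at high levels. -/
theorem laguerreMeasure_global_le {n : ℕ} {α : Fin (n + 1) → ℝ} (hα : ∀ i, -1 < α i)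
    (j : Fin (n + 1)) :
    ∃ C Λ : ℝ, 0 < C ∧ 0 < Λ ∧ ∀ (g : (Fin (n + 1) → ℝ) → ENNReal) (F l : ℝ), Measurable g →
      0 < F → ∫⁻ y, g y ∂(laguerreMeasure α) = ENNReal.ofReal F → Λ * F ≤ l →
      laguerreMeasure α {x ∈ posOrthant (n + 1) | (∀ i, x i ≤ x j) ∧
        ENNReal.ofReal l < ENNReal.ofReal (Real.exp (∑ i, x i)) *
          ∫⁻ y, ENNReal.ofReal ((boxVol α (sqrtVec x) (admissibleRadius (sqrtVec x) +
            rayGap j (sqrtVec x) (sqrtVec y)))⁻¹) * g y ∂(laguerreMeasure α)} ≤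
      ENNReal.ofReal (C * F / l) := by
  obtain ⟨C₁, hC₁, hann⟩ := laguerreMeasure_annulus_le hα j
  obtain ⟨C₂, hC₂, htail⟩ := laguerreMeasure_exp_ge_le hα
  obtain ⟨C₃, hC₃, hbox⟩ := exists_inv_boxVol_le_exp hα
  have hΛ0 : 0 < Real.exp 1 + C₃ ^ 4 := by positivity
  refine ⟨C₂ + C₁, Real.exp 1 + C₃ ^ 4, by positivity, hΛ0, fun g F l hg hF hgF hl => ?_⟩
  have hl0 : 0 < l := lt_of_lt_of_le (by positivity) hl
  obtain ⟨Λ, hΛ⟩ : ∃ Λ, Λ = l / F := ⟨_, rfl⟩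
  have hΛge : Real.exp 1 + C₃ ^ 4 ≤ Λ := by rw [hΛ, le_div_iff₀ hF]; exact hl
  have hΛpos : 0 < Λ := hΛ0.trans_le hΛge
  have hlΛ : l = Λ * F := by rw [hΛ]; field_simp
  obtain ⟨L, hL⟩ : ∃ L, L = Real.log Λ := ⟨_, rfl⟩
  have hexpL : Real.exp L = Λ := by rw [hL, Real.exp_log hΛpos]
  have hL1 : 1 ≤ L := by
    rw [hL, Real.le_log_iff_exp_le hΛpos]
    exact le_trans (le_add_of_nonneg_right (by positivity)) hΛge
  have hC₃L : C₃ ≤ Real.exp (L / 4) := by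
    refine le_of_pow_le_pow_left₀ (n := 4) (by norm_num) (Real.exp_pos _).le ?_
    rw [← Real.exp_nat_mul, show ((4 : ℕ) : ℝ) * (L / 4) = L by push_cast; ring, hexpL]
    exact le_trans (le_add_of_nonneg_left (by positivity)) hΛge
  refine (measure_mono (t := {x | 2 * L ≤ ∑ i, x i} ∪
    {x ∈ posOrthant (n + 1) | (∀ i, x i ≤ x j) ∧ L / (2 * ((n : ℝ) + 1)) ≤ x j ∧ x j ≤ 2 * L ∧
        ENNReal.ofReal l < ENNReal.ofReal (Real.exp (∑ i, x i)) *
          ∫⁻ y, ENNReal.ofReal ((boxVol α (sqrtVec x) (admissibleRadius (sqrtVec x) +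
            rayGap j (sqrtVec x) (sqrtVec y)))⁻¹) * g y ∂(laguerreMeasure α)}) ?_).trans ?_
  · rintro x ⟨hx, hmax, hlt⟩
    rcases le_or_gt (2 * L) (∑ i, x i) with h2 | h2
    · exact Or.inl h2
    refine Or.inr ⟨hx, hmax, ?_, ?_, hlt⟩
    · rw [div_le_iff₀ (by positivity)]
      have hsum : ∑ i, x i ≤ ((n : ℝ) + 1) * x j := by
        have := Finset.sum_le_sum (s := Finset.univ) fun i _ => hmax i
        simpa using this
      by_contra hlt2
      have hsmall : ∑ i, x i < L / 2 := by linarith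
      have hbound : ∫⁻ y, ENNReal.ofReal ((boxVol α (sqrtVec x) (admissibleRadius (sqrtVec x) +
          rayGap j (sqrtVec x) (sqrtVec y)))⁻¹) * g y ∂(laguerreMeasure α) ≤
          ENNReal.ofReal (C₃ * Real.exp (1 / 2 * ∑ i, x i)) * ENNReal.ofReal F := by
        rw [← hgF, ← lintegral_const_mul' _ _ ENNReal.ofReal_ne_top]
        refine lintegral_mono fun y => ?_
        exact mul_le_mul_left (ENNReal.ofReal_le_ofReal (hbox x hx _
          (le_add_of_nonneg_right (rayGap_nonneg _ _ _)))) _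
      have h3 := hlt.trans_le (mul_le_mul_right hbound _)
      rw [← ENNReal.ofReal_mul (by positivity), ← ENNReal.ofReal_mul (by positivity)] at h3
      have h4 := (ENNReal.ofReal_lt_ofReal_iff_of_nonneg hl0.le).1 h3
      have h5 : Real.exp (∑ i, x i) * (C₃ * Real.exp (1 / 2 * ∑ i, x i) * F) ≤ Λ * F := by
        calc Real.exp (∑ i, x i) * (C₃ * Real.exp (1 / 2 * ∑ i, x i) * F)
            = C₃ * Real.exp (∑ i, x i + 1 / 2 * ∑ i, x i) * F := by rw [Real.exp_add]; ring
          _ ≤ Real.exp (L / 4) * Real.exp (3 / 4 * L) * F := by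
              gcongr
              linarith
          _ = Λ * F := by rw [← Real.exp_add, ← hexpL]; ring_nf
      linarith
    · exact (Finset.single_le_sum (fun i _ => (hx i).le) (Finset.mem_univ j)).trans h2.le
  · refine (measure_union_le _ _).trans ?_
    refine (add_le_add (htail L) (hann g L l hg hL1 hl0)).trans ?_
    rw [hgF, ← ENNReal.ofReal_mul (by positivity), ← ENNReal.ofReal_add (by positivity)
      (by positivity)]
    apply ENNReal.ofReal_le_ofReal
    rw [Real.exp_neg, hexpL, hΛ]
    apply le_of_eq
    field_simp

theorem laguerreSemigroup_enorm_le {d : ℕ} (α : Fin d → ℝ) {t : ℝ} {f : (Fin d → ℝ) → ℂ}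
    {g : (Fin d → ℝ) → ENNReal} (hfg : (fun y => ‖f y‖ₑ) =ᵐ[laguerreMeasure α] g)
    {x : Fin d → ℝ} (h0 : ∀ y ∈ posOrthant d, 0 ≤ laguerreKernel α t x y) :
    ‖laguerreSemigroup α t f x‖ₑ ≤
      ∫⁻ y, ENNReal.ofReal (laguerreKernel α t x y) * g y ∂(laguerreMeasure α) := by
  refine (enorm_integral_le_lintegral_enorm _).trans (lintegral_mono_ae ?_)
  filter_upwards [hfg, ae_mem_posOrthant α] with y hy hyp
  rw [enorm_mul, ← hy, ← ofReal_norm, Complex.norm_real, Real.norm_of_nonneg (h0 y hyp)]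

theorem measurable_laguerreKernel {d : ℕ} {α : Fin d → ℝ} (hα : ∀ i, -1 < α i) {t : ℝ} (ht : 0 < t)
    (x : Fin d → ℝ) : Measurable fun y => laguerreKernel α t x y := by
  have h1 : ∀ i, Measurable fun y : ℝ => laguerreKernel₁ (α i) t (x i) y := fun i => by
    refine measurable_of_tendsto_metrizable
      (f := fun N y => ∑ n ∈ Finset.range N, laguerreKernelTerm (α i) t (x i) y n) (fun N => ?_) ?_
    · unfold laguerreKernelTerm laguerreNormalized laguerrePoly
      fun_prop
    · exact tendsto_pi_nhds.2 fun y => (summable_laguerreKernelTerm (hα i) ht (x i) y).hasSum.tendsto_sum_nat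
  unfold laguerreKernel
  exact Finset.measurable_prod _ fun i _ => (h1 i).comp (measurable_pi_apply i)

theorem exists_sqrt_exp_neg {t : ℝ} (ht : 0 < t) :
    ∃ ρ s : ℝ, 0 < ρ ∧ 0 < s ∧ ρ ^ 2 = Real.exp (-t) ∧ s ^ 2 = 1 - Real.exp (-t) := by
  have h : 0 < 1 - Real.exp (-t) := by simpa using ht
  exact ⟨√(Real.exp (-t)), √(1 - Real.exp (-t)), Real.sqrt_pos.2 (Real.exp_pos _),
    Real.sqrt_pos.2 h, Real.sq_sqrt (Real.exp_pos _).le, Real.sq_sqrt h.le⟩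

theorem integrable_laguerreKernel_mul {d : ℕ} {α : Fin d → ℝ} (hα : ∀ i, -1 < α i)
    {f : (Fin d → ℝ) → ℂ} (hf : Integrable f (laguerreMeasure α)) {t : ℝ} (ht : 0 < t)
    {x : Fin d → ℝ} (hx : x ∈ posOrthant d) :
    Integrable (fun y => (laguerreKernel α t x y : ℂ) * f y) (laguerreMeasure α) := by
  obtain ⟨C, hC, hker⟩ := laguerreKernel_le hα
  obtain ⟨ρ, s, hρ, hs, hρt, hst⟩ := exists_sqrt_exp_neg ht
  refine hf.bdd_mul (c := C * (Real.exp (∑ i, x i) * (1 / boxVol α (sqrtVec x) s)))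
    ((Complex.measurable_ofReal.comp (measurable_laguerreKernel hα ht x)).aestronglyMeasurable) ?_
  filter_upwards [ae_mem_posOrthant α] with y hy
  obtain ⟨h0, hle⟩ := hker x y ρ s t hx hy ht hρ hs hρt hst
  change ‖((laguerreKernel α t x y : ℝ) : ℂ)‖ ≤ _
  rw [Complex.norm_real, Real.norm_of_nonneg h0]
  refine hle.trans ?_
  have := boxVol_pos α (sqrtVec x) hs
  gcongr
  rw [Real.exp_le_one_iff]
  have : 0 ≤ ‖sqrtVec x - ρ • sqrtVec y‖ ^ 2 / (2 * s ^ 2) := by positivity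
  linarith

/-- Splits the semigroup into a global part and averages over admissible balls. -/
theorem lintegral_laguerreKernel_le {n : ℕ} {α : Fin (n + 1) → ℝ} (hα : ∀ i, -1 < α i) :
    ∃ C : ℝ, 0 < C ∧ ∀ (j : Fin (n + 1)) (x : Fin (n + 1) → ℝ) (t : ℝ)
      (g : (Fin (n + 1) → ℝ) → ENNReal), Measurable g → x ∈ posOrthant (n + 1) → 0 < t →
      ∃ r : ℕ → ℝ, (∀ k, 0 < r k ∧ r k ≤ admissibleRadius (sqrtVec x)) ∧
        ∫⁻ y, ENNReal.ofReal (laguerreKernel α t x y) * g y ∂(laguerreMeasure α) ≤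
          ENNReal.ofReal C * (ENNReal.ofReal (Real.exp (∑ i, x i)) *
            ∫⁻ y, ENNReal.ofReal ((boxVol α (sqrtVec x) (admissibleRadius (sqrtVec x) +
              rayGap j (sqrtVec x) (sqrtVec y)))⁻¹) * g y ∂(laguerreMeasure α)) +
          ∑' k, ENNReal.ofReal (C * ((1 / 2) ^ k *
            (Real.exp (∑ i, x i) / boxVol α (sqrtVec x) (r k)))) *
            ∫⁻ y in sqrtVec ⁻¹' Metric.closedBall (sqrtVec x) (r k), g y ∂(laguerreMeasure α) := by
  obtain ⟨C₁, hC₁, hker⟩ := laguerreKernel_le hα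
  obtain ⟨C₂, hC₂, hgauss⟩ := gaussian_div_boxVol_le hα
  refine ⟨C₁ * C₂, by positivity, fun j x t g hg hx ht => ?_⟩
  obtain ⟨ρ, s, hρ, hs, hρt, hst⟩ := exists_sqrt_exp_neg ht
  have hr0 := admissibleRadius_pos (sqrtVec x)
  obtain ⟨r, hr⟩ : ∃ r : ℕ → ℝ, r = fun k => min (2 ^ k * s) (admissibleRadius (sqrtVec x)) :=
    ⟨_, rfl⟩
  have hrpos : ∀ k, 0 < r k := fun k => by rw [hr]; exact lt_min (by positivity) hr0
  refine ⟨r, fun k => ⟨hrpos k, by rw [hr]; exact min_le_right _ _⟩, ?_⟩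
  have hball : ∀ k, MeasurableSet (sqrtVec ⁻¹' Metric.closedBall (sqrtVec x) (r k)) := fun k =>
    measurable_sqrtVec Metric.isClosed_closedBall.measurableSet
  have hpt : ∀ᵐ y ∂(laguerreMeasure α), ENNReal.ofReal (laguerreKernel α t x y) * g y ≤
      ENNReal.ofReal (C₁ * C₂) * ENNReal.ofReal (Real.exp (∑ i, x i)) *
        (ENNReal.ofReal ((boxVol α (sqrtVec x) (admissibleRadius (sqrtVec x) +
              rayGap j (sqrtVec x) (sqrtVec y)))⁻¹) * g y) +
      ∑' k, ENNReal.ofReal (C₁ * C₂ * ((1 / 2) ^ k *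
            (Real.exp (∑ i, x i) / boxVol α (sqrtVec x) (r k)))) *
          (sqrtVec ⁻¹' Metric.closedBall (sqrtVec x) (r k)).indicator g y := by
    filter_upwards [ae_mem_posOrthant α] with y hy
    have h1 := (hker x y ρ s t hx hy ht hρ hs hρt hst).2
    rcases hgauss j (sqrtVec x) (sqrtVec y) ρ s (fun i => Real.sqrt_pos.2 (hy i)) hρ hs
      (by rw [hρt, hst]; ring) with h2 | ⟨k, hk, h2⟩
    · refine le_add_right ?_
      rw [← mul_assoc, ← ENNReal.ofReal_mul (by positivity), ← ENNReal.ofReal_mul (by positivity)]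
      refine mul_le_mul_left (ENNReal.ofReal_le_ofReal (h1.trans ?_)) _
      refine (mul_le_mul_of_nonneg_left (mul_le_mul_of_nonneg_left h2 (Real.exp_pos _).le)
        hC₁.le).trans_eq ?_
      rw [div_eq_mul_inv]
      ring
    · refine le_add_left (le_trans ?_ (ENNReal.le_tsum k))
      have hmem : y ∈ sqrtVec ⁻¹' Metric.closedBall (sqrtVec x) (r k) := by
        rw [Set.mem_preimage, Metric.mem_closedBall, dist_comm, dist_eq_norm, hr]
        exact hk
      rw [Set.indicator_of_mem hmem]
      refine mul_le_mul_left (ENNReal.ofReal_le_ofReal (h1.trans ?_)) _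
      refine (mul_le_mul_of_nonneg_left (mul_le_mul_of_nonneg_left h2 (Real.exp_pos _).le)
        hC₁.le).trans_eq ?_
      rw [hr]
      ring
  refine (lintegral_mono_ae hpt).trans ?_
  rw [lintegral_add_right]
  · rw [lintegral_const_mul' _ _ (ENNReal.mul_ne_top ENNReal.ofReal_ne_top ENNReal.ofReal_ne_top),
      lintegral_tsum fun k => ((hg.indicator (hball k)).const_mul _).aemeasurable, mul_assoc]
    gcongr with k
    rw [lintegral_const_mul _ (hg.indicator (hball k)), lintegral_indicator (hball k)]
  · exact Measurable.tsum fun k => (hg.indicator (hball k)).const_mul _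

theorem lintegral_laguerreKernel_le_of_averages_le {n : ℕ} {α : Fin (n + 1) → ℝ}
    (hα : ∀ i, -1 < α i) :
    ∃ C : ℝ, 0 < C ∧ ∀ (j : Fin (n + 1)) (x : Fin (n + 1) → ℝ) (t l : ℝ)
      (g : (Fin (n + 1) → ℝ) → ENNReal), Measurable g → x ∈ posOrthant (n + 1) → 0 < t → 0 < l →
      (∀ r, 0 < r → r ≤ admissibleRadius (sqrtVec x) →
        ∫⁻ y in sqrtVec ⁻¹' Metric.closedBall (sqrtVec x) r, g y ∂(laguerreMeasure α) ≤
          ENNReal.ofReal (l / (4 * C) * (Real.exp (-∑ i, x i) * boxVol α (sqrtVec x) r))) →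
      ENNReal.ofReal (Real.exp (∑ i, x i)) *
          ∫⁻ y, ENNReal.ofReal ((boxVol α (sqrtVec x) (admissibleRadius (sqrtVec x) +
            rayGap j (sqrtVec x) (sqrtVec y)))⁻¹) * g y ∂(laguerreMeasure α) ≤
        ENNReal.ofReal (l / (2 * C)) →
      ∫⁻ y, ENNReal.ofReal (laguerreKernel α t x y) * g y ∂(laguerreMeasure α) ≤
        ENNReal.ofReal l := by
  obtain ⟨C, hC, h⟩ := lintegral_laguerreKernel_le hα
  refine ⟨C, hC, fun j x t l g hg hx ht hl hloc hglob => ?_⟩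
  obtain ⟨r, hr, hle⟩ := h j x t g hg hx ht
  have hterm : ∀ k, ENNReal.ofReal (C * ((1 / 2) ^ k *
      (Real.exp (∑ i, x i) / boxVol α (sqrtVec x) (r k)))) *
      ∫⁻ y in sqrtVec ⁻¹' Metric.closedBall (sqrtVec x) (r k), g y ∂(laguerreMeasure α) ≤
      ENNReal.ofReal (l / 4 * (1 / 2) ^ k) := fun k => by
    have hb := boxVol_pos α (sqrtVec x) (hr k).1
    refine (mul_le_mul_right (hloc (r k) (hr k).1 (hr k).2) _).trans ?_
    rw [← ENNReal.ofReal_mul (by positivity)]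
    apply ENNReal.ofReal_le_ofReal
    rw [Real.exp_neg]
    apply le_of_eq
    field_simp
  refine hle.trans ((add_le_add (mul_le_mul_right hglob _) (ENNReal.tsum_le_tsum hterm)).trans ?_)
  rw [← ENNReal.ofReal_tsum_of_nonneg (fun k => by positivity)
    (summable_geometric_two.mul_left _), tsum_mul_left, tsum_geometric_two,
    ← ENNReal.ofReal_mul hC.le, ← ENNReal.ofReal_add (by positivity) (by positivity)]
  apply ENNReal.ofReal_le_ofReal
  apply le_of_eq
  field_simp
  norm_num

theorem laguerreMaximal_superlevel_le {n : ℕ} {α : Fin (n + 1) → ℝ} (hα : ∀ i, -1 < α i) :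
    ∃ C : ℝ, 0 < C ∧ ∀ f : (Fin (n + 1) → ℝ) → ℂ, Integrable f (laguerreMeasure α) →
      ∀ l : ℝ, 0 < l →
        laguerreMeasure α {x ∈ posOrthant (n + 1) | ENNReal.ofReal l < laguerreMaximal α f x} ≤
          ENNReal.ofReal (C / l * ∫ x, ‖f x‖ ∂(laguerreMeasure α)) := by
  obtain ⟨C, hC, hpt⟩ := lintegral_laguerreKernel_le_of_averages_le hα
  obtain ⟨C₁, hC₁, hloc⟩ := laguerreMeasure_local_le hα
  choose C₂ Λ hC₂ hΛ hglob using laguerreMeasure_global_le hα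
  obtain ⟨M, hM, huniv⟩ := laguerreMeasure_univ_le hα
  obtain ⟨_, _, hker⟩ := laguerreKernel_le hα
  have hC₂s : 0 ≤ ∑ j, C₂ j := Finset.sum_nonneg fun j _ => (hC₂ j).le
  have hΛs : 0 ≤ ∑ j, Λ j := Finset.sum_nonneg fun j _ => (hΛ j).le
  refine ⟨4 * C * C₁ + 2 * C * ∑ j, C₂ j + M * (2 * C * ∑ j, Λ j), by positivity,
    fun f hf l hl => ?_⟩
  obtain ⟨g, hg, hfg⟩ := hf.aestronglyMeasurable.enorm
  obtain ⟨F, hF⟩ : ∃ F, F = ∫ x, ‖f x‖ ∂(laguerreMeasure α) := ⟨_, rfl⟩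
  have hF0 : 0 ≤ F := hF ▸ integral_nonneg fun _ => norm_nonneg _
  have hgF : ∫⁻ y, g y ∂(laguerreMeasure α) = ENNReal.ofReal F := by
    rw [hF, ofReal_integral_norm_eq_lintegral_enorm hf]
    exact lintegral_congr_ae hfg.symm
  rw [← hF]
  have hT : ∀ x ∈ posOrthant (n + 1), ∀ t, 0 < t → ‖laguerreSemigroup α t f x‖ₑ ≤
      ∫⁻ y, ENNReal.ofReal (laguerreKernel α t x y) * g y ∂(laguerreMeasure α) := by
    intro x hx t ht
    obtain ⟨ρ, s, hρ, hs, hρt, hst⟩ := exists_sqrt_exp_neg ht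
    exact laguerreSemigroup_enorm_le α hfg fun y hy => (hker x y ρ s t hx hy ht hρ hs hρt hst).1
  rcases hF0.eq_or_lt with hFz | hFpos
  · have hg0 : g =ᵐ[laguerreMeasure α] 0 := by
      rw [← lintegral_eq_zero_iff hg, hgF, ← hFz, ENNReal.ofReal_zero]
    have : {x ∈ posOrthant (n + 1) | ENNReal.ofReal l < laguerreMaximal α f x} = ∅ := by
      refine Set.eq_empty_of_forall_notMem fun x hx => absurd hx.2 (not_lt.2 ?_)
      refine iSup₂_le fun t ht => (hT x hx.1 t ht).trans ?_
      rw [lintegral_congr_ae (g := fun _ => 0) (by filter_upwards [hg0] with y hy; simp [hy])]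
      simp
    rw [this, measure_empty]
    exact zero_le
  rcases le_or_gt (2 * C * (∑ j, Λ j) * F) l with hlarge | hsmall
  · have hsub : {x ∈ posOrthant (n + 1) | ENNReal.ofReal l < laguerreMaximal α f x} ⊆
        {x ∈ posOrthant (n + 1) | ∃ ρ, 0 < ρ ∧ ρ ≤ admissibleRadius (sqrtVec x) ∧
          ENNReal.ofReal (l / (4 * C) * (Real.exp (-∑ i, x i) * boxVol α (sqrtVec x) ρ)) <
            ∫⁻ y in sqrtVec ⁻¹' Metric.closedBall (sqrtVec x) ρ, g y ∂(laguerreMeasure α)} ∪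
        ⋃ j, {x ∈ posOrthant (n + 1) | (∀ i, x i ≤ x j) ∧
          ENNReal.ofReal (l / (2 * C)) < ENNReal.ofReal (Real.exp (∑ i, x i)) *
            ∫⁻ y, ENNReal.ofReal ((boxVol α (sqrtVec x) (admissibleRadius (sqrtVec x) +
              rayGap j (sqrtVec x) (sqrtVec y)))⁻¹) * g y ∂(laguerreMeasure α)} := by
      rintro x ⟨hx, hlt⟩
      by_contra hnot
      simp only [Set.mem_union, Set.mem_iUnion, not_or, not_exists] at hnot
      obtain ⟨hn1, hn2⟩ := hnot
      obtain ⟨j, hj⟩ := Finite.exists_max x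
      refine absurd hlt (not_lt.2 (iSup₂_le fun t ht => (hT x hx t ht).trans ?_))
      refine hpt j x t l g hg hx ht hl (fun r hr0 hr => ?_) ?_
      · by_contra hlt'
        exact hn1 ⟨hx, r, hr0, hr, not_le.1 hlt'⟩
      · by_contra hlt'
        exact hn2 j ⟨hx, hj, not_le.1 hlt'⟩
    refine (measure_mono hsub).trans ((measure_union_le _ _).trans ?_)
    have hG : ∀ j, laguerreMeasure α {x ∈ posOrthant (n + 1) | (∀ i, x i ≤ x j) ∧
          ENNReal.ofReal (l / (2 * C)) < ENNReal.ofReal (Real.exp (∑ i, x i)) *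
            ∫⁻ y, ENNReal.ofReal ((boxVol α (sqrtVec x) (admissibleRadius (sqrtVec x) +
              rayGap j (sqrtVec x) (sqrtVec y)))⁻¹) * g y ∂(laguerreMeasure α)} ≤
        ENNReal.ofReal (C₂ j * F / (l / (2 * C))) := fun j => by
      refine hglob j g F _ hg hFpos hgF ?_
      rw [le_div_iff₀ (by positivity)]
      refine le_trans ?_ hlarge
      have := Finset.single_le_sum (fun i _ => (hΛ i).le) (Finset.mem_univ j)
      calc Λ j * F * (2 * C) = 2 * C * Λ j * F := by ring
        _ ≤ _ := by gcongr
    refine (add_le_add (hloc g (l / (4 * C)) (by positivity)) ((measure_iUnion_fintype_le _ _).trans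
      (Finset.sum_le_sum fun j _ => hG j))).trans ?_
    rw [hgF, ← ENNReal.ofReal_mul (by positivity),
      ← ENNReal.ofReal_sum_of_nonneg fun j _ => by have := hC₂ j; positivity,
      ← ENNReal.ofReal_add (by positivity)
        (Finset.sum_nonneg fun j _ => by have := hC₂ j; positivity)]
    apply ENNReal.ofReal_le_ofReal
    rw [← Finset.sum_div, ← Finset.sum_mul]
    calc C₁ / (l / (4 * C)) * F + (∑ j, C₂ j) * F / (l / (2 * C))
        = (4 * C * C₁ + 2 * C * ∑ j, C₂ j) / l * F := by field_simp
      _ ≤ _ := by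
        refine mul_le_mul_of_nonneg_right (div_le_div_of_nonneg_right ?_ hl.le) hF0
        exact le_add_of_nonneg_right (by positivity)
  · refine (measure_mono (Set.subset_univ _)).trans (huniv.trans (ENNReal.ofReal_le_ofReal ?_))
    rw [div_mul_eq_mul_div, le_div_iff₀ hl]
    have h1 : M * l ≤ M * (2 * C * (∑ j, Λ j) * F) := by gcongr
    have h2 : 0 ≤ (4 * C * C₁ + 2 * C * ∑ j, C₂ j) * F := by positivity
    linarith

theorem theorem2p1 (d : ℕ) (hd : 1 ≤ d) (α : Fin d → ℝ) (hα : ∀ i, -1 < α i) :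
    -- the series defining the kernel converges
    (∀ t : ℝ, 0 < t → ∀ x ∈ posOrthant d, ∀ y ∈ posOrthant d, ∀ i : Fin d,
      Summable (laguerreKernelTerm (α i) t (x i) (y i))) ∧
    -- the integral defining the semigroup converges absolutely on all of `L¹`
    (∀ f : (Fin d → ℝ) → ℂ, Integrable f (laguerreMeasure α) →
      ∀ t : ℝ, 0 < t → ∀ x ∈ posOrthant d,
        Integrable (fun y => (laguerreKernel α t x y : ℂ) * f y) (laguerreMeasure α)) ∧
    -- the weak type (1,1) estimate
    ∃ C : ℝ, 0 < C ∧
      ∀ f : (Fin d → ℝ) → ℂ, Integrable f (laguerreMeasure α) → ∀ l : ℝ, 0 < l →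
        laguerreMeasure α {x ∈ posOrthant d | ENNReal.ofReal l < laguerreMaximal α f x} ≤
          ENNReal.ofReal (C / l * ∫ x, ‖f x‖ ∂(laguerreMeasure α)) := by
  refine ⟨fun t ht x _ y _ i => summable_laguerreKernelTerm (hα i) ht (x i) (y i),
    fun f hf t ht x hx => integrable_laguerreKernel_mul hα hf ht hx, ?_⟩
  obtain ⟨n, rfl⟩ := Nat.exists_eq_succ_of_ne_zero (Nat.one_le_iff_ne_zero.1 hd)
  exact laguerreMaximal_superlevel_le hα
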